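/- **Setting.** Data $(x_i,y_i)_{i\le n}$ with design points $x_i$, a candidate point $x_{n+1}$ and candidate value $a\in\mathbb R$. The model is one of the following, with known $\sigma^2>0$ and independent errors $\varepsilon_i\sim N(0,\sigma^2)$, $y_i=f(x_i)+\varepsilon_i$: * *Basis expansion*: $f(x)=\sum_{k\le K}\beta_k\phi_k(x)$, $\beta\sim N(\beta_0,\sigma^2V)$, $V$ positive definite; $z_i=(\phi_1(x_i),\dots,\phi_K(x_i))^T$, $Z$ has rows $z_i^T$. * *Gaussian process*: $f\sim GP(m,k)$. Let $p_i$ be the Bayes posterior predictive law of the response at $x_i$ given all data except $(x_i,y_i)$, and $q_i(\cdot;a)$ the one given the data with $(x_i,y_i)$ replaced by $(x_{n+1},a)$. Let $D$ be the squared Hellinger distance $1-\int\sqrt{pq}$, or the density power divergence with $\alpha>0$, $d_\alpha(g,f)=\int\{f^{1+\alpha}-(1+\frac1\alpha)gf^\alpha+\frac1\alpha g^{1+\alpha}\}$, in either order of arguments. Put $J(y;a)=\sum_iD(p_i,q_i(\cdot;a))$, $\psi_i=\partial_aD(p_i,q_i(\cdot;a))$, $\psi(y;a)=\sum_i\psi_i$,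 where $y=(y_1,\dots,y_n)$. For a law $\mu$ of $y$ on $\mathbb R^n$ put $\Psi(a;\mu)=E_\mu\psi(Y;a)$; at a root $a$ of $\Psi(\cdot;\mu)$ with $\partial_a\Psi\ne0$ the influence function is $\mathrm{IF}(z)=-\psi(z;a)/\partial_a\Psi(a;\mu)$. For any score the asymptotic variance at a root is $\mathrm{Var}_\mu(\psi(Y;a))/(\partial_a\Psi(a;\mu))^2$. **Claim.** In both models: *(C1), (C2), affine mean.* $p_i=N(m_{2i},s_{2i}^2)$ and $q_i(\cdot;a)=N(c_i+d_ia,s_{1i}^2)$ with $s_{1i}^2,s_{2i}^2>0$, so the swapped mean is differentiable with constant derivative $d_i$; $d_i,s_{1i},s_{2i}$ do not depend on $y$. For basis expansion, with $A=Z^TZ+V^{-1}$, $\hat\beta=A^{-1}(Z^Ty+V^{-1}\beta_0)$, $\ell_i=z_i^TA^{-1}z_i<1$, $A_{-i}^{(+)}=A-z_iz_i^T+z_{n+1}z_{n+1}^T$: $m_{2i}=\frac{z_i^T\hat\beta-\ell_iy_i}{1-\ell_i}$, $s_{2i}^2=\frac{\sigma^2}{1-\ell_i}$, $s_{1i}^2=\sigma^2(1+z_i^T(A_{-i}^{(+)})^{-1}z_i)$,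 $c_i=z_i^T(A_{-i}^{(+)})^{-1}(\sum_{j\ne i}y_jz_j+V^{-1}\beta_0)$, $d_i=z_i^T(A_{-i}^{(+)})^{-1}z_{n+1}$. For the Gaussian process the predictive law at $x$ given any of these data sets (full, leave-one-out, swapped) is $N(m(x)+k(x)^T\Sigma^{-1}(y-m),\;k(x,x)-k(x)^T\Sigma^{-1}k(x)+\sigma^2)$, with $\Sigma$ the kernel matrix of the data plus $\sigma^2I$; the leave-one-out mean and variance are also $y_i-[\Sigma_n^{-1}(y-m)]_i/[\Sigma_n^{-1}]_{ii}$ and $1/[\Sigma_n^{-1}]_{ii}$. With $\Delta_i(a)=m_{2i}-c_i-d_ia$ we have $D(p_i,q_i(\cdot;a))=D_i(\Delta_i(a))$, $D_i(\delta)=b_i-K_ie^{-\kappa_i\delta^2}$, with explicit $b_i$, $K_i,\kappa_i>0$ depending only on $s_{1i},s_{2i},D$. (Hellinger: $b_i=1$, $K_i=\sqrt{2s_{1i}s_{2i}/(s_{1i}^2+s_{2i}^2)}$, $\kappa_i=1/(4(s_{1i}^2+s_{2i}^2))$; for $d_\alpha(q_i,p_i)$: $\kappa_i=\alpha/(2(s_{2i}^2+\alpha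 s_{1i}^2))$; for $d_\alpha(p_i,q_i)$ exchange $s_{1i},s_{2i}$.) *(i) Bounded influence.* $\psi_i(a)=-d_ig_i(\Delta_i(a))$ with $g_i(\delta)=2K_i\kappa_i\delta e^{-\kappa_i\delta^2}$ odd, tending to $0$ at $\pm\infty$, $\sup|g_i|=M_i=K_i\sqrt{2\kappa_i/e}$. Hence $|\psi(y;a)|\le M:=\sum_i|d_i|M_i$ for all $y,a$. For every law $\mu$, $\partial_a\Psi=E_\mu\partial_a\psi$, and at a root with $\partial_a\Psi\ne0$, $\sup_z|\mathrm{IF}(z)|\le M/|\partial_a\Psi|<\infty$. *(ii) Local convexity.* $\mathcal R_i:=\{D_i''>0\}=(-1/\sqrt{2\kappa_i},1/\sqrt{2\kappa_i})$; $J''(a)=\sum_id_i^2D_i''(\Delta_i(a))$, which is positive if $\Delta_i(a)\in\mathcal R_i$ for all $i$ and some $d_i\ne0$. If $\sum_id_i^2D_i''(\Delta_i(a))\ge c>0$ then $J''(a)\ge c$ and for each $c'<c$, $J$ is $c'$-strongly convex near $a$. Also $\partial_a\Psi(a;\mu)=E_\mu\sum_id_i^2D_i''(\Delta_i(a))$,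 positive if some $d_i\neq0$ and $\mu$-a.s. all $\Delta_i(a)\in\mathcal R_i$. *(iii) Asymptotic normality.* Let $Y_1,Y_2,\dots$ be i.i.d. response vectors with law $\mu$, $\Psi_N(a)=N^{-1}\sum_{j\le N}\psi(Y_j;a)$, $\Psi(a_0;\mu)=0$, $A=E_\mu\partial_a\psi(Y;a_0)\ne0$, $B=\mathrm{Var}_\mu\psi(Y;a_0)$. For some $\delta>0$, with probability tending to one $\Psi_N$ has exactly one root in $[a_0-\delta,a_0+\delta]$, and any random variables $a_N$ that with probability tending to one are roots in this interval are $\sqrt N$-consistent with $\sqrt N(a_N-a_0)\to N(0,B/A^2)$ in law. The same holds for minimisers $a_N$ of $N^{-1}\sum_{j\le N}J(Y_j;\cdot)$ over a closed set $\mathcal A$ (for instance $\mathbb R$ or a compact interval) with $a_0$ in its interior, if $a_0$ is the unique minimiser of $E_\mu J(Y;\cdot)$ on $\mathcal A$. *(iv) Variance dominance.* Let $0<\epsilon<1$, $G_\tau=(1-\epsilon)\mu+\epsilon H_\tau$, $\Psi(a_\tau;G_\tau)=0$ for $\tau>0$, $A_\tau=\partial_a\Psi(a_\tau;G_\tau)$,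 and $V^*(\tau)$ the asymptotic variance at $a_\tau$. (a) If for $0<\tau\le T$ the roots lie in a compact $\mathcal K$, $\partial_a\Psi(a;G_\tau)$ is continuous on $\mathcal K\times[0,T]$ and the curvature $E_{G_\tau}\sum_id_i^2D_i''(\Delta_i(a))$ is positive there, then there are $0<\underline A_T\le\overline A_T<\infty$ with $\underline A_T\le|A_\tau|\le\overline A_T$ and $V^*(\tau)\le M^2/\underline A_T^2$ for $0<\tau\le T$; the last bound holds whenever $|A_\tau|\ge\underline A_T>0$ on $(0,T]$. (b) Let a plug-in predictor have score $\psi_0$, integrable under $G_\tau$ at a root $\theta_\tau$ of $E_{G_\tau}\psi_0(Y;\cdot)$, with nonzero sensitivity $\partial_aE_{G_\tau}\psi_0(Y;a)|_{\theta_\tau}$ that is bounded for large $\tau$, and $E_{H_\tau}\psi_0(Y;\theta_\tau)^2\to\infty$. Then its asymptotic variance $V_0(\tau)\to\infty$. (c) If moreover $|A_\tau|$ is bounded away from $0$ for large $\tau$, there is $\tau_0$ with $V^*(\tau)<V_0(\tau)$ for all $\tau\ge\tau_0$. *(v) ELPD comparison.* Let $G_\epsilon=(1-\epsilon)F_0+\epsilon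 H$, $a^*$ a root of $\Psi(\cdot;F_0)$ with $\partial_a\Psi(a^*;F_0)\neq0$, and $a_{*,\epsilon}\to a^*$ roots of $\Psi(\cdot;G_\epsilon)$ for small $\epsilon>0$. Then $a_{*,\epsilon}=a^*+\epsilon B_*+o(\epsilon)$ with $B_*=E_H\mathrm{IF}$, $|B_*|\le M/|\partial_a\Psi(a^*;F_0)|$. Let a plug-in predictor satisfy $a_{0,\epsilon}=a_0+\epsilon B_0+o(\epsilon)$, $B_0=E_H\mathrm{IF}_0$, and let the response to be predicted have means $m_0,m_H$ under the clean and contaminating laws, $m_\epsilon=m_0+\epsilon(m_H-m_0)$. If $S(a;G_\epsilon)=-\lambda(m_\epsilon-a)^2+\mathrm{const}(\epsilon)+o(\epsilon)$ locally uniformly in $a$, $\lambda>0$, then $$S(a_{*,\epsilon};G_\epsilon)-S(a_{0,\epsilon};G_\epsilon)=\lambda[(m_0-a_0)^2-(m_0-a^*)^2]+2\lambda\epsilon[(m_0-a_0)\{(m_H-m_0)-B_0\}-(m_0-a^*)\{(m_H-m_0)-B_*\}]+o(\epsilon).$$ For response laws with finite second moments this applies to the expected log density of $N(a,s^2)$,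 which is exactly quadratic, with $\lambda=1/(2s^2)$. If $\mathrm{IF}_0$ is unbounded, $|E_{H}\mathrm{IF}_0|$ is arbitrarily large for suitable $H$. *(vi) Scalar equation.* For every $y$, $J$ has a minimiser over $\mathbb R$; $J'(a)=\sum_i\psi_i(a)$; every local minimiser solves $\sum_i\psi_i(a)=0$; if some $d_i\ne0$, all solutions lie between the least and the largest of the numbers $(m_{2i}-c_i)/d_i$, $d_i\ne0$. *(vii) Rank-two update.* Basis expansion: with $B_i=A^{-1}+\frac{A^{-1}z_iz_i^TA^{-1}}{1-\ell_i}$, $(A_{-i}^{(+)})^{-1}=B_i-\frac{B_iz_{n+1}z_{n+1}^TB_i}{1+z_{n+1}^TB_iz_{n+1}}$ with positive denominators; all $c_i,d_i$ ($i\le n$) are computed from $A^{-1}$, the data and the prior parameters by at most $C\,nK^2$ arithmetic operations, $C$ universal. Gaussian process: replacing $x_i$ by $x_{n+1}$ changes $\Sigma_n$ to $\Sigma_n+e_iw^T+we_i^T$ for an explicit $w$, whose inverse is obtained from $\Sigma_n^{-1}$ by two rank-one Woodbury steps with positive denominators (with $u=e_i+w$ and then $v=e_i-w$); all $c_i,d_i$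 are computed from $\Sigma_n^{-1}$, the data and the values of $m,k$ by at most $C\,n\cdot n^2$ arithmetic operations. -/

import Mathlib

open MeasureTheory ProbabilityTheory Filter Topology Matrix
open scoped NNReal ENNReal

universe u v w

noncomputable section

namespace CPP

/-! ### Bayesian regression: posterior and predictive distributions by Bayes' rule

The unknown regression function is the random function `x ↦ f x ω`, `ω ∼ P` (the prior), and
responses are `f x + ε` with independent `ε ∼ N(0, σ2)`. -/

section Bayes

variable {Ω : Type v} [MeasurableSpace Ω] {𝒳 : Type u} {ι : Type} [Fintype ι]

/-- Gaussian likelihood of the responses `y` at the design points `x`. -/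
def likelihood (f : 𝒳 → Ω → ℝ) (σ2 : ℝ≥0) (x : ι → 𝒳) (y : ι → ℝ) (ω : Ω) : ℝ≥0∞ :=
  ∏ j, gaussianPDF (f (x j) ω) σ2 (y j)

/-- Posterior law: prior times likelihood, normalised. -/
def bayesPosterior (P : Measure Ω) (f : 𝒳 → Ω → ℝ) (σ2 : ℝ≥0) (x : ι → 𝒳) (y : ι → ℝ) :
    Measure Ω :=
  (∫⁻ ω, likelihood f σ2 x y ω ∂P)⁻¹ • P.withDensity (likelihood f σ2 x y)

/-- Posterior predictive law of a response at `x₀` given the data `(x, y)`. -/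
def predictive (P : Measure Ω) (f : 𝒳 → Ω → ℝ) (σ2 : ℝ≥0) (x : ι → 𝒳) (y : ι → ℝ) (x₀ : 𝒳) :
    Measure ℝ :=
  (bayesPosterior P f σ2 x y).bind fun ω => gaussianReal (f x₀ ω) σ2

end Bayes

/-- The leave-one-out predictive laws `pᵢ` and the swapped predictive laws `qᵢ(·; a)`, as functions
of the response vector `y`. -/
structure PredictiveFamilies (n : ℕ) where
  loo : (Fin n → ℝ) → Fin n → Measure ℝ
  swapped : (Fin n → ℝ) → Fin n → ℝ → Measure ℝ

/-- `pᵢ`: the observation `i` is deleted. `qᵢ(·; a)`: the observation `i` is replaced by the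
candidate `(xNew, a)`. Both are predictive laws of the response at `x i`. -/
def bayesFamilies {Ω : Type v} [MeasurableSpace Ω] {𝒳 : Type u} {n : ℕ} (P : Measure Ω)
    (f : 𝒳 → Ω → ℝ) (σ2 : ℝ≥0) (x : Fin n → 𝒳) (xNew : 𝒳) : PredictiveFamilies n where
  loo y i := predictive P f σ2 (fun j : {j : Fin n // j ≠ i} => x j) (fun j => y j) (x i)
  swapped y i a := predictive P f σ2 (Function.update x i xNew) (Function.update y i a) (x i)

/-- Closed-form parameters of a Gaussian predictive family with affine swapped mean:
`pᵢ = N(m2ᵢ, v2ᵢ)` and `qᵢ(·; a) = N(cᵢ + dᵢ a, v1ᵢ)`. -/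
structure AffineForm (n : ℕ) where
  m2 : (Fin n → ℝ) → Fin n → ℝ
  v2 : Fin n → ℝ
  c : (Fin n → ℝ) → Fin n → ℝ
  d : Fin n → ℝ
  v1 : Fin n → ℝ

/-- Predictive discrepancy `Δᵢ(a) = μ₂ᵢ - μ₁ᵢ(a)`. -/
def AffineForm.disc {n : ℕ} (G : AffineForm n) (y : Fin n → ℝ) (i : Fin n) (a : ℝ) : ℝ :=
  G.m2 y i - (G.c y i + G.d i * a)

/-! ### Divergences -/

/-- Lebesgue density of a law on the line. -/
def dens (p : Measure ℝ) (t : ℝ) : ℝ := (p.rnDeriv volume t).toReal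

/-- Squared Hellinger distance, one minus the Bhattacharyya coefficient. -/
def hellingerSq (p q : Measure ℝ) : ℝ := 1 - ∫ t, √(dens p t * dens q t)

/-- Density power divergence `d_α(g, f)` of Basu, Harris, Hjort and Jones. -/
def basuDPD (α : ℝ) (g f : Measure ℝ) : ℝ :=
  ∫ t, (dens f t ^ (1 + α) - (1 + 1 / α) * dens g t * dens f t ^ α
    + (1 / α) * dens g t ^ (1 + α))

/-- The robust divergences: squared Hellinger, and the density power divergence with `α > 0` in
either order of its two arguments. -/
inductive RobustDivergence where
  | hellinger : RobustDivergence
  | dpd (α : ℝ) (hα : 0 < α) : RobustDivergence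
  | dpdSwap (α : ℝ) (hα : 0 < α) : RobustDivergence

namespace RobustDivergence

/-- The divergence `D(p, q)`. -/
def div : RobustDivergence → Measure ℝ → Measure ℝ → ℝ
  | hellinger, p, q => hellingerSq p q
  | dpd α _, p, q => basuDPD α p q
  | dpdSwap α _, p, q => basuDPD α q p

/-! For `p = N(μ₂, v2)` and `q = N(μ₁, v1)` the divergence has the closed form
`base - amp * exp (-rate * (μ₂ - μ₁)²)`. -/

/-- The exponential rate `κ`. -/
def rate : RobustDivergence → ℝ → ℝ → ℝ
  | hellinger, v2, v1 => 1 / (4 * (v2 + v1))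
  | dpd α _, v2, v1 => α / (2 * (v1 + α * v2))
  | dpdSwap α _, v2, v1 => α / (2 * (v2 + α * v1))

/-- The amplitude `K`. -/
def amp : RobustDivergence → ℝ → ℝ → ℝ
  | hellinger, v2, v1 => √(2 * (√v2 * √v1) / (v2 + v1))
  | dpd α _, v2, v1 =>
      (1 + 1 / α) * (2 * Real.pi * v1) ^ (-α / 2) * √(v1 / (v1 + α * v2))
  | dpdSwap α _, v2, v1 =>
      (1 + 1 / α) * (2 * Real.pi * v2) ^ (-α / 2) * √(v2 / (v2 + α * v1))

/-- The limit of the divergence at infinite discrepancy. -/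
def base : RobustDivergence → ℝ → ℝ → ℝ
  | hellinger, _, _ => 1
  | dpd α _, v2, v1 =>
      ((2 * Real.pi * v1) ^ (-α / 2) + (1 / α) * (2 * Real.pi * v2) ^ (-α / 2)) / √(1 + α)
  | dpdSwap α _, v2, v1 =>
      ((2 * Real.pi * v2) ^ (-α / 2) + (1 / α) * (2 * Real.pi * v1) ^ (-α / 2)) / √(1 + α)

end RobustDivergence

/-! ### The criterion, its score and the associated functionals -/

section Criterion

variable {n : ℕ}

/-- The CPP criterion `J(a) = ∑ᵢ D(pᵢ, qᵢ(·; a))` for the response vector `y`. -/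
def objective (F : PredictiveFamilies n) (D : RobustDivergence) (y : Fin n → ℝ) (a : ℝ) : ℝ :=
  ∑ i, D.div (F.loo y i) (F.swapped y i a)

/-- Per-term score `ψᵢ(a) = ∂ₐ D(pᵢ, qᵢ(·; a))`. -/
def scoreTerm (F : PredictiveFamilies n) (D : RobustDivergence) (y : Fin n → ℝ) (i : Fin n)
    (a : ℝ) : ℝ :=
  deriv (fun b => D.div (F.loo y i) (F.swapped y i b)) a

/-- Aggregate score `ψ(y; a) = ∑ᵢ ψᵢ(a)`. -/
def score (F : PredictiveFamilies n) (D : RobustDivergence) (y : Fin n → ℝ) (a : ℝ) : ℝ :=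
  ∑ i, scoreTerm F D y i a

/-- The divergence as a function `Dᵢ(δ)` of the discrepancy of the two predictive means. -/
def profile (G : AffineForm n) (D : RobustDivergence) (i : Fin n) (δ : ℝ) : ℝ :=
  D.div (gaussianReal δ (G.v2 i).toNNReal) (gaussianReal 0 (G.v1 i).toNNReal)

/-- `Dᵢ''`. -/
def profile'' (G : AffineForm n) (D : RobustDivergence) (i : Fin n) : ℝ → ℝ :=
  deriv (deriv (profile G D i))

/-- The convexity region `{δ : Dᵢ''(δ) > 0}`. -/
def convexityRegion (G : AffineForm n) (D : RobustDivergence) (i : Fin n) : Set ℝ :=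
  {δ | 0 < profile'' G D i δ}

/-- `κᵢ`. -/
def kappa (G : AffineForm n) (D : RobustDivergence) (i : Fin n) : ℝ := D.rate (G.v2 i) (G.v1 i)

/-- The redescending function `gᵢ(δ) = 2 Kᵢ κᵢ δ exp(-κᵢ δ²)`. -/
def redesc (G : AffineForm n) (D : RobustDivergence) (i : Fin n) (δ : ℝ) : ℝ :=
  2 * D.amp (G.v2 i) (G.v1 i) * kappa G D i * δ * Real.exp (-(kappa G D i * δ ^ 2))

/-- `Mᵢ = sup |gᵢ| = Kᵢ √(2 κᵢ / e)`. -/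
def redescBound (G : AffineForm n) (D : RobustDivergence) (i : Fin n) : ℝ :=
  D.amp (G.v2 i) (G.v1 i) * √(2 * kappa G D i / Real.exp 1)

/-- `M = ∑ᵢ |dᵢ| Mᵢ`. -/
def scoreBound (G : AffineForm n) (D : RobustDivergence) : ℝ :=
  ∑ i, |G.d i| * redescBound G D i

end Criterion

section MEstimation

variable {S : Type} [MeasurableSpace S]

/-- `Ψ(a; μ) = E_μ ψ(Y; a)`. -/
def popScore (ψ : S → ℝ → ℝ) (μ : Measure S) (a : ℝ) : ℝ := ∫ y, ψ y a ∂μ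

/-- `∂ₐ Ψ(a; μ)`. -/
def sensitivity (ψ : S → ℝ → ℝ) (μ : Measure S) (a : ℝ) : ℝ := deriv (popScore ψ μ) a

/-- Influence function at `z` of the root functional, evaluated at the root `a`. -/
def influence (ψ : S → ℝ → ℝ) (μ : Measure S) (a : ℝ) (z : S) : ℝ :=
  -(sensitivity ψ μ a)⁻¹ * ψ z a

/-- Asymptotic variance `Var_μ ψ(Y; a) / (∂ₐ Ψ(a; μ))²` of the estimator with score `ψ`, as an
extended nonnegative number. -/
def asympVar (ψ : S → ℝ → ℝ) (μ : Measure S) (a : ℝ) : ℝ≥0∞ :=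
  evariance (fun y => ψ y a) μ / ENNReal.ofReal (sensitivity ψ μ a ^ 2)

/-- The contaminated law `(1 - ε) μ + ε H`. -/
def contaminated (ε : ℝ) (μ H : Measure S) : Measure S :=
  ENNReal.ofReal (1 - ε) • μ + ENNReal.ofReal ε • H

/-- `T N` is `√N`-consistent for `a₀` and `√N (T N - a₀)` converges in law to `N(0, V)`. -/
def RootNNormal {Ω : Type w} [MeasurableSpace Ω] (P : Measure Ω) [IsProbabilityMeasure P]
    (T : ℕ → Ω → ℝ) (a₀ : ℝ) (V : ℝ≥0) : Prop :=
  (∀ η : ℝ, 0 < η → ∃ R : ℝ, ∀ᶠ N : ℕ in atTop,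
    P {ω | R ≤ √(N : ℝ) * |T N ω - a₀|} ≤ ENNReal.ofReal η) ∧
  TendstoInDistribution (fun (N : ℕ) ω => √(N : ℝ) * (T N ω - a₀)) atTop (id : ℝ → ℝ)
    (fun _ => P) (gaussianReal 0 V)

end MEstimation

/-! ### The individual results -/

section Results

variable {n : ℕ}

/-- (C1), (C2) and the affine structure: the predictive laws are the Gaussian laws with the
parameters listed in `G`, all divergences have their closed form, and the swapped mean
`μ₁ᵢ(a) = cᵢ + dᵢ a` is differentiable with constant derivative `dᵢ`. -/
def ConditionsC1C2 (F : PredictiveFamilies n) (G : AffineForm n) : Prop :=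
  (∀ i, 0 < G.v1 i ∧ 0 < G.v2 i) ∧
  (∀ y i, F.loo y i = gaussianReal (G.m2 y i) (G.v2 i).toNNReal ∧
    ∫ t, t ∂(F.loo y i) = G.m2 y i) ∧
  (∀ y i a, F.swapped y i a = gaussianReal (G.c y i + G.d i * a) (G.v1 i).toNNReal ∧
    ∫ t, t ∂(F.swapped y i a) = G.c y i + G.d i * a ∧
    HasDerivAt (fun b => ∫ t, t ∂(F.swapped y i b)) (G.d i) a) ∧
  (∀ (D : RobustDivergence) (y : Fin n → ℝ) (i : Fin n) (a : ℝ),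
    D.div (F.loo y i) (F.swapped y i a) = profile G D i (G.disc y i a) ∧
    D.div (F.loo y i) (F.swapped y i a) = D.base (G.v2 i) (G.v1 i)
      - D.amp (G.v2 i) (G.v1 i) * Real.exp (-(kappa G D i * G.disc y i a ^ 2)))

/-- Redescending score structure, bounded aggregate score, bounded influence function. -/
def BoundedInfluence (F : PredictiveFamilies n) (G : AffineForm n) (D : RobustDivergence) : Prop :=
  (∀ i, (∀ δ, redesc G D i (-δ) = -redesc G D i δ) ∧
    IsLUB (Set.range fun δ => |redesc G D i δ|) (redescBound G D i) ∧
    Tendsto (redesc G D i) (cocompact ℝ) (𝓝 0)) ∧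
  (∀ y i a, HasDerivAt (fun b => D.div (F.loo y i) (F.swapped y i b))
    (-(G.d i * redesc G D i (G.disc y i a))) a) ∧
  (∀ y a, |score F D y a| ≤ scoreBound G D) ∧
  ∀ (μ : Measure (Fin n → ℝ)) [IsProbabilityMeasure μ] (a : ℝ),
    HasDerivAt (popScore (score F D) μ) (∫ y, deriv (score F D y) a ∂μ) a ∧
    (popScore (score F D) μ a = 0 → sensitivity (score F D) μ a ≠ 0 →
      BddAbove (Set.range fun z => |influence (score F D) μ a z|) ∧
      ∀ z, |influence (score F D) μ a z| ≤ scoreBound G D / |sensitivity (score F D) μ a|)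

/-- Explicit convexity regions and local strong convexity of the criterion. -/
def LocalConvexity (F : PredictiveFamilies n) (G : AffineForm n) (D : RobustDivergence) : Prop :=
  (∀ i, ContDiff ℝ 2 (profile G D i) ∧
    convexityRegion G D i =
      Set.Ioo (-(1 / √(2 * kappa G D i))) (1 / √(2 * kappa G D i))) ∧
  (∀ y a, HasDerivAt (objective F D y) (score F D y a) a ∧
    HasDerivAt (score F D y) (∑ i, G.d i ^ 2 * profile'' G D i (G.disc y i a)) a) ∧
  (∀ y a, (∃ i, G.d i ≠ 0) → (∀ i, G.disc y i a ∈ convexityRegion G D i) →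
    0 < ∑ i, G.d i ^ 2 * profile'' G D i (G.disc y i a)) ∧
  (∀ y a c, 0 < c → c ≤ ∑ i, G.d i ^ 2 * profile'' G D i (G.disc y i a) →
    c ≤ deriv (deriv (objective F D y)) a ∧
    ∀ c' < c, ∃ r > 0, StrongConvexOn (Metric.ball a r) c' (objective F D y)) ∧
  -- the population version
  (∀ (μ : Measure (Fin n → ℝ)) [IsProbabilityMeasure μ] (a : ℝ),
    sensitivity (score F D) μ a =
      ∫ y, ∑ i, G.d i ^ 2 * profile'' G D i (G.disc y i a) ∂μ ∧
    ((∃ i, G.d i ≠ 0) → (∀ᵐ y ∂μ, ∀ i, G.disc y i a ∈ convexityRegion G D i) →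
      0 < sensitivity (score F D) μ a))

/-- `√N`-consistency and asymptotic normality for independent data `Y 0, Y 1, …` with law `μ`:
local existence and uniqueness of the root of the empirical score, and the limit law, both for
roots near `a₀` and for minimisers of the empirical criterion over a closed set `𝒜`. -/
def AsymptoticNormality (F : PredictiveFamilies n) (D : RobustDivergence) : Prop :=
  ∀ (Ω : Type w) [MeasurableSpace Ω] (P : Measure Ω) [IsProbabilityMeasure P]
    (μ : Measure (Fin n → ℝ)) [IsProbabilityMeasure μ] (Y : ℕ → Ω → Fin n → ℝ),
    (∀ j, Measurable (Y j)) → iIndepFun Y P → (∀ j, P.map (Y j) = μ) →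
    ∀ a₀ : ℝ, popScore (score F D) μ a₀ = 0 → ∫ y, deriv (score F D y) a₀ ∂μ ≠ 0 →
    let ΨN : ℕ → Ω → ℝ → ℝ := fun N ω a =>
      (N : ℝ)⁻¹ * ∑ j ∈ Finset.range N, score F D (Y j ω) a
    let JN : ℕ → Ω → ℝ → ℝ := fun N ω a =>
      (N : ℝ)⁻¹ * ∑ j ∈ Finset.range N, objective F D (Y j ω) a
    let V : ℝ≥0 := (asympVar (score F D) μ a₀).toNNReal
    (∃ δ > 0,
      Tendsto (fun N => P {ω | ¬ ∃! a, a ∈ Set.Icc (a₀ - δ) (a₀ + δ) ∧ ΨN N ω a = 0})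
        atTop (𝓝 0) ∧
      ∀ T : ℕ → Ω → ℝ, (∀ N, AEMeasurable (T N) P) →
        Tendsto (fun N => P {ω | ¬ (T N ω ∈ Set.Icc (a₀ - δ) (a₀ + δ) ∧ ΨN N ω (T N ω) = 0)})
          atTop (𝓝 0) →
        RootNNormal P T a₀ V) ∧
    (∀ 𝒜 : Set ℝ, IsClosed 𝒜 → a₀ ∈ interior 𝒜 →
      (∀ a ∈ 𝒜, a ≠ a₀ → ∫ y, objective F D y a₀ ∂μ < ∫ y, objective F D y a ∂μ) →
      ∀ T : ℕ → Ω → ℝ, (∀ N, AEMeasurable (T N) P) →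
        (∀ N ω, T N ω ∈ 𝒜 ∧ IsMinOn (JN N ω) 𝒜 (T N ω)) →
        RootNNormal P T a₀ V)

/-- Variance dominance along a contamination path `(1 - ε) μ + ε H τ`, with CPP roots `aS τ`. -/
def VarianceDominance (F : PredictiveFamilies n) (G : AffineForm n) (D : RobustDivergence) :
    Prop :=
  ∀ (μ : Measure (Fin n → ℝ)) [IsProbabilityMeasure μ]
    (H : ℝ → Measure (Fin n → ℝ)) [∀ τ, IsProbabilityMeasure (H τ)] (ε : ℝ), 0 < ε → ε < 1 →
    ∀ aS : ℝ → ℝ, (∀ τ > 0, popScore (score F D) (contaminated ε μ (H τ)) (aS τ) = 0) →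
    let A : ℝ → ℝ := fun τ => sensitivity (score F D) (contaminated ε μ (H τ)) (aS τ)
    let VS : ℝ → ℝ≥0∞ := fun τ => asympVar (score F D) (contaminated ε μ (H τ)) (aS τ)
    let M : ℝ := scoreBound G D
    -- finite ranges: bounds on the sensitivity, and on the asymptotic variance
    (∀ (T : ℝ) (𝒦 : Set ℝ), 0 < T → IsCompact 𝒦 → (∀ τ ∈ Set.Ioc 0 T, aS τ ∈ 𝒦) →
      ContinuousOn (fun q : ℝ × ℝ => sensitivity (score F D) (contaminated ε μ (H q.2)) q.1)
        (𝒦 ×ˢ Set.Icc 0 T) →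
      (∀ a ∈ 𝒦, ∀ τ ∈ Set.Icc 0 T,
        0 < ∫ y, ∑ i, G.d i ^ 2 * profile'' G D i (G.disc y i a) ∂(contaminated ε μ (H τ))) →
      ∃ Alow Aup : ℝ, 0 < Alow ∧ Alow ≤ Aup ∧ ∀ τ ∈ Set.Ioc 0 T,
        Alow ≤ |A τ| ∧ |A τ| ≤ Aup ∧ VS τ ≤ ENNReal.ofReal (M ^ 2 / Alow ^ 2)) ∧
    (∀ T Alow : ℝ, 0 < T → 0 < Alow → (∀ τ ∈ Set.Ioc 0 T, Alow ≤ |A τ|) →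
      ⨆ τ ∈ Set.Ioc (0 : ℝ) T, VS τ ≤ ENNReal.ofReal (M ^ 2 / Alow ^ 2)) ∧
    -- comparison with a plug-in predictor with score `ψ₀` and roots `θ τ`
    (∀ (ψ₀ : (Fin n → ℝ) → ℝ → ℝ) (θ : ℝ → ℝ),
      (∀ τ > 0, Measurable fun y => ψ₀ y (θ τ)) →
      (∀ τ > 0, Integrable (fun y => ψ₀ y (θ τ)) (contaminated ε μ (H τ)) ∧
        popScore ψ₀ (contaminated ε μ (H τ)) (θ τ) = 0 ∧
        DifferentiableAt ℝ (popScore ψ₀ (contaminated ε μ (H τ))) (θ τ) ∧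
        sensitivity ψ₀ (contaminated ε μ (H τ)) (θ τ) ≠ 0) →
      (∃ C : ℝ, ∀ᶠ τ in atTop, |sensitivity ψ₀ (contaminated ε μ (H τ)) (θ τ)| ≤ C) →
      Tendsto (fun τ => ∫⁻ y, ENNReal.ofReal (ψ₀ y (θ τ) ^ 2) ∂(H τ)) atTop (𝓝 ⊤) →
      Tendsto (fun τ => asympVar ψ₀ (contaminated ε μ (H τ)) (θ τ)) atTop (𝓝 ⊤) ∧
      ((∃ Alow > 0, ∀ᶠ τ in atTop, Alow ≤ |A τ|) →
        ∃ τ₀ > 0, ∀ τ ≥ τ₀, VS τ < asympVar ψ₀ (contaminated ε μ (H τ)) (θ τ)))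

/-- Expected log predictive density under `ν` of the predictive `N(a, s2)`. -/
def elpd (s2 : ℝ≥0) (a : ℝ) (ν : Measure ℝ) : ℝ := ∫ t, Real.log (gaussianPDFReal a s2 t) ∂ν

/-- First-order comparison under contamination. `μ, H` are the clean and the contaminating law of
the data, `ν, νH` those of the response to be predicted; `aS ε` is the contaminated CPP root and
`aP ε` the contaminated plug-in predictor. -/
def ElpdComparison (F : PredictiveFamilies n) (G : AffineForm n) (D : RobustDivergence) : Prop :=
  ∀ (μ H : Measure (Fin n → ℝ)) [IsProbabilityMeasure μ] [IsProbabilityMeasure H]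
    (aStar : ℝ) (aS : ℝ → ℝ),
    popScore (score F D) μ aStar = 0 → sensitivity (score F D) μ aStar ≠ 0 →
    Tendsto aS (𝓝[>] 0) (𝓝 aStar) →
    (∀ᶠ ε in 𝓝[>] (0 : ℝ), popScore (score F D) (contaminated ε μ H) (aS ε) = 0) →
    let BS : ℝ := ∫ z, influence (score F D) μ aStar z ∂H
    |BS| ≤ scoreBound G D / |sensitivity (score F D) μ aStar| ∧
    (fun ε => aS ε - aStar - ε * BS) =o[𝓝[>] 0] (fun ε : ℝ => ε) ∧
    ∀ (IF₀ : (Fin n → ℝ) → ℝ) (aPlug : ℝ) (aP : ℝ → ℝ), Measurable IF₀ →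
      -- an unbounded influence function makes the first-order bias arbitrarily large
      ((¬ BddAbove (Set.range fun z => |IF₀ z|)) →
        ∀ R : ℝ, ∃ H' : Measure (Fin n → ℝ), IsProbabilityMeasure H' ∧ Integrable IF₀ H' ∧
          R < |∫ z, IF₀ z ∂H'|) ∧
      (Integrable IF₀ H →
        let B₀ : ℝ := ∫ z, IF₀ z ∂H
        (fun ε => aP ε - aPlug - ε * B₀) =o[𝓝[>] 0] (fun ε : ℝ => ε) →
        ∀ (ν νH : Measure ℝ) [IsProbabilityMeasure ν] [IsProbabilityMeasure νH],
          Integrable id ν → Integrable id νH →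
          let m₀ : ℝ := ∫ t, t ∂ν
          let mH : ℝ := ∫ t, t ∂νH
          let gain : ℝ → ℝ → ℝ := fun lam ε =>
            lam * ((m₀ - aPlug) ^ 2 - (m₀ - aStar) ^ 2) + 2 * lam * ε *
              ((m₀ - aPlug) * ((mH - m₀) - B₀) - (m₀ - aStar) * ((mH - m₀) - BS))
          -- the mean of the contaminated response law
          (∀ ε ∈ Set.Icc (0 : ℝ) 1,
            ∫ t, t ∂(contaminated ε ν νH) = m₀ + ε * (mH - m₀)) ∧
          -- any score that is quadratic in the prediction to first order, locally uniformly
          (∀ (S : ℝ → Measure ℝ → ℝ) (lam : ℝ), 0 < lam →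
            (∃ k : ℝ → ℝ, ∀ R : ℝ, ∃ ρ : ℝ → ℝ, ρ =o[𝓝[>] 0] (fun ε : ℝ => ε) ∧
              ∀ᶠ ε in 𝓝[>] (0 : ℝ), ∀ a, |a| ≤ R →
                |S a (contaminated ε ν νH)
                  - (-lam * (m₀ + ε * (mH - m₀) - a) ^ 2 + k ε)| ≤ ρ ε) →
            (fun ε => S (aS ε) (contaminated ε ν νH) - S (aP ε) (contaminated ε ν νH)
              - gain lam ε) =o[𝓝[>] 0] (fun ε : ℝ => ε)) ∧
          -- the Gaussian expected log predictive density
          (MemLp id 2 ν → MemLp id 2 νH → ∀ s2 : ℝ≥0, 0 < s2 →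
            (∀ ε ∈ Set.Icc (0 : ℝ) 1, ∀ a, elpd s2 a (contaminated ε ν νH) =
              -(m₀ + ε * (mH - m₀) - a) ^ 2 / (2 * s2)
                + (-Var[id; contaminated ε ν νH] / (2 * s2)
                  - Real.log (2 * Real.pi * s2) / 2)) ∧
            (fun ε => elpd s2 (aS ε) (contaminated ε ν νH)
              - elpd s2 (aP ε) (contaminated ε ν νH) - gain (1 / (2 * s2)) ε)
              =o[𝓝[>] 0] (fun ε : ℝ => ε)))

/-- The minimiser exists and is found from one scalar equation, over a compact interval. -/
def ScalarScoreEquation (F : PredictiveFamilies n) (G : AffineForm n) (D : RobustDivergence) :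
    Prop :=
  ∀ y : Fin n → ℝ,
    (∃ a, IsMinOn (objective F D y) Set.univ a) ∧
    (∀ a, HasDerivAt (objective F D y) (score F D y a) a ∧
      score F D y a = ∑ i, -(G.d i * redesc G D i (G.disc y i a))) ∧
    (∀ a, IsLocalMin (objective F D y) a → score F D y a = 0) ∧
    ((∃ i, G.d i ≠ 0) → ∀ a, score F D y a = 0 →
      (∃ i, G.d i ≠ 0 ∧ (G.m2 y i - G.c y i) / G.d i ≤ a) ∧
      (∃ i, G.d i ≠ 0 ∧ a ≤ (G.m2 y i - G.c y i) / G.d i))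

/-- The results (i)–(vi) for every robust divergence. -/
def InheritedResults (F : PredictiveFamilies n) (G : AffineForm n) : Prop :=
  ∀ D : RobustDivergence, BoundedInfluence F G D ∧ LocalConvexity F G D ∧
    AsymptoticNormality.{w} F D ∧ VarianceDominance F G D ∧ ElpdComparison F G D ∧
    ScalarScoreEquation F G D

end Results

/-! ### Straight-line programs with a count of arithmetic operations -/

section Programs

variable {In : Type}

inductive ArithOp where
  | add | sub | mul | div

/-- An operand is an input, a rational constant, or the result of an earlier instruction. -/
inductive Operand (In : Type) where
  | input (v : In)
  | const (r : ℚ)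
  | reg (k : ℕ)

/-- One arithmetic operation. -/
structure Instr (In : Type) where
  op : ArithOp
  lhs : Operand In
  rhs : Operand In

def Operand.eval (inp : In → ℝ) (mem : List ℝ) : Operand In → Option ℝ
  | .input v => some (inp v)
  | .const r => some (r : ℝ)
  | .reg k => mem[k]?

open Classical in
/-- Division by zero is an error. -/
def ArithOp.eval : ArithOp → ℝ → ℝ → Option ℝ
  | .add, s, t => some (s + t)
  | .sub, s, t => some (s - t)
  | .mul, s, t => some (s * t)
  | .div, s, t => if t = 0 then none else some (s / t)

/-- Run a program; every instruction appends its result to the memory. -/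
def run (inp : In → ℝ) : List (Instr In) → List ℝ → Option (List ℝ)
  | [], mem => some mem
  | I :: p, mem =>
    (I.lhs.eval inp mem).bind fun s =>
      (I.rhs.eval inp mem).bind fun t =>
        (I.op.eval s t).bind fun r => run inp p (mem ++ [r])

/-- The program runs without error on `inp` and the operands `out` then hold `target`. Its cost is
the number of its instructions. -/
def Computes {Out : Type} (p : List (Instr In)) (out : Out → Operand In) (inp : In → ℝ)
    (target : Out → ℝ) : Prop :=
  ∃ mem, run inp p [] = some mem ∧ ∀ o, (out o).eval inp mem = some (target o)

end Programs

/-! ### Basis-expansion regression: closed forms -/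

/-- Design matrix (rows `zᵢ`), candidate feature vector, and the prior `N(β0, σ2 V)`. -/
structure BasisDesign (n K : ℕ) where
  Z : Matrix (Fin n) (Fin K) ℝ
  zNew : Fin K → ℝ
  β0 : Fin K → ℝ
  V : Matrix (Fin K) (Fin K) ℝ

namespace BasisDesign

variable {n K : ℕ} (B : BasisDesign n K)

/-- `A = ZᵀZ + V⁻¹`. -/
def A : Matrix (Fin K) (Fin K) ℝ := B.Zᵀ * B.Z + B.V⁻¹

/-- `β̂ = A⁻¹ (Zᵀ y + V⁻¹ β0)`. -/
def βhat (y : Fin n → ℝ) : Fin K → ℝ := B.A⁻¹ *ᵥ (B.Zᵀ *ᵥ y + B.V⁻¹ *ᵥ B.β0)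

/-- The leverage `ℓᵢ = zᵢᵀ A⁻¹ zᵢ`. -/
def lev (i : Fin n) : ℝ := B.Z i ⬝ᵥ (B.A⁻¹ *ᵥ B.Z i)

/-- `A₋ᵢ⁽⁺⁾`: the Gram matrix of the design with row `i` replaced by `zNew`, plus `V⁻¹`. -/
def Aswap (i : Fin n) : Matrix (Fin K) (Fin K) ℝ :=
  (B.Z.updateRow i B.zNew)ᵀ * B.Z.updateRow i B.zNew + B.V⁻¹

def c (y : Fin n → ℝ) (i : Fin n) : ℝ :=
  B.Z i ⬝ᵥ ((B.Aswap i)⁻¹ *ᵥ ((∑ j ∈ Finset.univ.erase i, y j • B.Z j) + B.V⁻¹ *ᵥ B.β0))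

def d (i : Fin n) : ℝ := B.Z i ⬝ᵥ ((B.Aswap i)⁻¹ *ᵥ B.zNew)

def affineForm (σ2 : ℝ≥0) : AffineForm n where
  m2 y i := (B.Z i ⬝ᵥ B.βhat y - B.lev i * y i) / (1 - B.lev i)
  v2 i := σ2 / (1 - B.lev i)
  c := B.c
  d := B.d
  v1 i := σ2 * (1 + B.Z i ⬝ᵥ ((B.Aswap i)⁻¹ *ᵥ B.Z i))

/-- Downdated inverse `Bᵢ = A⁻¹ + A⁻¹ zᵢ zᵢᵀ A⁻¹ / (1 - ℓᵢ)`. -/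
def downdate (i : Fin n) : Matrix (Fin K) (Fin K) ℝ :=
  B.A⁻¹ + (1 - B.lev i)⁻¹ • (B.A⁻¹ * vecMulVec (B.Z i) (B.Z i) * B.A⁻¹)

/-- The rank-two Woodbury update of `A⁻¹`. -/
def RankTwoUpdate : Prop :=
  ∀ i : Fin n,
    IsUnit B.A ∧ IsUnit (B.Aswap i) ∧
    B.Aswap i = B.A - vecMulVec (B.Z i) (B.Z i) + vecMulVec B.zNew B.zNew ∧
    0 < 1 - B.lev i ∧ 0 < 1 + B.zNew ⬝ᵥ (B.downdate i *ᵥ B.zNew) ∧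
    (B.Aswap i)⁻¹ = B.downdate i - (1 + B.zNew ⬝ᵥ (B.downdate i *ᵥ B.zNew))⁻¹ •
      (B.downdate i * vecMulVec B.zNew B.zNew * B.downdate i)

/-- Inputs of a program for `cᵢ, dᵢ`: the inverse `A⁻¹`, the data and the prior parameters. -/
inductive Input (n K : ℕ) where
  | Ainv (k l : Fin K)
  | feature (i : Fin n) (k : Fin K)
  | newFeature (k : Fin K)
  | response (i : Fin n)
  | priorPrecision (k l : Fin K)
  | priorMean (k : Fin K)

def input (y : Fin n → ℝ) : Input n K → ℝ
  | .Ainv k l => B.A⁻¹ k l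
  | .feature i k => B.Z i k
  | .newFeature k => B.zNew k
  | .response i => y i
  | .priorPrecision k l => B.V⁻¹ k l
  | .priorMean k => B.β0 k

end BasisDesign

/-- All `cᵢ, dᵢ` are computed from `A⁻¹`, the data and the prior with `O(n K²)` operations. -/
def BasisCost : Prop :=
  ∃ C : ℕ, ∀ n K : ℕ, ∃ (p : List (Instr (BasisDesign.Input n K)))
    (out : Fin n ⊕ Fin n → Operand (BasisDesign.Input n K)),
    p.length ≤ C * (n * K ^ 2) ∧
    ∀ (B : BasisDesign n K) (y : Fin n → ℝ), B.V.PosDef →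
      Computes p out (B.input y) (Sum.elim (B.c y) B.d)

/-- The design obtained from the features `φ₁, …, φ_K`. -/
def basisDesign {𝒳 : Type u} {n K : ℕ} (φ : Fin K → 𝒳 → ℝ) (β0 : Fin K → ℝ)
    (V : Matrix (Fin K) (Fin K) ℝ) (x : Fin n → 𝒳) (xNew : 𝒳) : BasisDesign n K where
  Z := Matrix.of fun i k => φ k (x i)
  zNew k := φ k xNew
  β0 := β0
  V := V

/-- The Bayesian basis-expansion model `f(x) = ∑ₖ βₖ φₖ(x)`, `β ∼ N(β0, σ2 V)`. -/
def basisFamilies {𝒳 : Type u} {n K : ℕ} (φ : Fin K → 𝒳 → ℝ) (β0 : Fin K → ℝ)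
    (V : Matrix (Fin K) (Fin K) ℝ) (σ2 : ℝ≥0) (x : Fin n → 𝒳) (xNew : 𝒳) :
    PredictiveFamilies n :=
  bayesFamilies (multivariateGaussian (WithLp.toLp 2 β0) ((σ2 : ℝ) • V))
    (fun x (β : EuclideanSpace ℝ (Fin K)) => ∑ k, β k * φ k x) σ2 x xNew

/-! ### Gaussian process regression: closed forms -/

section GP

variable {𝒳 : Type u} {ι : Type} [Fintype ι] [DecidableEq ι]

/-- `Σ = [k(xᵢ, xⱼ)] + σ2 I`. -/
def gpSigma (k : 𝒳 → 𝒳 → ℝ) (σ2 : ℝ≥0) (x : ι → 𝒳) : Matrix ι ι ℝ :=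
  Matrix.of (fun i j => k (x i) (x j)) + (σ2 : ℝ) • (1 : Matrix ι ι ℝ)

/-- `m(x₀) + k(x₀)ᵀ Σ⁻¹ (y - m)`. -/
def gpMean (m : 𝒳 → ℝ) (k : 𝒳 → 𝒳 → ℝ) (σ2 : ℝ≥0) (x : ι → 𝒳) (y : ι → ℝ) (x₀ : 𝒳) : ℝ :=
  m x₀ + (fun j => k x₀ (x j)) ⬝ᵥ ((gpSigma k σ2 x)⁻¹ *ᵥ fun j => y j - m (x j))

/-- `k(x₀, x₀) - k(x₀)ᵀ Σ⁻¹ k(x₀)`. -/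
def gpVar (k : 𝒳 → 𝒳 → ℝ) (σ2 : ℝ≥0) (x : ι → 𝒳) (x₀ : 𝒳) : ℝ :=
  k x₀ x₀ - (fun j => k x₀ (x j)) ⬝ᵥ ((gpSigma k σ2 x)⁻¹ *ᵥ fun j => k x₀ (x j))

end GP

/-- Mean function, kernel, noise variance, design points and candidate point. -/
structure GPDesign (𝒳 : Type u) (n : ℕ) where
  m : 𝒳 → ℝ
  k : 𝒳 → 𝒳 → ℝ
  σ2 : ℝ≥0
  x : Fin n → 𝒳
  xNew : 𝒳

namespace GPDesign

variable {𝒳 : Type u} {n : ℕ} (B : GPDesign 𝒳 n)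

/-- The kernel is symmetric and positive semidefinite. -/
def IsKernel : Prop :=
  ∀ s : Finset 𝒳, (Matrix.of fun i j : s => B.k i j).PosSemidef

/-- Covariance matrix `Σₙ` of the responses. -/
def Sig : Matrix (Fin n) (Fin n) ℝ := gpSigma B.k B.σ2 B.x

/-- The design points with `xᵢ` replaced by the candidate point. -/
def xSwap (i : Fin n) : Fin n → 𝒳 := Function.update B.x i B.xNew

/-- Covariance matrix of the responses at the swapped design points. -/
def SigSwap (i : Fin n) : Matrix (Fin n) (Fin n) ℝ := gpSigma B.k B.σ2 (B.xSwap i)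

/-- Covariances of `f(xᵢ)` with `f` at the swapped design points. -/
def kSwap (i : Fin n) : Fin n → ℝ := fun j => B.k (B.x i) (B.xSwap i j)

/-- The swapped predictive mean at `a = 0`. -/
def c (y : Fin n → ℝ) (i : Fin n) : ℝ :=
  B.m (B.x i) + B.kSwap i ⬝ᵥ ((B.SigSwap i)⁻¹ *ᵥ
    fun j => Function.update y i 0 j - B.m (B.xSwap i j))

/-- The weight of the added point in the swapped predictive mean. -/
def d (i : Fin n) : ℝ := (B.kSwap i ᵥ* (B.SigSwap i)⁻¹) i

def affineForm : AffineForm n where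
  m2 y i := gpMean B.m B.k B.σ2 (fun j : {j : Fin n // j ≠ i} => B.x j) (fun j => y j) (B.x i)
  v2 i := gpVar B.k B.σ2 (fun j : {j : Fin n // j ≠ i} => B.x j) (B.x i) + B.σ2
  c := B.c
  d := B.d
  v1 i := gpVar B.k B.σ2 (B.xSwap i) (B.x i) + B.σ2

/-- The usual expressions of the leave-one-out mean and variance through `Σₙ⁻¹`. -/
def LooFormulas : Prop :=
  ∀ (y : Fin n → ℝ) (i : Fin n), 0 < B.Sig⁻¹ i i ∧
    B.affineForm.m2 y i = y i - (B.Sig⁻¹ *ᵥ fun j => y j - B.m (B.x j)) i / B.Sig⁻¹ i i ∧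
    B.affineForm.v2 i = 1 / B.Sig⁻¹ i i

/-- `Σ₋ᵢ⁽⁺⁾ = Σₙ + eᵢ wᵀ + w eᵢᵀ` for this `w`. -/
def shift (i : Fin n) : Fin n → ℝ := fun j =>
  if j = i then (B.k B.xNew B.xNew - B.k (B.x i) (B.x i)) / 2
  else B.k B.xNew (B.x j) - B.k (B.x i) (B.x j)

/-- First rank-one step, with `u = eᵢ + w`. -/
def update1 (i : Fin n) : Matrix (Fin n) (Fin n) ℝ :=
  let u := Pi.single i 1 + B.shift i
  B.Sig⁻¹ - (2 + u ⬝ᵥ (B.Sig⁻¹ *ᵥ u))⁻¹ • (B.Sig⁻¹ * vecMulVec u u * B.Sig⁻¹)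

/-- The rank-two Woodbury update of `Σₙ⁻¹`, the second step with `v = eᵢ - w`. -/
def RankTwoUpdate : Prop :=
  ∀ i : Fin n,
    let e : Fin n → ℝ := Pi.single i 1
    let u := e + B.shift i
    let v := e - B.shift i
    IsUnit B.Sig ∧ IsUnit (B.SigSwap i) ∧
    B.SigSwap i = B.Sig + vecMulVec e (B.shift i) + vecMulVec (B.shift i) e ∧
    0 < 2 + u ⬝ᵥ (B.Sig⁻¹ *ᵥ u) ∧ 0 < 2 - v ⬝ᵥ (B.update1 i *ᵥ v) ∧
    (B.SigSwap i)⁻¹ = B.update1 i + (2 - v ⬝ᵥ (B.update1 i *ᵥ v))⁻¹ •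
      (B.update1 i * vecMulVec v v * B.update1 i)

/-- Inputs of a program for `cᵢ, dᵢ`: the inverse `Σₙ⁻¹`, the data, and the values of the mean
function and the kernel. -/
inductive Input (n : ℕ) where
  | SigInv (i j : Fin n)
  | kernel (i j : Fin n)
  | kernelNew (j : Fin n)
  | kernelNewNew
  | noise
  | response (i : Fin n)
  | mean (i : Fin n)
  | meanNew

def input (y : Fin n → ℝ) : Input n → ℝ
  | .SigInv i j => B.Sig⁻¹ i j
  | .kernel i j => B.k (B.x i) (B.x j)
  | .kernelNew j => B.k B.xNew (B.x j)
  | .kernelNewNew => B.k B.xNew B.xNew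
  | .noise => B.σ2
  | .response i => y i
  | .mean i => B.m (B.x i)
  | .meanNew => B.m B.xNew

end GPDesign

/-- All `cᵢ, dᵢ` are computed from `Σₙ⁻¹` and the data with `O(n · n²)` operations: the system has
size `n`, which takes the place of the number of features. -/
def GPCost : Prop :=
  ∃ C : ℕ, ∀ n : ℕ, ∃ (p : List (Instr (GPDesign.Input n)))
    (out : Fin n ⊕ Fin n → Operand (GPDesign.Input n)),
    p.length ≤ C * (n * n ^ 2) ∧
    ∀ (𝒳 : Type u) (B : GPDesign 𝒳 n) (y : Fin n → ℝ), B.IsKernel → 0 < B.σ2 →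
      Computes p out (B.input y) (Sum.elim (B.c y) B.d)

end CPP

end

/-!
Both regression models have Gaussian predictive laws whose mean, for the swapped data, is affine in
the candidate value, and for such laws every divergence considered is
`base - amp * exp (-rate * Δ ^ 2)` in the difference `Δ` of the means. Everything else is calculus
of this bump, applied to a discrepancy that is affine in `a`, and linear algebra.

*Predictive laws.* For a Gaussian process, the likelihood of the data is written as a Fourier
integral over frequencies `ξ`, and the prior expectation of a linear combination of values of `f`
is a Gaussian exponential. Weighting by `exp (i t f(s))` amounts to translating `ξ` by
`t Σ⁻¹ k(s)`, and the quadratic terms that remain show that the posterior characteristic function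
is that of a normal law (`integral_likelihood_mul_cexp`, `predictive_gaussianProcess`); no density
of the process is needed and `Σ` may come from repeated design points. The basis expansion is the
Gaussian process with kernel `σ² φᵀ V φ`, and `(X V Xᵀ + 1) X = X V (Xᵀ X + V⁻¹)` turns its kernel
formulas into those in terms of coefficients (`gpMean_basis`, `gpVar_basis`).

*The criterion.* `RobustDivergence.div_gaussianReal` gives the bump form. Its first derivative is
bounded and its second is bounded and Lipschitz, so the score is a `RegularScore`: bounded, with a
bounded derivative that is Lipschitz in `a` uniformly in the data. Boundedness makes influence
functions and score variances bounded under every law and allows differentiation under the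
integral. Each term of the score has the sign of `a` minus the root of its discrepancy, which
locates all solutions of the score equation.

*Asymptotics.* By the law of large numbers the empirical slope is close to its population value on
a whole neighbourhood of `a₀`, where the empirical score is therefore strictly monotone and nearly
linear; the central limit theorem for the score at `a₀` passes to the root (`rootNNormal`). For
minimisers over an unbounded set, the amount by which the criterion lies below its limit at
infinity is bounded, equi-Lipschitz and dominated outside `[-R, R]` by an envelope with vanishing
expectation, which yields consistency (`whp_near_of_maximiser`).

*Contamination.* An unbounded plug-in score has exploding second moment along the contaminating
laws while its sensitivity stays bounded, whereas the score variance here is at most `M²`. Roots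
under contamination expand to first order because the estimating function is differentiable with
nonzero slope (`root_expansion`), and inserting two such expansions in a quadratic gives the
comparison of expected log predictive densities (`quadratic_gain`).

*Updates.* Deleting and inserting an observation are rank-one changes, inverted by Sherman–Morrison;
the denominators of the downdates are positive because the downdated matrices are positive definite
(`Matrix.PosDef.one_sub_pos`). For kernel matrices the change `e wᵀ + w eᵀ` is
`(u uᵀ - v vᵀ) / 2` with `u = e + w` and `v = e - w` (`GPDesign.SigSwap_eq_polarised`). The
operation counts compose straight-line programs: `Derives c S T` says that `c` further instructions
lead from the values in `S` to those in `T`.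
-/

noncomputable section

namespace CPP

/-! ### Gaussian integrals and the closed forms of the divergences -/

section Divergence

lemma sq_add_sq_complete {p q : ℝ} (hpq : p + q ≠ 0) (a b t : ℝ) :
    -(p * (t - a) ^ 2 + q * (t - b) ^ 2)
      = -(p + q) * (t - (p * a + q * b) / (p + q)) ^ 2 + -(p * q / (p + q) * (a - b) ^ 2) := by
  field_simp
  ring

lemma integral_exp_neg_two_sq {p q : ℝ} (hp : 0 < p) (hq : 0 < q) (a b : ℝ) :
    ∫ t : ℝ, Real.exp (-(p * (t - a) ^ 2 + q * (t - b) ^ 2))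
      = √(Real.pi / (p + q)) * Real.exp (-(p * q / (p + q) * (a - b) ^ 2)) := by
  simp_rw [sq_add_sq_complete (add_pos hp hq).ne', Real.exp_add]
  rw [integral_mul_const,
    integral_sub_right_eq_self (fun t => Real.exp (-(p + q) * t ^ 2)), integral_gaussian]

lemma integrable_exp_neg_two_sq {p q : ℝ} (hp : 0 < p) (hq : 0 < q) (a b : ℝ) :
    Integrable fun t : ℝ => Real.exp (-(p * (t - a) ^ 2 + q * (t - b) ^ 2)) := by
  simp_rw [sq_add_sq_complete (add_pos hp hq).ne', Real.exp_add]
  exact ((integrable_exp_neg_mul_sq (add_pos hp hq)).comp_sub_right _).mul_const _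

lemma dens_gaussianReal (μ : ℝ) (v : ℝ≥0) :
    dens (gaussianReal μ v) =ᵐ[volume] gaussianPDFReal μ v := by
  filter_upwards [rnDeriv_gaussianReal μ v] with t ht
  rw [dens, ht, toReal_gaussianPDF]

variable {v₁ v₂ : ℝ≥0}

lemma gaussianPDFReal_mul_rpow (hv₁ : 0 < v₁) (α a b t : ℝ) :
    gaussianPDFReal a v₂ t * gaussianPDFReal b v₁ t ^ α =
      ((√(2 * Real.pi * v₂))⁻¹ * (2 * Real.pi * v₁) ^ (-α / 2)) *
        Real.exp (-(1 / (2 * v₂) * (t - a) ^ 2 + α / (2 * v₁) * (t - b) ^ 2)) := by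
  have h1 : (0 : ℝ) < v₁ := hv₁
  have hpos : (0 : ℝ) ≤ 2 * Real.pi * v₁ := by positivity
  rw [gaussianPDFReal, gaussianPDFReal, Real.mul_rpow (by positivity) (Real.exp_pos _).le,
    ← Real.exp_mul, Real.sqrt_eq_rpow (2 * Real.pi * v₁), ← Real.rpow_neg hpos,
    ← Real.rpow_mul hpos]
  rw [show -(1 / (2 * (v₂ : ℝ)) * (t - a) ^ 2 + α / (2 * v₁) * (t - b) ^ 2)
    = -(t - a) ^ 2 / (2 * v₂) + -(t - b) ^ 2 / (2 * v₁) * α by ring, Real.exp_add,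
    show -(1 / 2) * α = -α / 2 by ring]
  ring

lemma integrable_gaussianPDFReal_mul_rpow (hv₁ : 0 < v₁) (hv₂ : 0 < v₂) {α : ℝ} (hα : 0 < α)
    (a b : ℝ) :
    Integrable fun t => gaussianPDFReal a v₂ t * gaussianPDFReal b v₁ t ^ α := by
  have h1 : (0 : ℝ) < v₁ := hv₁
  have h2 : (0 : ℝ) < v₂ := hv₂
  simp_rw [gaussianPDFReal_mul_rpow hv₁]
  exact (integrable_exp_neg_two_sq (by positivity) (by positivity) a b).const_mul _

lemma integral_gaussianPDFReal_mul_rpow (hv₁ : 0 < v₁) (hv₂ : 0 < v₂) {α : ℝ} (hα : 0 < α)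
    (a b : ℝ) :
    ∫ t, gaussianPDFReal a v₂ t * gaussianPDFReal b v₁ t ^ α =
      (2 * Real.pi * v₁) ^ (-α / 2) * √(v₁ / (v₁ + α * v₂)) *
        Real.exp (-(α / (2 * (v₁ + α * v₂)) * (a - b) ^ 2)) := by
  have h1 : (0 : ℝ) < v₁ := hv₁
  have h2 : (0 : ℝ) < v₂ := hv₂
  simp_rw [gaussianPDFReal_mul_rpow hv₁]
  rw [integral_const_mul, integral_exp_neg_two_sq (by positivity) (by positivity)]
  have e1 : 1 / (2 * (v₂ : ℝ)) * (α / (2 * v₁)) / (1 / (2 * v₂) + α / (2 * v₁))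
      = α / (2 * (v₁ + α * v₂)) := by
    field_simp
  have e2 : (√(2 * Real.pi * v₂))⁻¹ * √(Real.pi / (1 / (2 * v₂) + α / (2 * v₁)))
      = √(v₁ / (v₁ + α * v₂)) := by
    rw [← Real.sqrt_inv, ← Real.sqrt_mul (by positivity)]
    congr 1
    field_simp
  rw [e1, ← e2]
  ring

lemma gaussianPDFReal_rpow_one_add (hv₁ : 0 < v₁) (α b t : ℝ) :
    gaussianPDFReal b v₁ t ^ (1 + α) = gaussianPDFReal b v₁ t * gaussianPDFReal b v₁ t ^ α := by
  rw [Real.rpow_add (gaussianPDFReal_pos b v₁ t hv₁.ne'), Real.rpow_one]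

lemma integral_gaussianPDFReal_rpow_one_add (hv₁ : 0 < v₁) {α : ℝ} (hα : 0 < α) (b : ℝ) :
    ∫ t, gaussianPDFReal b v₁ t ^ (1 + α) = (2 * Real.pi * v₁) ^ (-α / 2) / √(1 + α) := by
  have h1 : (0 : ℝ) < v₁ := hv₁
  simp_rw [gaussianPDFReal_rpow_one_add hv₁]
  rw [integral_gaussianPDFReal_mul_rpow hv₁ hv₁ hα,
    show (v₁ : ℝ) / (v₁ + α * v₁) = (1 + α)⁻¹ by field_simp, Real.sqrt_inv]
  simp [div_eq_mul_inv]

lemma hellingerSq_gaussianReal (hv₁ : 0 < v₁) (hv₂ : 0 < v₂) (a b : ℝ) :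
    hellingerSq (gaussianReal a v₂) (gaussianReal b v₁) =
      1 - √(2 * (√v₂ * √v₁) / (v₂ + v₁)) *
        Real.exp (-(1 / (4 * (v₂ + v₁)) * (a - b) ^ 2)) := by
  have h1 : (0 : ℝ) < v₁ := hv₁
  have h2 : (0 : ℝ) < v₂ := hv₂
  have key : ∀ t, √(gaussianPDFReal a v₂ t * gaussianPDFReal b v₁ t) =
      √((√(2 * Real.pi * v₂))⁻¹ * (√(2 * Real.pi * v₁))⁻¹) *
        Real.exp (-(1 / (4 * v₂) * (t - a) ^ 2 + 1 / (4 * v₁) * (t - b) ^ 2)) := by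
    intro t
    rw [show gaussianPDFReal a v₂ t * gaussianPDFReal b v₁ t =
      ((√(2 * Real.pi * v₂))⁻¹ * (√(2 * Real.pi * v₁))⁻¹) *
        Real.exp (-(1 / (4 * v₂) * (t - a) ^ 2 + 1 / (4 * v₁) * (t - b) ^ 2)) ^ 2 by
          rw [← Real.exp_nat_mul, gaussianPDFReal, gaussianPDFReal,
            show ((2 : ℕ) : ℝ) * -(1 / (4 * (v₂ : ℝ)) * (t - a) ^ 2 + 1 / (4 * v₁) * (t - b) ^ 2)
              = -(t - a) ^ 2 / (2 * v₂) + -(t - b) ^ 2 / (2 * v₁) by push_cast; ring, Real.exp_add]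
          ring,
      Real.sqrt_mul (by positivity), Real.sqrt_sq (Real.exp_pos _).le]
  have hcongr : ∫ t, √(dens (gaussianReal a v₂) t * dens (gaussianReal b v₁) t) =
      ∫ t, √(gaussianPDFReal a v₂ t * gaussianPDFReal b v₁ t) := by
    refine integral_congr_ae ?_
    filter_upwards [dens_gaussianReal a v₂, dens_gaussianReal b v₁] with t h h'
    rw [h, h']
  rw [hellingerSq, hcongr]
  simp_rw [key]
  rw [integral_const_mul, integral_exp_neg_two_sq (by positivity) (by positivity)]
  have e1 : 1 / (4 * (v₂ : ℝ)) * (1 / (4 * v₁)) / (1 / (4 * v₂) + 1 / (4 * v₁))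
      = 1 / (4 * (v₂ + v₁)) := by
    field_simp
    ring
  have e2 : √((√(2 * Real.pi * v₂))⁻¹ * (√(2 * Real.pi * v₁))⁻¹) *
      √(Real.pi / (1 / (4 * v₂) + 1 / (4 * v₁))) = √(2 * (√v₂ * √v₁) / (v₂ + v₁)) := by
    rw [← Real.sqrt_mul (by positivity)]
    congr 1
    have s0 : √(2 * Real.pi * v₂) * √(2 * Real.pi * v₁) = 2 * Real.pi * (√v₂ * √v₁) := by
      have h : (0 : ℝ) ≤ 2 * Real.pi := by positivity
      rw [Real.sqrt_mul h (v₂ : ℝ), Real.sqrt_mul h (v₁ : ℝ)]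
      linear_combination (√(v₂ : ℝ) * √(v₁ : ℝ)) * Real.mul_self_sqrt h
    rw [← mul_inv, s0]
    have s1 : √(v₁ : ℝ) ^ 2 = v₁ := Real.sq_sqrt h1.le
    have s2 : √(v₂ : ℝ) ^ 2 = v₂ := Real.sq_sqrt h2.le
    have : 0 < √(v₁ : ℝ) := Real.sqrt_pos.2 h1
    have : 0 < √(v₂ : ℝ) := Real.sqrt_pos.2 h2
    field_simp
    rw [s1, s2]
    ring
  rw [e1, ← e2]
  ring

lemma basuDPD_gaussianReal (hv₁ : 0 < v₁) (hv₂ : 0 < v₂) {α : ℝ} (hα : 0 < α) (a b : ℝ) :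
    basuDPD α (gaussianReal a v₂) (gaussianReal b v₁) =
      ((2 * Real.pi * v₁) ^ (-α / 2) + (1 / α) * (2 * Real.pi * v₂) ^ (-α / 2)) / √(1 + α) -
        (1 + 1 / α) * (2 * Real.pi * v₁) ^ (-α / 2) * √(v₁ / (v₁ + α * v₂)) *
        Real.exp (-(α / (2 * (v₁ + α * v₂)) * (a - b) ^ 2)) := by
  have hcongr : basuDPD α (gaussianReal a v₂) (gaussianReal b v₁) =
      ∫ t, (gaussianPDFReal b v₁ t ^ (1 + α)
        - (1 + 1 / α) * (gaussianPDFReal a v₂ t * gaussianPDFReal b v₁ t ^ α)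
        + (1 / α) * gaussianPDFReal a v₂ t ^ (1 + α)) := by
    refine integral_congr_ae ?_
    filter_upwards [dens_gaussianReal a v₂, dens_gaussianReal b v₁] with t h h'
    rw [h, h', mul_assoc]
  have i1 : ∀ {v : ℝ≥0} (_ : 0 < v) (b : ℝ),
      Integrable fun t => gaussianPDFReal b v t ^ (1 + α) := fun hv b => by
    simp_rw [gaussianPDFReal_rpow_one_add hv]
    exact integrable_gaussianPDFReal_mul_rpow hv hv hα b b
  have i2 := (integrable_gaussianPDFReal_mul_rpow hv₁ hv₂ hα a b).const_mul (1 + 1 / α)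
  have e1 := integral_add ((i1 hv₁ b).sub i2) ((i1 hv₂ a).const_mul (1 / α))
  simp only [Pi.sub_apply] at e1
  rw [hcongr, e1, integral_sub (i1 hv₁ b) i2, integral_const_mul, integral_const_mul,
    integral_gaussianPDFReal_rpow_one_add hv₁ hα, integral_gaussianPDFReal_rpow_one_add hv₂ hα,
    integral_gaussianPDFReal_mul_rpow hv₁ hv₂ hα]
  ring

/-- Every robust divergence of two Gaussian laws is an affine function of a Gaussian bump in the
difference of the means. -/
lemma RobustDivergence.div_gaussianReal (D : RobustDivergence) (hv₁ : 0 < v₁) (hv₂ : 0 < v₂)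
    (a b : ℝ) :
    D.div (gaussianReal a v₂) (gaussianReal b v₁) =
      D.base v₂ v₁ - D.amp v₂ v₁ * Real.exp (-(D.rate v₂ v₁ * (a - b) ^ 2)) := by
  cases D with
  | hellinger => exact hellingerSq_gaussianReal hv₁ hv₂ a b
  | dpd α hα => exact basuDPD_gaussianReal hv₁ hv₂ hα a b
  | dpdSwap α hα =>
    simp only [RobustDivergence.div, RobustDivergence.base, RobustDivergence.amp,
      RobustDivergence.rate]
    rw [basuDPD_gaussianReal hv₂ hv₁ hα b a, ← neg_sub a b, neg_sq]

lemma RobustDivergence.rate_pos (D : RobustDivergence) {s t : ℝ} (hs : 0 < s) (ht : 0 < t) :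
    0 < D.rate s t := by
  cases D <;> simp only [RobustDivergence.rate] <;> positivity

lemma RobustDivergence.amp_pos (D : RobustDivergence) {s t : ℝ} (hs : 0 < s) (ht : 0 < t) :
    0 < D.amp s t := by
  cases D <;> simp only [RobustDivergence.amp]
  · have := Real.sqrt_pos.2 hs
    have := Real.sqrt_pos.2 ht
    positivity
  all_goals
    have : (0 : ℝ) < 2 * Real.pi * t := by positivity
    have : (0 : ℝ) < 2 * Real.pi * s := by positivity
    positivity

end Divergence

/-! ### Calculus of the Gaussian bump -/

section Bump

/-- `b - K exp (-κ δ²)`. -/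
def well (b K κ δ : ℝ) : ℝ := b - K * Real.exp (-(κ * δ ^ 2))

/-- The derivative `2 K κ δ exp (-κ δ²)` of `well b K κ`. -/
def well' (K κ δ : ℝ) : ℝ := 2 * K * κ * δ * Real.exp (-(κ * δ ^ 2))

/-- The second derivative of `well b K κ`. -/
def well'' (K κ δ : ℝ) : ℝ := 2 * K * κ * (1 - 2 * κ * δ ^ 2) * Real.exp (-(κ * δ ^ 2))

/-- The third derivative of `well b K κ`. -/
def well''' (K κ δ : ℝ) : ℝ :=
  2 * K * κ * (4 * κ ^ 2 * δ ^ 3 - 6 * κ * δ) * Real.exp (-(κ * δ ^ 2))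

variable {b K κ : ℝ}

lemma hasDerivAt_exp_neg_mul_sq (κ δ : ℝ) :
    HasDerivAt (fun x : ℝ => Real.exp (-(κ * x ^ 2)))
      (Real.exp (-(κ * δ ^ 2)) * (-(2 * κ * δ))) δ := by
  have h : HasDerivAt (fun x : ℝ => -(κ * x ^ 2)) (-(2 * κ * δ)) δ := by
    convert! ((hasDerivAt_pow 2 δ).const_mul κ).neg using 1
    simp; ring
  exact h.exp

lemma hasDerivAt_well (δ : ℝ) : HasDerivAt (well b K κ) (well' K κ δ) δ := by
  convert! ((hasDerivAt_exp_neg_mul_sq κ δ).const_mul K).const_sub b using 1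
  rw [well']; ring

lemma hasDerivAt_well' (δ : ℝ) : HasDerivAt (well' K κ) (well'' K κ δ) δ := by
  convert! ((hasDerivAt_id δ).const_mul (2 * K * κ)).mul (hasDerivAt_exp_neg_mul_sq κ δ) using 1
  simp only [well'', id]; ring

lemma hasDerivAt_well'' (δ : ℝ) : HasDerivAt (well'' K κ) (well''' K κ δ) δ := by
  have h : HasDerivAt (fun x : ℝ => 2 * K * κ * (1 - 2 * κ * x ^ 2))
      (2 * K * κ * (-(2 * κ * (2 * δ)))) δ := by
    convert! (((hasDerivAt_pow 2 δ).const_mul (2 * κ)).const_sub 1).const_mul (2 * K * κ) using 1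
    simp
  convert! h.mul (hasDerivAt_exp_neg_mul_sq κ δ) using 1
  simp only [well''']; ring

lemma continuous_well : Continuous (well b K κ) := by unfold well; fun_prop

lemma continuous_well' : Continuous (well' K κ) := by unfold well'; fun_prop

lemma continuous_well'' : Continuous (well'' K κ) := by unfold well''; fun_prop

lemma well'_neg (δ : ℝ) : well' K κ (-δ) = -well' K κ δ := by
  simp only [well', neg_sq]; ring

/-- The inequality is `s e^{-s} ≤ e^{-1}` at `s = 2 κ δ²`, after taking square roots; equality holds
at `δ = 1 / √(2κ)`. -/
lemma abs_well'_le (hK : 0 ≤ K) (hκ : 0 < κ) (δ : ℝ) :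
    |well' K κ δ| ≤ K * √(2 * κ / Real.exp 1) := by
  have hs : (2 * κ * δ ^ 2) * Real.exp (-(2 * κ * δ ^ 2)) ≤ (Real.exp 1)⁻¹ := by
    have h := Real.add_one_le_exp (2 * κ * δ ^ 2 - 1)
    rw [← Real.exp_neg, show (-1 : ℝ) = (2 * κ * δ ^ 2 - 1) + -(2 * κ * δ ^ 2) by ring,
      Real.exp_add]
    exact mul_le_mul_of_nonneg_right (by linarith) (Real.exp_pos _).le
  have hsq : |2 * κ * δ * Real.exp (-(κ * δ ^ 2))| ≤ √(2 * κ / Real.exp 1) := by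
    refine Real.abs_le_sqrt ?_
    have h2 : Real.exp (-(κ * δ ^ 2)) ^ 2 = Real.exp (-(2 * κ * δ ^ 2)) := by
      rw [← Real.exp_nat_mul]; congr 1; push_cast; ring
    calc (2 * κ * δ * Real.exp (-(κ * δ ^ 2))) ^ 2
        = 2 * κ * ((2 * κ * δ ^ 2) * Real.exp (-(2 * κ * δ ^ 2))) := by rw [← h2]; ring
      _ ≤ 2 * κ * (Real.exp 1)⁻¹ := by gcongr
      _ = 2 * κ / Real.exp 1 := by ring
  rw [show well' K κ δ = K * (2 * κ * δ * Real.exp (-(κ * δ ^ 2))) by rw [well']; ring, abs_mul,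
    abs_of_nonneg hK]
  gcongr

lemma abs_well'_max (hK : 0 ≤ K) (hκ : 0 < κ) :
    |well' K κ (1 / √(2 * κ))| = K * √(2 * κ / Real.exp 1) := by
  have h2 : 0 < √(2 * κ) := Real.sqrt_pos.2 (by positivity)
  have hsq : √(2 * κ) ^ 2 = 2 * κ := Real.sq_sqrt (by positivity)
  have e1 : κ * (1 / √(2 * κ)) ^ 2 = 1 / 2 := by
    rw [div_pow, hsq]; field_simp
  have e2 : Real.exp (-(1 / 2)) = (√(Real.exp 1))⁻¹ := by
    rw [Real.exp_neg, Real.exp_half]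
  rw [well', e1, e2, Real.sqrt_div (by positivity)]
  have e3 : 2 * K * κ * (1 / √(2 * κ)) = K * √(2 * κ) := by
    field_simp; rw [hsq]; ring
  rw [e3, abs_of_nonneg (by positivity)]
  ring

lemma tendsto_pow_mul_exp_neg_mul_sq (hκ : 0 < κ) (m : ℕ) :
    Tendsto (fun δ : ℝ => δ ^ m * Real.exp (-(κ * δ ^ 2))) (cocompact ℝ) (𝓝 0) := by
  rw [tendsto_zero_iff_norm_tendsto_zero]
  have h := tendsto_rpow_abs_mul_exp_neg_mul_sq_cocompact hκ m
  refine h.congr fun δ => ?_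
  rw [norm_mul, norm_pow, Real.norm_eq_abs, Real.norm_eq_abs, Real.abs_exp, Real.rpow_natCast,
    neg_mul]

lemma tendsto_well' (hκ : 0 < κ) : Tendsto (well' K κ) (cocompact ℝ) (𝓝 0) := by
  have h := (tendsto_pow_mul_exp_neg_mul_sq hκ 1).const_mul (2 * K * κ)
  rw [mul_zero] at h
  exact h.congr fun δ => by rw [well']; ring

lemma exists_bound_of_tendsto_cocompact {f : ℝ → ℝ} (hf : Continuous f)
    (h : Tendsto f (cocompact ℝ) (𝓝 0)) : ∃ C, 0 ≤ C ∧ ∀ x, |f x| ≤ C := by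
  obtain ⟨C, hC⟩ := isBounded_iff_forall_norm_le.1
    (ZeroAtInftyContinuousMap.isBounded_range (⟨⟨f, hf⟩, h⟩ : ZeroAtInftyContinuousMap ℝ ℝ))
  exact ⟨C, (norm_nonneg _).trans (hC _ ⟨0, rfl⟩), fun x => hC _ ⟨x, rfl⟩⟩

lemma exists_bound_well'' (hκ : 0 < κ) : ∃ C, 0 ≤ C ∧ ∀ δ, |well'' K κ δ| ≤ C := by
  refine exists_bound_of_tendsto_cocompact continuous_well'' ?_
  have h := ((tendsto_pow_mul_exp_neg_mul_sq hκ 0).sub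
    ((tendsto_pow_mul_exp_neg_mul_sq hκ 2).const_mul (2 * κ))).const_mul (2 * K * κ)
  simp only [mul_zero, sub_zero] at h
  exact h.congr fun δ => by rw [well'']; ring

lemma exists_bound_well''' (hκ : 0 < κ) : ∃ C, 0 ≤ C ∧ ∀ δ, |well''' K κ δ| ≤ C := by
  refine exists_bound_of_tendsto_cocompact (by unfold well'''; fun_prop) ?_
  have h := (((tendsto_pow_mul_exp_neg_mul_sq hκ 3).const_mul (4 * κ ^ 2)).sub
    ((tendsto_pow_mul_exp_neg_mul_sq hκ 1).const_mul (6 * κ))).const_mul (2 * K * κ)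
  simp only [mul_zero, sub_zero] at h
  exact h.congr fun δ => by rw [well''']; ring

lemma well''_pos_iff (hK : 0 < K) (hκ : 0 < κ) (δ : ℝ) :
    0 < well'' K κ δ ↔ δ ∈ Set.Ioo (-(1 / √(2 * κ))) (1 / √(2 * κ)) := by
  have h2 : 0 < √(2 * κ) := Real.sqrt_pos.2 (by positivity)
  have hsq : √(2 * κ) ^ 2 = 2 * κ := Real.sq_sqrt (by positivity)
  rw [well'', mul_pos_iff_of_pos_right (Real.exp_pos _), mul_pos_iff_of_pos_left (by positivity),
    sub_pos, Set.mem_Ioo, ← abs_lt, lt_div_iff₀ h2,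
    ← sq_lt_one_iff₀ (show 0 ≤ |δ| * √(2 * κ) by positivity), mul_pow, sq_abs, hsq, mul_comm]

end Bump

/-! ### Differentiation of population scores -/

section RegularScore

variable {S : Type} [MeasurableSpace S]

/-- A score with derivative `ψ'`, both bounded, and `ψ'` Lipschitz in the parameter, uniformly in
the data. -/
structure RegularScore (ψ ψ' : S → ℝ → ℝ) (M C L : ℝ) : Prop where
  meas : ∀ a, Measurable fun y => ψ y a
  meas' : ∀ a, Measurable fun y => ψ' y a
  hasDerivAt : ∀ y a, HasDerivAt (ψ y) (ψ' y a) a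
  bound : ∀ y a, |ψ y a| ≤ M
  bound' : ∀ y a, |ψ' y a| ≤ C
  lip : ∀ y a b, |ψ' y a - ψ' y b| ≤ L * |a - b|

namespace RegularScore

variable {ψ ψ' : S → ℝ → ℝ} {M C L : ℝ}

lemma integrable (h : RegularScore ψ ψ' M C L) (μ : Measure S) [IsFiniteMeasure μ] (a : ℝ) :
    Integrable (fun y => ψ y a) μ :=
  .of_bound (h.meas a).aestronglyMeasurable M (.of_forall fun y => h.bound y a)

lemma integrable' (h : RegularScore ψ ψ' M C L) (μ : Measure S) [IsFiniteMeasure μ] (a : ℝ) :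
    Integrable (fun y => ψ' y a) μ :=
  .of_bound (h.meas' a).aestronglyMeasurable C (.of_forall fun y => h.bound' y a)

lemma hasDerivAt_popScore (h : RegularScore ψ ψ' M C L) (μ : Measure S) [IsFiniteMeasure μ]
    (a : ℝ) : HasDerivAt (popScore ψ μ) (∫ y, ψ' y a ∂μ) a :=
  (hasDerivAt_integral_of_dominated_loc_of_deriv_le (F := fun a y => ψ y a)
    (F' := fun a y => ψ' y a) (bound := fun _ => C) univ_mem
    (.of_forall fun b => (h.meas b).aestronglyMeasurable) (h.integrable μ a)
    (h.meas' a).aestronglyMeasurable (.of_forall fun y b _ => h.bound' y b)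
    (integrable_const C) (.of_forall fun y b _ => h.hasDerivAt y b)).2

lemma sensitivity_eq (h : RegularScore ψ ψ' M C L) (μ : Measure S) [IsFiniteMeasure μ] (a : ℝ) :
    sensitivity ψ μ a = ∫ y, ψ' y a ∂μ :=
  (h.hasDerivAt_popScore μ a).deriv

lemma abs_popScore_le (h : RegularScore ψ ψ' M C L) (μ : Measure S) [IsProbabilityMeasure μ]
    (a : ℝ) : |popScore ψ μ a| ≤ M := by
  have := norm_integral_le_of_norm_le_const (μ := μ) (f := fun y => ψ y a)
    (.of_forall fun y => h.bound y a)
  simpa [popScore] using this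

end RegularScore

end RegularScore

/-! ### The score and the curvature of the criterion -/

section Structure

variable {n : ℕ} {F : PredictiveFamilies n} {G : AffineForm n} (D : RobustDivergence)

lemma profile_eq (hG : ∀ i, 0 < G.v1 i ∧ 0 < G.v2 i) (i : Fin n) :
    profile G D i = well (D.base (G.v2 i) (G.v1 i)) (D.amp (G.v2 i) (G.v1 i)) (kappa G D i) := by
  funext δ
  rw [profile, D.div_gaussianReal (Real.toNNReal_pos.2 (hG i).1) (Real.toNNReal_pos.2 (hG i).2),
    Real.coe_toNNReal _ (hG i).1.le, Real.coe_toNNReal _ (hG i).2.le, sub_zero]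
  rfl

lemma profile''_eq (hG : ∀ i, 0 < G.v1 i ∧ 0 < G.v2 i) (i : Fin n) :
    profile'' G D i = well'' (D.amp (G.v2 i) (G.v1 i)) (kappa G D i) := by
  have h1 : deriv (profile G D i) = well' (D.amp (G.v2 i) (G.v1 i)) (kappa G D i) := by
    rw [profile_eq D hG]
    exact funext fun δ => (hasDerivAt_well δ).deriv
  rw [profile'', h1]
  exact funext fun δ => (hasDerivAt_well' δ).deriv

lemma redesc_eq (i : Fin n) :
    redesc G D i = well' (D.amp (G.v2 i) (G.v1 i)) (kappa G D i) := rfl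

lemma kappa_pos (hG : ∀ i, 0 < G.v1 i ∧ 0 < G.v2 i) (i : Fin n) : 0 < kappa G D i :=
  D.rate_pos (hG i).2 (hG i).1

lemma amp_pos (hG : ∀ i, 0 < G.v1 i ∧ 0 < G.v2 i) (i : Fin n) :
    0 < D.amp (G.v2 i) (G.v1 i) :=
  D.amp_pos (hG i).2 (hG i).1

lemma hasDerivAt_disc (y : Fin n → ℝ) (i : Fin n) (a : ℝ) :
    HasDerivAt (G.disc y i) (-G.d i) a := by
  convert! (((hasDerivAt_id a).const_mul (G.d i)).const_add (G.c y i)).const_sub (G.m2 y i) using 1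
  simp

lemma continuous_disc (y : Fin n → ℝ) (i : Fin n) : Continuous (G.disc y i) := by
  unfold AffineForm.disc; fun_prop

/-- The curvature `∑ᵢ dᵢ² Dᵢ''(Δᵢ(a))` of the criterion. -/
def curvature (G : AffineForm n) (D : RobustDivergence) (y : Fin n → ℝ) (a : ℝ) : ℝ :=
  ∑ i, G.d i ^ 2 * profile'' G D i (G.disc y i a)

variable {D}

lemma ConditionsC1C2.div_eq (hC : ConditionsC1C2 F G) (y : Fin n → ℝ) (i : Fin n) :
    (fun a => D.div (F.loo y i) (F.swapped y i a)) = fun a =>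
      well (D.base (G.v2 i) (G.v1 i)) (D.amp (G.v2 i) (G.v1 i)) (kappa G D i) (G.disc y i a) :=
  funext fun a => (hC.2.2.2 D y i a).2

lemma ConditionsC1C2.hasDerivAt_div (hC : ConditionsC1C2 F G) (y : Fin n → ℝ) (i : Fin n)
    (a : ℝ) : HasDerivAt (fun b => D.div (F.loo y i) (F.swapped y i b))
      (-(G.d i * redesc G D i (G.disc y i a))) a := by
  rw [hC.div_eq]
  convert! (hasDerivAt_well _).comp a (hasDerivAt_disc y i a) using 1
  rw [redesc_eq]; ring

lemma ConditionsC1C2.score_eq (hC : ConditionsC1C2 F G) (y : Fin n → ℝ) :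
    score F D y = fun a => ∑ i, -(G.d i * redesc G D i (G.disc y i a)) :=
  funext fun a => Finset.sum_congr rfl fun i _ => (hC.hasDerivAt_div y i a).deriv

lemma ConditionsC1C2.hasDerivAt_objective (hC : ConditionsC1C2 F G) (y : Fin n → ℝ) (a : ℝ) :
    HasDerivAt (objective F D y) (score F D y a) a := by
  rw [hC.score_eq]
  exact HasDerivAt.fun_sum fun i _ => hC.hasDerivAt_div y i a

lemma ConditionsC1C2.hasDerivAt_score (hC : ConditionsC1C2 F G) (y : Fin n → ℝ) (a : ℝ) :
    HasDerivAt (score F D y) (curvature G D y a) a := by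
  rw [hC.score_eq]
  refine HasDerivAt.fun_sum fun i _ => ?_
  convert! (((hasDerivAt_well' _).comp a (hasDerivAt_disc y i a)).const_mul (G.d i)).neg using 1
  rw [profile''_eq D hC.1]; ring

lemma ConditionsC1C2.deriv_score (hC : ConditionsC1C2 F G) (y : Fin n → ℝ) :
    deriv (score F D y) = curvature G D y :=
  funext fun a => (hC.hasDerivAt_score y a).deriv

lemma ConditionsC1C2.continuous_curvature (hC : ConditionsC1C2 F G) (y : Fin n → ℝ) :
    Continuous (curvature G D y) := by
  refine continuous_finsetSum _ fun i _ => continuous_const.mul ?_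
  rw [profile''_eq D hC.1]
  exact continuous_well''.comp (continuous_disc y i)

lemma ConditionsC1C2.abs_redesc_le (hC : ConditionsC1C2 F G) (i : Fin n) (δ : ℝ) :
    |redesc G D i δ| ≤ redescBound G D i :=
  abs_well'_le (amp_pos D hC.1 i).le (kappa_pos D hC.1 i) δ

lemma ConditionsC1C2.abs_score_le (hC : ConditionsC1C2 F G) (y : Fin n → ℝ) (a : ℝ) :
    |score F D y a| ≤ scoreBound G D := by
  rw [hC.score_eq]
  refine (Finset.abs_sum_le_sum_abs _ _).trans (Finset.sum_le_sum fun i _ => ?_)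
  rw [abs_neg, abs_mul]
  exact mul_le_mul_of_nonneg_left (hC.abs_redesc_le i _) (abs_nonneg _)

lemma ConditionsC1C2.exists_regularScore (hC : ConditionsC1C2 F G)
    (hm : ∀ i, Measurable fun y => G.m2 y i - G.c y i) :
    ∃ C L, 0 ≤ C ∧ 0 ≤ L ∧
      RegularScore (score F D) (curvature G D) (scoreBound G D) C L := by
  choose C₂ hC₂ hb₂ using fun i => exists_bound_well'' (K := D.amp (G.v2 i) (G.v1 i))
    (kappa_pos D hC.1 i)
  choose C₃ hC₃ hb₃ using fun i => exists_bound_well''' (K := D.amp (G.v2 i) (G.v1 i))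
    (kappa_pos D hC.1 i)
  have hdisc : ∀ i a, Measurable fun y => G.disc y i a := fun i a => by
    simp only [AffineForm.disc, ← sub_sub]
    exact (hm i).sub_const _
  refine ⟨∑ i, G.d i ^ 2 * C₂ i, ∑ i, G.d i ^ 2 * (C₃ i * |G.d i|),
    Finset.sum_nonneg fun i _ => mul_nonneg (sq_nonneg _) (hC₂ i),
    Finset.sum_nonneg fun i _ => mul_nonneg (sq_nonneg _) (mul_nonneg (hC₃ i) (abs_nonneg _)), ?_⟩
  constructor
  · intro a
    simp_rw [hC.score_eq]
    refine Finset.measurable_fun_sum _ fun i _ => ((Measurable.const_mul ?_ _).neg)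
    exact continuous_well'.measurable.comp (hdisc i a)
  · intro a
    refine Finset.measurable_fun_sum _ fun i _ => (Measurable.const_mul ?_ _)
    rw [profile''_eq D hC.1]
    exact continuous_well''.measurable.comp (hdisc i a)
  · exact hC.hasDerivAt_score
  · exact hC.abs_score_le
  · intro y a
    refine (Finset.abs_sum_le_sum_abs _ _).trans (Finset.sum_le_sum fun i _ => ?_)
    rw [abs_mul, abs_of_nonneg (sq_nonneg _), profile''_eq D hC.1]
    exact mul_le_mul_of_nonneg_left (hb₂ i _) (sq_nonneg _)
  · intro y a b
    rw [curvature, curvature, ← Finset.sum_sub_distrib, Finset.sum_mul]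
    refine (Finset.abs_sum_le_sum_abs _ _).trans (Finset.sum_le_sum fun i _ => ?_)
    rw [← mul_sub, abs_mul, abs_of_nonneg (sq_nonneg _), profile''_eq D hC.1, mul_assoc]
    refine mul_le_mul_of_nonneg_left ?_ (sq_nonneg _)
    have hlip := Convex.norm_image_sub_le_of_norm_hasDerivWithin_le (s := Set.univ)
      (f := well'' (D.amp (G.v2 i) (G.v1 i)) (kappa G D i)) (C := C₃ i)
      (fun x _ => (hasDerivAt_well'' x).hasDerivWithinAt)
      (fun x _ => hb₃ i x) convex_univ (Set.mem_univ (G.disc y i b)) (Set.mem_univ (G.disc y i a))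
    rw [Real.norm_eq_abs, Real.norm_eq_abs] at hlip
    refine hlip.trans_eq ?_
    rw [show G.disc y i a - G.disc y i b = -(G.d i * (a - b)) by simp [AffineForm.disc]; ring,
      abs_neg, abs_mul, mul_assoc]

/-! ### Bounded influence -/

theorem ConditionsC1C2.boundedInfluence (hC : ConditionsC1C2 F G)
    (hm : ∀ i, Measurable fun y => G.m2 y i - G.c y i) : BoundedInfluence F G D := by
  obtain ⟨C, L, -, -, hreg⟩ := hC.exists_regularScore (D := D) hm
  refine ⟨fun i => ⟨fun δ => well'_neg δ, ⟨?_, fun B hB => ?_⟩, tendsto_well' (kappa_pos D hC.1 i)⟩,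
    fun y i a => hC.hasDerivAt_div y i a, hC.abs_score_le, fun μ _ a => ⟨?_, fun _ hs => ?_⟩⟩
  · rintro _ ⟨δ, rfl⟩
    exact hC.abs_redesc_le i δ
  · rw [redescBound, ← abs_well'_max (amp_pos D hC.1 i).le (kappa_pos D hC.1 i)]
    exact hB ⟨_, rfl⟩
  · simp_rw [hC.deriv_score]
    exact hreg.hasDerivAt_popScore μ a
  · have key : ∀ z, |influence (score F D) μ a z| ≤
        scoreBound G D / |sensitivity (score F D) μ a| := fun z => by
      rw [influence, neg_mul, abs_neg, abs_mul, abs_inv, inv_mul_eq_div]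
      exact div_le_div_of_nonneg_right (hC.abs_score_le z a) (abs_nonneg _)
    exact ⟨⟨_, by rintro _ ⟨z, rfl⟩; exact key z⟩, key⟩

/-! ### Local convexity -/

lemma curvature_pos {y : Fin n → ℝ} {a : ℝ}
    (hd : ∃ i, G.d i ≠ 0) (h : ∀ i, G.disc y i a ∈ convexityRegion G D i) :
    0 < curvature G D y a := by
  obtain ⟨i, hi⟩ := hd
  exact Finset.sum_pos' (fun j _ => mul_nonneg (sq_nonneg _) (h j).le)
    ⟨i, Finset.mem_univ i, mul_pos (pow_pos (abs_pos.2 hi) 2 |>.trans_eq (sq_abs _)) (h i)⟩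

lemma ConditionsC1C2.exists_strongConvexOn (hC : ConditionsC1C2 F G) (y : Fin n → ℝ) {a c : ℝ}
    (h : c < curvature G D y a) :
    ∃ r > 0, StrongConvexOn (Metric.ball a r) c (objective F D y) := by
  obtain ⟨r, hr, hball⟩ := Metric.eventually_nhds_iff_ball.1
    ((hC.continuous_curvature (D := D) y).continuousAt.eventually (lt_mem_nhds h))
  refine ⟨r, hr, strongConvexOn_iff_convex.2 ?_⟩
  have h1 : ∀ x, HasDerivAt (fun x => objective F D y x - c / 2 * ‖x‖ ^ 2)
      (score F D y x - c * x) x := fun x => by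
    simp_rw [Real.norm_eq_abs, sq_abs]
    convert! (hC.hasDerivAt_objective y x).sub ((hasDerivAt_pow 2 x).const_mul (c / 2)) using 1
    simp; ring
  have h2 : ∀ x, HasDerivAt (fun x => score F D y x - c * x) (curvature G D y x - c) x :=
    fun x => by
      convert! (hC.hasDerivAt_score y x).sub ((hasDerivAt_id x).const_mul c) using 1
      simp
  refine convexOn_of_hasDerivWithinAt2_nonneg (convex_ball a r)
    (fun x _ => (h1 x).continuousAt.continuousWithinAt)
    (fun x _ => (h1 x).hasDerivWithinAt) (fun x _ => (h2 x).hasDerivWithinAt) fun x hx => ?_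
  exact sub_nonneg.2 (hball x (interior_subset hx)).le

lemma integral_pos_of_ae_pos {S : Type*} [MeasurableSpace S] {μ : Measure S} [NeZero μ]
    {f : S → ℝ} (hf : Integrable f μ) (h : ∀ᵐ x ∂μ, 0 < f x) : 0 < ∫ x, f x ∂μ := by
  rw [integral_pos_iff_support_of_nonneg_ae (h.mono fun x hx => hx.le) hf, pos_iff_ne_zero]
  intro h0
  have : ∀ᵐ x ∂μ, False := by
    filter_upwards [h, measure_eq_zero_iff_ae_notMem.1 h0] with x hx hx'
    exact hx' hx.ne'
  exact NeZero.ne μ (by simpa using this)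

theorem ConditionsC1C2.localConvexity (hC : ConditionsC1C2 F G)
    (hm : ∀ i, Measurable fun y => G.m2 y i - G.c y i) : LocalConvexity F G D := by
  obtain ⟨C, L, -, -, hreg⟩ := hC.exists_regularScore (D := D) hm
  refine ⟨fun i => ⟨?_, ?_⟩, fun y a => ⟨hC.hasDerivAt_objective y a, hC.hasDerivAt_score y a⟩,
    fun y a hd h => curvature_pos hd h, fun y a c _ hc => ⟨?_, fun c' hc' =>
      hC.exists_strongConvexOn y (hc'.trans_le hc)⟩, fun μ _ a => ⟨hreg.sensitivity_eq μ a, ?_⟩⟩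
  · rw [profile_eq D hC.1]
    unfold well
    fun_prop
  · ext δ
    rw [convexityRegion, Set.mem_ofPred_eq, profile''_eq D hC.1]
    exact well''_pos_iff (amp_pos D hC.1 i) (kappa_pos D hC.1 i) δ
  · rw [show deriv (objective F D y) = score F D y from
      funext fun b => (hC.hasDerivAt_objective y b).deriv, hC.deriv_score]
    exact hc
  · intro hd hae
    rw [hreg.sensitivity_eq]
    exact integral_pos_of_ae_pos (hreg.integrable' μ a) (hae.mono fun y hy =>
      curvature_pos hd hy)

/-! ### The scalar score equation -/

lemma tendsto_affine_cocompact (u : ℝ) {d : ℝ} (hd : d ≠ 0) :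
    Tendsto (fun a : ℝ => u - d * a) (cocompact ℝ) (cocompact ℝ) :=
  ((Homeomorph.mulLeft₀ d hd).trans (Homeomorph.subLeft u)).isClosedEmbedding.tendsto_cocompact

lemma disc_eq_sub (y : Fin n → ℝ) (i : Fin n) (a : ℝ) :
    G.disc y i a = (G.m2 y i - G.c y i) - G.d i * a := by
  rw [AffineForm.disc, sub_sub]

/-- The part `∑ Kᵢ exp (-κᵢ Δᵢ(a)²)`, over `dᵢ ≠ 0`, by which the criterion lies below its limit
at infinity. -/
def dip (G : AffineForm n) (D : RobustDivergence) (y : Fin n → ℝ) (a : ℝ) : ℝ :=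
  ∑ i with G.d i ≠ 0, D.amp (G.v2 i) (G.v1 i) * Real.exp (-(kappa G D i * G.disc y i a ^ 2))

/-- The limit of the criterion at infinity; the terms with `dᵢ = 0` do not depend on `a`. -/
def ceiling (G : AffineForm n) (D : RobustDivergence) (y : Fin n → ℝ) : ℝ :=
  ∑ i with G.d i ≠ 0, D.base (G.v2 i) (G.v1 i) +
    ∑ i with ¬ G.d i ≠ 0,
      well (D.base (G.v2 i) (G.v1 i)) (D.amp (G.v2 i) (G.v1 i)) (kappa G D i)
        (G.m2 y i - G.c y i)

lemma ConditionsC1C2.objective_eq (hC : ConditionsC1C2 F G) (y : Fin n → ℝ) (a : ℝ) :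
    objective F D y a = ceiling G D y - dip G D y a := by
  have h : ∀ i, D.div (F.loo y i) (F.swapped y i a) = well (D.base (G.v2 i) (G.v1 i))
      (D.amp (G.v2 i) (G.v1 i)) (kappa G D i) (G.disc y i a) := fun i =>
    congrFun (hC.div_eq y i) a
  simp only [objective, h]
  rw [← Finset.sum_filter_add_sum_filter_not Finset.univ (fun i => G.d i ≠ 0), ceiling, dip,
    add_sub_right_comm, ← Finset.sum_sub_distrib]
  congr 1
  refine Finset.sum_congr rfl fun i hi => ?_
  have hd : G.d i = 0 := by simpa using hi
  rw [disc_eq_sub, hd, zero_mul, sub_zero]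

lemma ConditionsC1C2.dip_pos (hC : ConditionsC1C2 F G) (hd : ∃ i, G.d i ≠ 0) (y : Fin n → ℝ)
    (a : ℝ) : 0 < dip G D y a := by
  obtain ⟨i, hi⟩ := hd
  exact Finset.sum_pos (fun j _ => mul_pos (amp_pos D hC.1 j) (Real.exp_pos _))
    ⟨i, by simpa using hi⟩

lemma ConditionsC1C2.tendsto_dip (hC : ConditionsC1C2 F G) (y : Fin n → ℝ) :
    Tendsto (dip G D y) (cocompact ℝ) (𝓝 0) := by
  rw [show (0 : ℝ) = ∑ i with G.d i ≠ 0, D.amp (G.v2 i) (G.v1 i) * 0 by simp]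
  refine tendsto_finsetSum _ fun i hi => Tendsto.const_mul _ ?_
  have h := (tendsto_pow_mul_exp_neg_mul_sq (kappa_pos D hC.1 i) 0).comp
    (tendsto_affine_cocompact (G.m2 y i - G.c y i) (Finset.mem_filter.1 hi).2)
  refine h.congr fun a => ?_
  simp [disc_eq_sub]

lemma ConditionsC1C2.continuous_objective (hC : ConditionsC1C2 F G) (y : Fin n → ℝ) :
    Continuous (objective F D y) :=
  continuous_iff_continuousAt.2 fun a => (hC.hasDerivAt_objective y a).continuousAt

lemma ConditionsC1C2.exists_isMinOn (hC : ConditionsC1C2 F G) (y : Fin n → ℝ) :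
    ∃ a, IsMinOn (objective F D y) Set.univ a := by
  by_cases hd : ∃ i, G.d i ≠ 0
  · obtain ⟨a, ha⟩ := (hC.continuous_objective (D := D) y).exists_forall_le' 0 (by
      filter_upwards [(hC.tendsto_dip (D := D) y).eventually (gt_mem_nhds (hC.dip_pos hd y 0))]
        with a ha
      rw [hC.objective_eq, hC.objective_eq]
      linarith)
    exact ⟨a, fun b _ => ha b⟩
  · push Not at hd
    refine ⟨0, fun b _ => ?_⟩
    simp [hC.objective_eq, dip, hd]

/-- Each term of the score has the sign of `a - rᵢ`, where `rᵢ` is the root of `Δᵢ`. -/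
lemma ConditionsC1C2.scoreTerm_sign (hC : ConditionsC1C2 F G) (y : Fin n → ℝ) {i : Fin n}
    (hi : G.d i ≠ 0) (a : ℝ) :
    ∃ w : ℝ, 0 < w ∧ -(G.d i * redesc G D i (G.disc y i a)) =
      w * (a - (G.m2 y i - G.c y i) / G.d i) := by
  refine ⟨2 * D.amp (G.v2 i) (G.v1 i) * kappa G D i * G.d i ^ 2 *
    Real.exp (-(kappa G D i * G.disc y i a ^ 2)), ?_, ?_⟩
  · have := amp_pos D hC.1 i
    have := kappa_pos D hC.1 i
    have : 0 < G.d i ^ 2 := by positivity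
    positivity
  · rw [redesc]
    nth_rewrite 1 [disc_eq_sub]
    field_simp
    ring

theorem ConditionsC1C2.scalarScoreEquation (hC : ConditionsC1C2 F G) :
    ScalarScoreEquation F G D := by
  intro y
  refine ⟨hC.exists_isMinOn y, fun a => ⟨hC.hasDerivAt_objective y a, ?_⟩, fun a ha =>
    ha.hasDerivAt_eq_zero (hC.hasDerivAt_objective y a), fun ⟨k, hk⟩ a ha => ⟨?_, ?_⟩⟩
  · rw [hC.score_eq]
  all_goals
    by_contra! hcon
    rw [hC.score_eq] at ha
  · have : ∑ i, -(G.d i * redesc G D i (G.disc y i a)) < 0 := by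
      refine Finset.sum_neg' (fun i _ => ?_) ⟨k, Finset.mem_univ k, ?_⟩
      · by_cases hi : G.d i = 0
        · simp [hi]
        · obtain ⟨w, hw, h⟩ := hC.scoreTerm_sign (D := D) y hi a
          rw [h]
          exact mul_nonpos_of_nonneg_of_nonpos hw.le (by linarith [hcon i hi])
      · obtain ⟨w, hw, h⟩ := hC.scoreTerm_sign (D := D) y hk a
        rw [h]
        exact mul_neg_of_pos_of_neg hw (by linarith [hcon k hk])
    exact this.ne ha
  · have : 0 < ∑ i, -(G.d i * redesc G D i (G.disc y i a)) := by
      refine Finset.sum_pos' (fun i _ => ?_) ⟨k, Finset.mem_univ k, ?_⟩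
      · by_cases hi : G.d i = 0
        · simp [hi]
        · obtain ⟨w, hw, h⟩ := hC.scoreTerm_sign (D := D) y hi a
          rw [h]
          exact mul_nonneg hw.le (by linarith [hcon i hi])
      · obtain ⟨w, hw, h⟩ := hC.scoreTerm_sign (D := D) y hk a
        rw [h]
        exact mul_pos hw (by linarith [hcon k hk])
    exact this.ne' ha

end Structure

set_option linter.unusedSectionVars false

/-! ### Empirical means of independent observations -/

section Empirical

variable {Ω : Type w} [MeasurableSpace Ω] {S : Type} [MeasurableSpace S]

/-- The event `A N` has probability tending to one (for the outer measure, so that no measurability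
is needed). -/
def Whp (P : Measure Ω) (A : ℕ → Ω → Prop) : Prop :=
  Tendsto (fun N => P {ω | ¬ A N ω}) atTop (𝓝 0)

lemma Whp.mono {P : Measure Ω} {A B : ℕ → Ω → Prop} (hA : Whp P A)
    (h : ∀ N ω, A N ω → B N ω) : Whp P B :=
  tendsto_of_tendsto_of_tendsto_of_le_of_le tendsto_const_nhds hA (fun _ => zero_le)
    fun N => measure_mono fun ω hω hA => hω (h N ω hA)

lemma Whp.and {P : Measure Ω} {A B : ℕ → Ω → Prop} (hA : Whp P A) (hB : Whp P B) :
    Whp P fun N ω => A N ω ∧ B N ω := by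
  have h := hA.add hB
  rw [add_zero] at h
  refine tendsto_of_tendsto_of_tendsto_of_le_of_le tendsto_const_nhds h (fun _ => zero_le)
    fun N => (measure_mono fun ω hω => ?_).trans (measure_union_le _ _)
  exact not_and_or.1 hω

lemma whp_of_forall {P : Measure Ω} {A : ℕ → Ω → Prop} (h : ∀ N ω, A N ω) : Whp P A := by
  simp [Whp, h]

lemma Whp.forall_finite {P : Measure Ω} {ι : Type*} {t : Set ι} (ht : t.Finite)
    {A : ι → ℕ → Ω → Prop} (h : ∀ i ∈ t, Whp P (A i)) :
    Whp P fun N ω => ∀ i ∈ t, A i N ω := by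
  induction t, ht using Set.Finite.induction_on with
  | empty => exact whp_of_forall fun N ω i hi => hi.elim
  | insert _ _ ih =>
    refine ((h _ (Set.mem_insert _ _)).and
      (ih fun i hi => h i (Set.mem_insert_of_mem _ hi))).mono fun N ω hω i hi => ?_
    rcases hi with rfl | hi
    exacts [hω.1, hω.2 i hi]

/-- The empirical mean of `h` over the first `N` observations. -/
def emp (Y : ℕ → Ω → S) (h : S → ℝ) (N : ℕ) (ω : Ω) : ℝ :=
  (N : ℝ)⁻¹ * ∑ j ∈ Finset.range N, h (Y j ω)

lemma emp_mono (Y : ℕ → Ω → S) {h₁ h₂ : S → ℝ} (hle : ∀ y, h₁ y ≤ h₂ y) (N : ℕ) (ω : Ω) :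
    emp Y h₁ N ω ≤ emp Y h₂ N ω :=
  mul_le_mul_of_nonneg_left (Finset.sum_le_sum fun _ _ => hle _) (by positivity)

lemma emp_sub (Y : ℕ → Ω → S) (h₁ h₂ : S → ℝ) (N : ℕ) (ω : Ω) :
    emp Y (fun y => h₁ y - h₂ y) N ω = emp Y h₁ N ω - emp Y h₂ N ω := by
  simp only [emp, Finset.sum_sub_distrib, mul_sub]

lemma abs_emp_le (Y : ℕ → Ω → S) {h : S → ℝ} {c : ℝ} (hc : ∀ y, |h y| ≤ c) (N : ℕ) (ω : Ω) :
    |emp Y h N ω| ≤ c := by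
  have h0 : 0 ≤ c := (abs_nonneg _).trans (hc (Y 0 ω))
  rcases Nat.eq_zero_or_pos N with rfl | hN
  · simpa [emp] using h0
  have hN' : (0 : ℝ) < N := Nat.cast_pos.2 hN
  rw [emp, abs_mul, abs_of_pos (inv_pos.2 hN'), inv_mul_le_iff₀ hN']
  refine (Finset.abs_sum_le_sum_abs _ _).trans ((Finset.sum_le_sum fun j _ => hc _).trans_eq ?_)
  simp

lemma hasDerivAt_emp (Y : ℕ → Ω → S) {φ φ' : S → ℝ → ℝ}
    (h : ∀ y a, HasDerivAt (φ y) (φ' y a) a) (N : ℕ) (ω : Ω) (a : ℝ) :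
    HasDerivAt (fun a => emp Y (fun y => φ y a) N ω) (emp Y (fun y => φ' y a) N ω) a :=
  (HasDerivAt.fun_sum fun j _ => h (Y j ω) a).const_mul _

variable {P : Measure Ω} [IsProbabilityMeasure P] {μ : Measure S} {Y : ℕ → Ω → S}

lemma identDistrib_comp (hY : ∀ j, Measurable (Y j)) (hlaw : ∀ j, P.map (Y j) = μ) {h : S → ℝ}
    (hm : Measurable h) (j : ℕ) : IdentDistrib (fun ω => h (Y j ω)) (fun ω => h (Y 0 ω)) P P :=
  IdentDistrib.comp ⟨(hY j).aemeasurable, (hY 0).aemeasurable, by rw [hlaw, hlaw]⟩ hm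

lemma memLp_comp (hY : ∀ j, Measurable (Y j)) {h : S → ℝ} (hm : Measurable h) {c : ℝ}
    (hc : ∀ y, |h y| ≤ c) (p : ℝ≥0∞) (j : ℕ) : MemLp (fun ω => h (Y j ω)) p P :=
  .of_bound (hm.comp (hY j)).aestronglyMeasurable c (.of_forall fun _ => hc _)

lemma integral_comp (hY : ∀ j, Measurable (Y j)) (hlaw : ∀ j, P.map (Y j) = μ) {h : S → ℝ}
    (hm : Measurable h) (j : ℕ) : ∫ ω, h (Y j ω) ∂P = ∫ y, h y ∂μ := by
  rw [← hlaw j, integral_map (hY j).aemeasurable hm.aestronglyMeasurable]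

/-- Weak law of large numbers for bounded functions. -/
lemma whp_abs_emp_sub_lt (hY : ∀ j, Measurable (Y j)) (hind : iIndepFun Y P)
    (hlaw : ∀ j, P.map (Y j) = μ) {h : S → ℝ} (hm : Measurable h) {c : ℝ}
    (hc : ∀ y, |h y| ≤ c) {η : ℝ} (hη : 0 < η) :
    Whp P fun N ω => |emp Y h N ω - ∫ y, h y ∂μ| < η := by
  have hae := strong_law_ae_real (fun j ω => h (Y j ω))
    ((memLp_comp hY hm hc 1 0).integrable le_rfl)
    (fun i j hij => (hind.indepFun hij).comp hm hm) (identDistrib_comp hY hlaw hm)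
  rw [integral_comp hY hlaw hm] at hae
  have hmeas := tendstoInMeasure_of_tendsto_ae (f := emp Y h) (g := fun _ => ∫ y, h y ∂μ)
    (fun N => ((Finset.measurable_fun_sum _ fun j _ =>
      hm.comp (hY j)).const_mul _).aestronglyMeasurable)
    (hae.mono fun ω hω => hω.congr fun N => by rw [emp, inv_mul_eq_div])
  refine (tendstoInMeasure_iff_norm.1 hmeas η hη).congr fun N => ?_
  simp only [not_lt, Real.norm_eq_abs]

/-- Chebyshev's inequality for normalised sums. -/
lemma measure_le_sqrt_mul_abs_emp (hY : ∀ j, Measurable (Y j)) (hind : iIndepFun Y P)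
    (hlaw : ∀ j, P.map (Y j) = μ) {h : S → ℝ} (hm : Measurable h) {c : ℝ}
    (hc : ∀ y, |h y| ≤ c) (h0 : ∫ y, h y ∂μ = 0) {r : ℝ} (hr : 0 < r) (N : ℕ) :
    P {ω | r ≤ √(N : ℝ) * |emp Y h N ω|} ≤
      ENNReal.ofReal (Var[fun ω => h (Y 0 ω); P] / r ^ 2) := by
  rcases Nat.eq_zero_or_pos N with rfl | hN
  · simp [hr.not_ge]
  have hN' : (0 : ℝ) < N := Nat.cast_pos.2 hN
  have hs : 0 < √(N : ℝ) := Real.sqrt_pos.2 hN'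
  have hsq : √(N : ℝ) ^ 2 = N := Real.sq_sqrt hN'.le
  have hvar : Var[∑ j ∈ Finset.range N, (fun ω => h (Y j ω)); P] =
      N * Var[fun ω => h (Y 0 ω); P] := by
    rw [IndepFun.variance_sum (fun j _ => memLp_comp hY hm hc 2 j)
      fun i _ j _ hij => (hind.indepFun hij).comp hm hm,
      Finset.sum_congr rfl fun j _ => (identDistrib_comp hY hlaw hm j).variance_eq]
    simp
  have hmean : ∫ ω, (∑ j ∈ Finset.range N, fun ω => h (Y j ω)) ω ∂P = 0 := by
    simp only [Finset.sum_apply]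
    rw [integral_finsetSum _ fun j _ => (memLp_comp hY hm hc 1 j).integrable le_rfl]
    simp [integral_comp hY hlaw hm, h0]
  have hche := meas_ge_le_variance_div_sq (c := r * √(N : ℝ)) (memLp_finsetSum' (Finset.range N)
    fun j _ => memLp_comp (P := P) hY hm hc 2 j) (by positivity)
  rw [hmean, hvar, mul_pow, hsq] at hche
  refine (measure_mono fun ω hω => ?_).trans (hche.trans_eq ?_)
  · simp only [Set.mem_ofPred_eq, sub_zero, Finset.sum_apply] at hω ⊢
    rw [emp, abs_mul, abs_of_pos (inv_pos.2 hN')] at hω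
    nth_rewrite 2 [← hsq] at hω
    rw [show √(N : ℝ) * ((√(N : ℝ) ^ 2)⁻¹ * |∑ j ∈ Finset.range N, h (Y j ω)|) =
      |∑ j ∈ Finset.range N, h (Y j ω)| / √(N : ℝ) by field_simp, le_div_iff₀ hs] at hω
    exact hω
  · congr 1
    field_simp

end Empirical

/-! ### Roots of nearly linear functions -/

section Roots

variable {f f' : ℝ → ℝ} {a₀ A : ℝ}

lemma abs_linearization_le (hf : ∀ x, HasDerivAt f (f' x) x) {c r t : ℝ} (ht : |t - a₀| ≤ r)
    (hc : ∀ x, |x - a₀| ≤ r → |f' x - A| ≤ c) :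
    |f t - f a₀ - A * (t - a₀)| ≤ c * |t - a₀| := by
  have h := Convex.norm_image_sub_le_of_norm_hasDerivWithin_le (s := Metric.closedBall a₀ r)
    (f := fun x => f x - A * x) (f' := fun x => f' x - A) (x := a₀) (y := t) (C := c)
    (fun x _ => by
      have := (hf x).sub ((hasDerivAt_id x).const_mul A)
      rw [mul_one] at this
      exact this.hasDerivWithinAt)
    (fun x hx => hc x (by simpa [Real.dist_eq] using hx)) (convex_closedBall a₀ r)
    (Metric.mem_closedBall_self ((abs_nonneg _).trans ht))
    (by simpa [Real.dist_eq] using ht)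
  rw [Real.norm_eq_abs, Real.norm_eq_abs] at h
  rwa [show f t - f a₀ - A * (t - a₀) = f t - A * t - (f a₀ - A * a₀) by ring]

lemma existsUnique_root_of_nearly_linear (hA : A ≠ 0) {δ : ℝ} (hδ : 0 < δ)
    (hf : ∀ x, HasDerivAt f (f' x) x)
    (hf' : ∀ x, |x - a₀| ≤ δ → |f' x - A| ≤ |A| / 2) (h0 : |f a₀| < δ * |A| / 2) :
    ∃! a, a ∈ Set.Icc (a₀ - δ) (a₀ + δ) ∧ f a = 0 := by
  have hA' : 0 < |A| := abs_pos.2 hA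
  -- after division by `A` the slope is at least `1/2`
  have hg : ∀ x, HasDerivAt (fun x => A⁻¹ * f x) (A⁻¹ * f' x) x := fun x => (hf x).const_mul _
  have hg' : ∀ x, |x - a₀| ≤ δ → 1 / 2 ≤ A⁻¹ * f' x := fun x hx => by
    have h1 : |A⁻¹ * f' x - 1| ≤ 1 / 2 := by
      rw [show A⁻¹ * f' x - 1 = A⁻¹ * (f' x - A) by field_simp, abs_mul, abs_inv,
        inv_mul_le_iff₀ hA']
      linarith [hf' x hx]
    linarith [(abs_le.1 h1).1]
  have hg0 : |A⁻¹ * f a₀| < δ / 2 := by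
    rw [abs_mul, abs_inv, inv_mul_lt_iff₀ hA']
    linarith
  have hIcc : ∀ {x}, x ∈ Set.Icc (a₀ - δ) (a₀ + δ) ↔ |x - a₀| ≤ δ := fun {x} => by
    rw [abs_le, Set.mem_Icc]
    constructor <;> rintro ⟨h1, h2⟩ <;> constructor <;> linarith
  have hinc : ∀ x ∈ Set.Icc (a₀ - δ) (a₀ + δ), ∀ y ∈ Set.Icc (a₀ - δ) (a₀ + δ), x ≤ y →
      1 / 2 * (y - x) ≤ A⁻¹ * f y - A⁻¹ * f x :=
    (convex_Icc _ _).mul_sub_le_image_sub_of_le_deriv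
      (fun x _ => (hg x).continuousAt.continuousWithinAt)
      (fun x _ => (hg x).differentiableAt.differentiableWithinAt)
      fun x hx => by rw [(hg x).deriv]; exact hg' x (hIcc.1 (interior_subset hx))
  have hm0 : a₀ ∈ Set.Icc (a₀ - δ) (a₀ + δ) := ⟨by linarith, by linarith⟩
  have hml : a₀ - δ ∈ Set.Icc (a₀ - δ) (a₀ + δ) := ⟨le_rfl, by linarith⟩
  have hmr : a₀ + δ ∈ Set.Icc (a₀ - δ) (a₀ + δ) := ⟨by linarith, le_rfl⟩
  have h1 := hinc _ hml _ hm0 (by linarith)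
  have h2 := hinc _ hm0 _ hmr (by linarith)
  rw [abs_lt] at hg0
  obtain ⟨a, ha, hroot⟩ := intermediate_value_Icc (by linarith : a₀ - δ ≤ a₀ + δ)
    (fun x _ => (hg x).continuousAt.continuousWithinAt)
    (show (0 : ℝ) ∈ Set.Icc _ _ from ⟨by linarith, by linarith⟩)
  have hz : ∀ {x}, f x = 0 → A⁻¹ * f x = 0 := fun h => by rw [h, mul_zero]
  refine ⟨a, ⟨ha, by simpa [hA] using hroot⟩, fun b ⟨hb, hb0⟩ => ?_⟩
  have hroot' : A⁻¹ * f a = 0 := hroot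
  rcases le_total a b with hab | hab
  · have := hinc _ ha _ hb hab
    rw [hz hb0, hroot'] at this
    linarith
  · have := hinc _ hb _ ha hab
    rw [hz hb0, hroot'] at this
    linarith

end Roots

/-! ### Asymptotic normality of roots -/

section MTheory

variable {Ω : Type w} [MeasurableSpace Ω] {P : Measure Ω} [IsProbabilityMeasure P]
  {S : Type} [MeasurableSpace S] {μ : Measure S} [IsProbabilityMeasure μ] {Y : ℕ → Ω → S}
  {ψ ψ' : S → ℝ → ℝ} {M C L : ℝ} {a₀ A : ℝ}

namespace RegularScore

lemma abs_emp_deriv_sub_le (h : RegularScore ψ ψ' M C L) (N : ℕ) (ω : Ω) (a b : ℝ) :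
    |emp Y (fun y => ψ' y a) N ω - emp Y (fun y => ψ' y b) N ω| ≤ L * |a - b| := by
  rw [← emp_sub]
  exact abs_emp_le Y (fun y => h.lip y a b) N ω

/-- With high probability the empirical slope is close to the population slope, on a whole
neighbourhood of `a₀`. -/
lemma whp_slope (h : RegularScore ψ ψ' M C L) (hL : 0 ≤ L) (hY : ∀ j, Measurable (Y j))
    (hind : iIndepFun Y P) (hlaw : ∀ j, P.map (Y j) = μ) (hA : ∫ y, ψ' y a₀ ∂μ = A) {δ η : ℝ}
    (hδ : L * δ < η) :
    Whp P fun N ω => ∀ x, |x - a₀| ≤ δ → |emp Y (fun y => ψ' y x) N ω - A| ≤ η := by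
  refine (whp_abs_emp_sub_lt hY hind hlaw (h.meas' a₀) (fun y => h.bound' y a₀)
    (sub_pos.2 hδ)).mono fun N ω hω x hx => ?_
  rw [hA] at hω
  have h1 := h.abs_emp_deriv_sub_le (Y := Y) N ω x a₀
  have h2 := mul_le_mul_of_nonneg_left hx hL
  calc _ = |(emp Y (fun y => ψ' y x) N ω - emp Y (fun y => ψ' y a₀) N ω) +
        (emp Y (fun y => ψ' y a₀) N ω - A)| := by ring_nf
    _ ≤ _ := (abs_add_le _ _).trans (by linarith)

lemma whp_abs_emp_lt (h : RegularScore ψ ψ' M C L) (hY : ∀ j, Measurable (Y j))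
    (hind : iIndepFun Y P) (hlaw : ∀ j, P.map (Y j) = μ) (h0 : popScore ψ μ a₀ = 0) {η : ℝ}
    (hη : 0 < η) : Whp P fun N ω => |emp Y (fun y => ψ y a₀) N ω| < η := by
  refine (whp_abs_emp_sub_lt hY hind hlaw (h.meas a₀) (fun y => h.bound y a₀) hη).mono
    fun N ω hω => ?_
  rwa [show ∫ y, ψ y a₀ ∂μ = 0 from h0, sub_zero] at hω

lemma whp_existsUnique_root (h : RegularScore ψ ψ' M C L) (hL : 0 ≤ L)
    (hY : ∀ j, Measurable (Y j)) (hind : iIndepFun Y P) (hlaw : ∀ j, P.map (Y j) = μ)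
    (h0 : popScore ψ μ a₀ = 0) (hA : ∫ y, ψ' y a₀ ∂μ = A) (hA0 : A ≠ 0) {δ : ℝ} (hδ : 0 < δ)
    (hδL : L * δ < |A| / 2) :
    Whp P fun N ω => ∃! a, a ∈ Set.Icc (a₀ - δ) (a₀ + δ) ∧ emp Y (fun y => ψ y a) N ω = 0 := by
  have hA' : 0 < |A| := abs_pos.2 hA0
  refine ((h.whp_slope hL hY hind hlaw hA hδL).and
    (h.whp_abs_emp_lt hY hind hlaw h0 (show 0 < δ * |A| / 2 by positivity))).mono
    fun N ω hω => ?_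
  exact existsUnique_root_of_nearly_linear hA0 hδ (hasDerivAt_emp Y h.hasDerivAt N ω) hω.1 hω.2

/-- The central limit theorem for the normalised empirical score. -/
lemma tendstoInDistribution_neg_inv_mul_score (h : RegularScore ψ ψ' M C L)
    (hY : ∀ j, Measurable (Y j)) (hind : iIndepFun Y P) (hlaw : ∀ j, P.map (Y j) = μ)
    (h0 : popScore ψ μ a₀ = 0) (hA : ∫ y, ψ' y a₀ ∂μ = A) (hA0 : A ≠ 0) :
    TendstoInDistribution
      (fun (N : ℕ) ω => -A⁻¹ * (√(N : ℝ) * emp Y (fun y => ψ y a₀) N ω)) atTop (id : ℝ → ℝ)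
      (fun _ => P) (gaussianReal 0 (asympVar ψ μ a₀).toNNReal) := by
  have hA2 : 0 < A ^ 2 := by positivity
  have hvar : Var[fun ω => ψ (Y 0 ω) a₀; P] = Var[fun y => ψ y a₀; μ] := by
    rw [← hlaw 0, variance_map (h.meas a₀).aemeasurable (hY 0).aemeasurable]
    rfl
  have hV : ((asympVar ψ μ a₀).toNNReal : ℝ) = Var[fun y => ψ y a₀; μ] / A ^ 2 := by
    rw [asympVar, h.sensitivity_eq, hA, ← (MemLp.of_bound (h.meas a₀).aestronglyMeasurable M
      (.of_forall fun y => h.bound y a₀)).ofReal_variance_eq, ← ENNReal.ofReal_div_of_pos hA2]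
    exact Real.coe_toNNReal _ (div_nonneg (variance_nonneg _ _) hA2.le)
  have hZ : HasLaw (fun x : ℝ => -A * x)
      (gaussianReal 0 (Var[fun ω => ψ (Y 0 ω) a₀; P]).toNNReal)
      (gaussianReal 0 (asympVar ψ μ a₀).toNNReal) := by
    refine ⟨by fun_prop, ?_⟩
    rw [gaussianReal_map_const_mul, mul_zero]
    congr 1
    refine NNReal.coe_injective ?_
    rw [NNReal.coe_mul, NNReal.coe_mk, hV, hvar, Real.coe_toNNReal _ (variance_nonneg _ _), neg_sq]
    field_simp
  have hclt := tendstoInDistribution_inv_sqrt_mul_sum_sub (X := fun j ω => ψ (Y j ω) a₀) hZ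
    (memLp_comp hY (h.meas a₀) (fun y => h.bound y a₀) 2 0)
    (hind.comp (fun _ y => ψ y a₀) fun _ => h.meas a₀) (identDistrib_comp hY hlaw (h.meas a₀))
  rw [integral_comp hY hlaw (h.meas a₀), show ∫ y, ψ y a₀ ∂μ = 0 from h0] at hclt
  have hcomp := hclt.continuous_comp (g := fun x : ℝ => -A⁻¹ * x) (by fun_prop)
  convert! hcomp using 1
  · funext N ω
    simp only [Function.comp, emp, mul_zero, sub_zero]
    rw [← mul_assoc (√(N : ℝ)), ← div_eq_mul_inv, Real.sqrt_div_self]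
  · funext x
    simp only [Function.comp, id]
    field_simp

/-- `√N`-consistency and asymptotic normality of any approximate selection of roots near `a₀`. -/
theorem rootNNormal (h : RegularScore ψ ψ' M C L) (hL : 0 ≤ L)
    (hY : ∀ j, Measurable (Y j)) (hind : iIndepFun Y P) (hlaw : ∀ j, P.map (Y j) = μ)
    (h0 : popScore ψ μ a₀ = 0) (hA : ∫ y, ψ' y a₀ ∂μ = A) (hA0 : A ≠ 0) {δ : ℝ}
    (hδL : L * δ < |A| / 2) {T : ℕ → Ω → ℝ} (hT : ∀ N, AEMeasurable (T N) P)
    (hroot : Whp P fun N ω => T N ω ∈ Set.Icc (a₀ - δ) (a₀ + δ) ∧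
      emp Y (fun y => ψ y (T N ω)) N ω = 0) :
    RootNNormal P T a₀ (asympVar ψ μ a₀).toNNReal := by
  have hA' : 0 < |A| := abs_pos.2 hA0
  have habs : ∀ {x}, x ∈ Set.Icc (a₀ - δ) (a₀ + δ) → |x - a₀| ≤ δ := fun {x} hx => by
    rw [abs_le]; constructor <;> linarith [hx.1, hx.2]
  -- the estimation error is controlled by the score at `a₀`
  have hlin : Whp P fun N ω => |A| / 2 * |T N ω - a₀| ≤ |emp Y (fun y => ψ y a₀) N ω| := by
    refine (hroot.and (h.whp_slope hL hY hind hlaw hA hδL)).mono fun N ω ⟨⟨hmem, hz⟩, hsl⟩ => ?_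
    have hl := abs_linearization_le (hasDerivAt_emp Y h.hasDerivAt N ω) (habs hmem) hsl
    have h1 : |A * (T N ω - a₀)| ≤ |emp Y (fun y => ψ y (T N ω)) N ω
        - emp Y (fun y => ψ y a₀) N ω - A * (T N ω - a₀)| + |emp Y (fun y => ψ y a₀) N ω| := by
      rw [hz, zero_sub, ← abs_neg (A * (T N ω - a₀))]
      refine le_trans (le_of_eq ?_) (abs_add_le _ _)
      congr 1
      ring
    rw [abs_mul] at h1
    linarith
  have htight : ∀ η : ℝ, 0 < η → ∃ R : ℝ, 0 < R ∧ ∀ᶠ N : ℕ in atTop,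
      P {ω | R ≤ √(N : ℝ) * |T N ω - a₀|} ≤ ENNReal.ofReal η := by
    intro η hη
    set B := Var[fun ω => ψ (Y 0 ω) a₀; P]
    have hB : 0 ≤ B := variance_nonneg _ _
    obtain ⟨r, hr, hrB⟩ : ∃ r : ℝ, 0 < r ∧ B / r ^ 2 ≤ η / 2 := by
      refine ⟨√(2 * (B + 1) / η), by positivity, ?_⟩
      rw [Real.sq_sqrt (by positivity), div_div_eq_mul_div, div_le_div_iff₀ (by positivity) two_pos]
      nlinarith
    refine ⟨2 * r / |A|, by positivity, ?_⟩
    filter_upwards [hlin.eventually (ge_mem_nhds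
      (show (0 : ℝ≥0∞) < ENNReal.ofReal (η / 2) by simpa using hη))] with N hN
    have hche :=
      measure_le_sqrt_mul_abs_emp hY hind hlaw (h.meas a₀) (fun y => h.bound y a₀) h0 hr N
    refine (measure_mono (t := {ω | ¬ |A| / 2 * |T N ω - a₀| ≤ |emp Y (fun y => ψ y a₀) N ω|} ∪
      {ω | r ≤ √(N : ℝ) * |emp Y (fun y => ψ y a₀) N ω|}) fun ω hω => ?_).trans
      ((measure_union_le _ _).trans ((add_le_add hN
        (hche.trans (ENNReal.ofReal_le_ofReal hrB))).trans_eq ?_))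
    · by_cases hgood : |A| / 2 * |T N ω - a₀| ≤ |emp Y (fun y => ψ y a₀) N ω|
      · right
        have h1 : 2 * r / |A| ≤ √(N : ℝ) * |T N ω - a₀| := hω
        have h2 := mul_le_mul_of_nonneg_left hgood (Real.sqrt_nonneg (N : ℝ))
        rw [div_le_iff₀ hA'] at h1
        rw [Set.mem_ofPred_eq]
        linarith
      · exact Or.inl hgood
    · rw [← ENNReal.ofReal_add (by positivity) (by positivity), add_halves]
  refine ⟨fun η hη => ?_, ?_⟩
  · obtain ⟨R, -, hR⟩ := htight η hη
    exact ⟨R, hR⟩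
  refine tendstoInDistribution_of_tendstoInMeasure_sub _ _
    (h.tendstoInDistribution_neg_inv_mul_score hY hind hlaw h0 hA hA0) ?_
    fun N => ((hT N).sub_const a₀).const_mul _
  rw [tendstoInMeasure_iff_norm]
  intro ε hε
  rw [ENNReal.tendsto_nhds_zero]
  intro η hη
  -- tight times small is small
  obtain ⟨η', hη', hle⟩ : ∃ η' : ℝ, 0 < η' ∧ ENNReal.ofReal (2 * η') ≤ η := by
    rcases eq_or_ne η ⊤ with rfl | htop
    · exact ⟨1, one_pos, le_top⟩
    · refine ⟨η.toReal / 2, half_pos (ENNReal.toReal_pos hη.ne' htop), ?_⟩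
      rw [mul_div_cancel₀ _ two_ne_zero, ENNReal.ofReal_toReal htop]
  obtain ⟨R, hR, hRN⟩ := htight η' hη'
  set c := |A| * ε / (2 * R)
  have hc : 0 < c := by positivity
  obtain ⟨ρ, hρ, hρL⟩ : ∃ ρ : ℝ, 0 < ρ ∧ L * ρ < c := by
    refine ⟨c / (2 * (L + 1)), by positivity, ?_⟩
    rw [mul_div_assoc', div_lt_iff₀ (by positivity)]
    nlinarith [mul_nonneg hL hc.le]
  have hgood : Whp P fun N ω => emp Y (fun y => ψ y (T N ω)) N ω = 0 ∧ |T N ω - a₀| ≤ ρ ∧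
      ∀ x, |x - a₀| ≤ ρ → |emp Y (fun y => ψ' y x) N ω - A| ≤ c := by
    refine ((hroot.and hlin).and ((h.whp_slope hL hY hind hlaw hA hρL).and
      (h.whp_abs_emp_lt hY hind hlaw h0 (show 0 < |A| / 2 * ρ by positivity)))).mono
      fun N ω ⟨⟨h1, h2⟩, h3, h4⟩ => ⟨h1.2, ?_, h3⟩
    exact le_of_mul_le_mul_left (h2.trans h4.le) (by positivity)
  filter_upwards [hRN, hgood.eventually (ge_mem_nhds
    (show (0 : ℝ≥0∞) < ENNReal.ofReal η' by simpa using hη'))] with N hN1 hN2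
  refine (measure_mono (t := _ ∪ _) fun ω hω => ?_).trans ((measure_union_le _ _).trans
    ((add_le_add hN1 hN2).trans (le_trans (le_of_eq ?_) hle)))
  · by_contra hcon
    rw [Set.mem_union, not_or] at hcon
    simp only [Set.mem_ofPred_eq, not_le, not_not] at hcon
    obtain ⟨hc1, hz, hc2, hc3⟩ := hcon
    have hl := abs_linearization_le (hasDerivAt_emp Y h.hasDerivAt N ω) hc2 hc3
    rw [hz, zero_sub] at hl
    simp only [Set.mem_ofPred_eq, Pi.sub_apply, Pi.zero_apply, sub_zero, Real.norm_eq_abs] at hω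
    rw [show √(N : ℝ) * (T N ω - a₀) - -A⁻¹ * (√(N : ℝ) * emp Y (fun y => ψ y a₀) N ω) =
      -A⁻¹ * (√(N : ℝ) * (-emp Y (fun y => ψ y a₀) N ω - A * (T N ω - a₀))) by field_simp; ring,
      abs_mul, abs_neg, abs_inv, abs_mul, abs_of_nonneg (Real.sqrt_nonneg _),
      le_inv_mul_iff₀ hA'] at hω
    have h1 := mul_le_mul_of_nonneg_left hl (Real.sqrt_nonneg (N : ℝ))
    have h2 : c * (√(N : ℝ) * |T N ω - a₀|) < c * R := mul_lt_mul_of_pos_left hc1 hc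
    have h3 : c * R = |A| * ε / 2 := by simp only [c]; field_simp
    have h4 : 0 < |A| * ε := by positivity
    linarith
  · rw [← ENNReal.ofReal_add hη'.le hη'.le, two_mul]

end RegularScore

/-! ### Consistency of minimisers -/

/-- Near-maximisers of the empirical mean of a bounded, equi-Lipschitz function that vanishes at
infinity are consistent, even over an unbounded set. -/
theorem whp_near_of_maximiser {γ : S → ℝ → ℝ} {env : ℕ → S → ℝ} {B Λ : ℝ}
    (hY : ∀ j, Measurable (Y j)) (hind : iIndepFun Y P) (hlaw : ∀ j, P.map (Y j) = μ)
    (hm : ∀ a, Measurable fun y => γ y a) (hb : ∀ y a, |γ y a| ≤ B) (hpos : ∀ y, 0 < γ y a₀)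
    (hlip : ∀ y a b, |γ y a - γ y b| ≤ Λ * |a - b|)
    (hem : ∀ R, Measurable (env R)) (heb : ∀ R y, |env R y| ≤ B)
    (henv : ∀ (R : ℕ) y a, (R : ℝ) ≤ |a| → γ y a ≤ env R y)
    (hez : ∀ y, Tendsto (fun R => env R y) atTop (𝓝 0))
    {𝒜 : Set ℝ} (h𝒜 : IsClosed 𝒜)
    (hmax : ∀ a ∈ 𝒜, a ≠ a₀ → ∫ y, γ y a ∂μ < ∫ y, γ y a₀ ∂μ)
    {T : ℕ → Ω → ℝ} (hT : ∀ N ω, T N ω ∈ 𝒜 ∧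
      emp Y (fun y => γ y a₀) N ω ≤ emp Y (fun y => γ y (T N ω)) N ω)
    {δ : ℝ} (hδ : 0 < δ) : Whp P fun N ω => |T N ω - a₀| < δ := by
  have hint : ∀ a, Integrable (fun y => γ y a) μ := fun a =>
    .of_bound (hm a).aestronglyMeasurable B (.of_forall fun y => hb y a)
  set g₀ := ∫ y, γ y a₀ ∂μ
  have hg₀ : 0 < g₀ := integral_pos_of_ae_pos (hint a₀) (.of_forall hpos)
  have hΛ : 0 ≤ Λ := by
    obtain ⟨y⟩ := nonempty_of_isProbabilityMeasure μ
    have := (abs_nonneg _).trans (hlip y 1 0)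
    simpa using this
  -- far away the envelope is small
  have hlim : Tendsto (fun R => ∫ y, env R y ∂μ) atTop (𝓝 (∫ _, (0 : ℝ) ∂μ)) :=
    tendsto_integral_of_dominated_convergence (fun _ => B)
      (fun R => (hem R).aestronglyMeasurable) (integrable_const B)
      (fun R => .of_forall (heb R)) (.of_forall hez)
  rw [integral_zero] at hlim
  obtain ⟨R, hR⟩ := (hlim.eventually (gt_mem_nhds (show 0 < g₀ / 3 by positivity))).exists
  have hfar : Whp P fun N ω => |T N ω| < R := by
    refine ((whp_abs_emp_sub_lt hY hind hlaw (hem R) (heb R) (show 0 < g₀ / 3 by positivity)).and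
      (whp_abs_emp_sub_lt hY hind hlaw (hm a₀) (fun y => hb y a₀)
        (show 0 < g₀ / 3 by positivity))).mono fun N ω ⟨h1, h2⟩ => ?_
    by_contra! hcon
    have h3 := emp_mono Y (fun y => henv R y (T N ω) hcon) N ω
    linarith [(abs_lt.1 h1).2, (abs_lt.1 h2).1, (hT N ω).2]
  -- on the remaining compact set the population value is separated from its maximum
  set 𝒦 : Set ℝ := 𝒜 ∩ (Metric.closedBall 0 R ∩ {a | δ ≤ |a - a₀|})
  have h𝒦 : IsCompact 𝒦 := ((isCompact_closedBall _ _).inter_right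
    (isClosed_le continuous_const (by fun_prop))).inter_left h𝒜
  have hcont : Continuous fun a => ∫ y, γ y a ∂μ :=
    continuous_of_dominated (fun a => (hm a).aestronglyMeasurable)
      (fun a => .of_forall fun y => hb y a) (integrable_const B)
      (.of_forall fun y => (LipschitzWith.of_dist_le_mul (K := ⟨Λ, hΛ⟩)
        fun a b => hlip y a b).continuous)
  obtain ⟨η, hη, hsep⟩ : ∃ η : ℝ, 0 < η ∧ ∀ a ∈ 𝒦, ∫ y, γ y a ∂μ ≤ g₀ - 3 * η := by
    rcases 𝒦.eq_empty_or_nonempty with he | hne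
    · exact ⟨1, one_pos, by simp [he]⟩
    · obtain ⟨b, hb𝒦, hbmax⟩ := h𝒦.exists_isMaxOn hne hcont.continuousOn
      have hlt := hmax b hb𝒦.1 (by
        rintro rfl
        have := hb𝒦.2.2
        simp at this
        linarith)
      refine ⟨(g₀ - ∫ y, γ y b ∂μ) / 3, by linarith, fun a ha => ?_⟩
      have : ∫ y, γ y a ∂μ ≤ ∫ y, γ y b ∂μ := hbmax ha
      linarith
  obtain ⟨t, ht𝒦, htf, hcov⟩ := h𝒦.finite_cover_balls (show 0 < η / (Λ + 1) by positivity)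
  have hnear : Whp P fun N ω => T N ω ∉ 𝒦 := by
    refine ((Whp.forall_finite htf fun x _ => whp_abs_emp_sub_lt hY hind hlaw
      (hm x) (fun y => hb y x) hη).and (whp_abs_emp_sub_lt hY hind hlaw (hm a₀)
      (fun y => hb y a₀) hη)).mono fun N ω ⟨h1, h2⟩ hmem => ?_
    obtain ⟨x, hx, hxT⟩ := Set.mem_iUnion₂.1 (hcov hmem)
    rw [Metric.mem_ball, Real.dist_eq, lt_div_iff₀ (by positivity)] at hxT
    have h3 := abs_emp_le Y (fun y => hlip y (T N ω) x) N ω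
    rw [emp_sub] at h3
    have h4 := hsep x (ht𝒦 hx)
    have h5 : Λ * |T N ω - x| ≤ η := by nlinarith [abs_nonneg (T N ω - x)]
    linarith [(abs_lt.1 (h1 x hx)).2, (abs_lt.1 h2).1, (abs_le.1 h3).2, (hT N ω).2]
  refine (hfar.and hnear).mono fun N ω ⟨h1, h2⟩ => ?_
  by_contra! hcon
  exact h2 ⟨(hT N ω).1, by simpa using h1.le, hcon⟩

end MTheory

/-! ### Asymptotic normality of the criterion's roots and minimisers -/

section CriterionAsymptotics

variable {n : ℕ} {F : PredictiveFamilies n} {G : AffineForm n} {D : RobustDivergence}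

/-- A bound for `dip G D y a` over all `|a| ≥ R`. -/
def dipEnvelope (G : AffineForm n) (D : RobustDivergence) (R : ℕ) (y : Fin n → ℝ) : ℝ :=
  ∑ i with G.d i ≠ 0, D.amp (G.v2 i) (G.v1 i) *
    Real.exp (-(kappa G D i * (max (|G.d i| * R - |G.m2 y i - G.c y i|) 0) ^ 2))

/-- The value of `dip` when all discrepancies vanish. -/
def dipBound (G : AffineForm n) (D : RobustDivergence) : ℝ :=
  ∑ i with G.d i ≠ 0, D.amp (G.v2 i) (G.v1 i)

namespace ConditionsC1C2

lemma dip_sum_bound (hC : ConditionsC1C2 F G) (δ : Fin n → ℝ) :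
    |∑ i with G.d i ≠ 0, D.amp (G.v2 i) (G.v1 i) * Real.exp (-(kappa G D i * δ i ^ 2))| ≤
      dipBound G D := by
  rw [abs_of_nonneg (Finset.sum_nonneg fun i _ =>
    mul_nonneg (amp_pos D hC.1 i).le (Real.exp_pos _).le)]
  refine Finset.sum_le_sum fun i _ => mul_le_of_le_one_right (amp_pos D hC.1 i).le ?_
  have := kappa_pos D hC.1 i
  exact Real.exp_le_one_iff.2 (by have := mul_nonneg this.le (sq_nonneg (δ i)); linarith)

lemma dip_le_envelope (hC : ConditionsC1C2 F G) (R : ℕ) (y : Fin n → ℝ) (a : ℝ)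
    (ha : (R : ℝ) ≤ |a|) : dip G D y a ≤ dipEnvelope G D R y := by
  refine Finset.sum_le_sum fun i _ => mul_le_mul_of_nonneg_left ?_ (amp_pos D hC.1 i).le
  refine Real.exp_le_exp.2 (neg_le_neg (mul_le_mul_of_nonneg_left ?_ (kappa_pos D hC.1 i).le))
  rw [← sq_abs (G.disc y i a), disc_eq_sub]
  refine pow_le_pow_left₀ (le_max_right _ _) (max_le ?_ (abs_nonneg _)) 2
  have h1 := abs_sub_abs_le_abs_sub (G.d i * a) (G.m2 y i - G.c y i)
  rw [abs_mul, abs_sub_comm (G.d i * a)] at h1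
  have h2 := mul_le_mul_of_nonneg_left ha (abs_nonneg (G.d i))
  linarith

lemma tendsto_dipEnvelope (hC : ConditionsC1C2 F G) (y : Fin n → ℝ) :
    Tendsto (fun R => dipEnvelope G D R y) atTop (𝓝 0) := by
  rw [show (0 : ℝ) = ∑ i with G.d i ≠ 0, D.amp (G.v2 i) (G.v1 i) * 0 by simp]
  refine tendsto_finsetSum _ fun i hi => Tendsto.const_mul _ ?_
  have hd : 0 < |G.d i| := abs_pos.2 (Finset.mem_filter.1 hi).2
  have h1 : Tendsto (fun R : ℕ => max (|G.d i| * R - |G.m2 y i - G.c y i|) 0) atTop atTop :=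
    tendsto_atTop_mono (fun R => le_max_left _ _) (tendsto_atTop_add_const_right _ _
      (tendsto_natCast_atTop_atTop.const_mul_atTop hd))
  refine Real.tendsto_exp_atBot.comp (tendsto_neg_atTop_atBot.comp ?_)
  exact (((tendsto_pow_atTop two_ne_zero).comp h1).const_mul_atTop (kappa_pos D hC.1 i))

lemma hasDerivAt_dip (hC : ConditionsC1C2 F G) (y : Fin n → ℝ) (a : ℝ) :
    HasDerivAt (dip G D y) (-score F D y a) a := by
  rw [show dip G D y = fun a => ceiling G D y - objective F D y a from
    funext fun b => by rw [hC.objective_eq]; ring]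
  exact (hC.hasDerivAt_objective y a).const_sub _

lemma abs_dip_sub_le (hC : ConditionsC1C2 F G) (y : Fin n → ℝ) (a b : ℝ) :
    |dip G D y a - dip G D y b| ≤ scoreBound G D * |a - b| :=
  Convex.norm_image_sub_le_of_norm_hasDerivWithin_le (s := Set.univ)
    (fun x _ => (hC.hasDerivAt_dip y x).hasDerivWithinAt)
    (fun x _ => by rw [norm_neg]; exact hC.abs_score_le y x) convex_univ
    (Set.mem_univ b) (Set.mem_univ a)

lemma measurable_dip (hm : ∀ i, Measurable fun y => G.m2 y i - G.c y i) (a : ℝ) :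
    Measurable fun y => dip G D y a := by
  simp only [dip, disc_eq_sub]
  exact Finset.measurable_fun_sum _ fun i _ =>
    (((((hm i).sub_const _).pow_const 2).const_mul _).neg.exp).const_mul _

lemma measurable_dipEnvelope (hm : ∀ i, Measurable fun y => G.m2 y i - G.c y i) (R : ℕ) :
    Measurable fun y => dipEnvelope G D R y := by
  refine Finset.measurable_fun_sum _ fun i _ =>
    ((((Measurable.pow_const ?_ 2).const_mul _).neg.exp).const_mul _)
  exact ((continuous_abs.measurable.comp (hm i)).const_sub _).max measurable_const

/-- The bounded function `ceiling` contributes a constant to the population criterion. -/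
lemma exists_abs_ceiling_le (hC : ConditionsC1C2 F G) :
    ∃ c, ∀ y, |ceiling G D y| ≤ c := by
  refine ⟨∑ i with G.d i ≠ 0, |D.base (G.v2 i) (G.v1 i)| + ∑ i with ¬ G.d i ≠ 0,
    (|D.base (G.v2 i) (G.v1 i)| + D.amp (G.v2 i) (G.v1 i)), fun y => (abs_add_le _ _).trans
    (add_le_add (Finset.abs_sum_le_sum_abs _ _) ((Finset.abs_sum_le_sum_abs _ _).trans
      (Finset.sum_le_sum fun i _ => (abs_sub _ _).trans (add_le_add_right ?_ _))))⟩
  rw [abs_mul, abs_of_pos (amp_pos D hC.1 i), Real.abs_exp]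
  refine mul_le_of_le_one_right (amp_pos D hC.1 i).le (Real.exp_le_one_iff.2 ?_)
  have := mul_nonneg (kappa_pos D hC.1 i).le (sq_nonneg (G.m2 y i - G.c y i))
  linarith

lemma measurable_ceiling (hm : ∀ i, Measurable fun y => G.m2 y i - G.c y i) :
    Measurable fun y => ceiling G D y :=
  (Finset.measurable_fun_sum _ fun i _ => continuous_well.measurable.comp (hm i)).const_add _

theorem asymptoticNormality (hC : ConditionsC1C2 F G)
    (hm : ∀ i, Measurable fun y => G.m2 y i - G.c y i) : AsymptoticNormality.{w} F D := by
  intro Ω _ P _ μ _ Y hY hind hlaw a₀ h0 hA0 ΨN JN V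
  obtain ⟨C, L, -, hL, hreg⟩ := hC.exists_regularScore (D := D) hm
  simp_rw [hC.deriv_score] at hA0
  set A := ∫ y, curvature G D y a₀ ∂μ with hA
  have hA' : 0 < |A| := abs_pos.2 hA0
  obtain ⟨δ, hδ, hδL⟩ : ∃ δ : ℝ, 0 < δ ∧ L * δ < |A| / 2 := by
    refine ⟨|A| / (4 * (L + 1)), by positivity, ?_⟩
    rw [mul_div_assoc', div_lt_div_iff₀ (by positivity) two_pos]
    nlinarith [mul_nonneg hL hA'.le]
  have hnormal : ∀ T : ℕ → Ω → ℝ, (∀ N, AEMeasurable (T N) P) →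
      (Whp P fun N ω => T N ω ∈ Set.Icc (a₀ - δ) (a₀ + δ) ∧ ΨN N ω (T N ω) = 0) →
      RootNNormal P T a₀ V := fun T hT hroot =>
    hreg.rootNNormal hL hY hind hlaw h0 hA.symm hA0 hδL hT hroot
  refine ⟨⟨δ, hδ, hreg.whp_existsUnique_root hL hY hind hlaw h0 hA.symm hA0 hδ hδL, hnormal⟩,
    fun 𝒜 h𝒜 hint𝒜 hmin T hT hTmin => hnormal T hT ?_⟩
  have hd : ∃ i, G.d i ≠ 0 := by
    by_contra! hd
    exact hA0 (by simp [hA, curvature, hd])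
  have hdint : ∀ a, Integrable (fun y => dip G D y a) μ := fun a =>
    .of_bound (measurable_dip hm a).aestronglyMeasurable (dipBound G D)
      (.of_forall fun y => hC.dip_sum_bound _)
  obtain ⟨c, hc⟩ := hC.exists_abs_ceiling_le (D := D)
  have hcint : Integrable (fun y => ceiling G D y) μ :=
    .of_bound (measurable_ceiling hm).aestronglyMeasurable c (.of_forall hc)
  have hJint : ∀ a, ∫ y, objective F D y a ∂μ =
      ∫ y, ceiling G D y ∂μ - ∫ y, dip G D y a ∂μ := fun a => by
    simp_rw [hC.objective_eq]
    exact integral_sub hcint (hdint a)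
  have hJemp : ∀ N ω a, JN N ω a = emp Y (fun y => ceiling G D y) N ω -
      emp Y (fun y => dip G D y a) N ω := fun N ω a => by
    rw [← emp_sub]
    simp_rw [← hC.objective_eq]
    rfl
  -- a closed neighbourhood on which minimisers are interior
  obtain ⟨r, hr, hball⟩ := Metric.isOpen_iff.1 isOpen_interior a₀ hint𝒜
  refine (whp_near_of_maximiser (γ := dip G D) (env := dipEnvelope G D) (B := dipBound G D)
    hY hind hlaw (measurable_dip hm) (fun y a => hC.dip_sum_bound _) (fun y => hC.dip_pos hd y a₀)
    hC.abs_dip_sub_le (measurable_dipEnvelope hm) (fun R y => hC.dip_sum_bound _)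
    hC.dip_le_envelope hC.tendsto_dipEnvelope h𝒜 (fun a ha hne => ?_)
    (T := T) (fun N ω => ⟨(hTmin N ω).1, ?_⟩) (lt_min hr hδ)).mono fun N ω hω => ⟨?_, ?_⟩
  · have := hmin a ha hne
    rw [hJint, hJint] at this
    linarith
  · have : JN N ω (T N ω) ≤ JN N ω a₀ := (hTmin N ω).2 (interior_subset hint𝒜)
    rw [hJemp, hJemp] at this
    linarith
  · have := (lt_min_iff.1 hω).2
    rw [abs_lt] at this
    constructor <;> linarith
  · have hnhds : 𝒜 ∈ 𝓝 (T N ω) := mem_interior_iff_mem_nhds.1 (hball (by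
      rw [Metric.mem_ball, Real.dist_eq]
      exact (lt_min_iff.1 hω).1))
    exact ((hTmin N ω).2.isLocalMin hnhds).hasDerivAt_eq_zero
      (hasDerivAt_emp Y hC.hasDerivAt_objective N ω _)

end ConditionsC1C2

end CriterionAsymptotics

/-! ### Contaminated laws -/

section Contamination

variable {S : Type} [MeasurableSpace S] {μ H : Measure S} {ε : ℝ}

lemma contaminated_apply_integral {f : S → ℝ} (hε : ε ∈ Set.Icc (0 : ℝ) 1) (hμ : Integrable f μ)
    (hH : Integrable f H) :
    ∫ y, f y ∂(contaminated ε μ H) = (1 - ε) * ∫ y, f y ∂μ + ε * ∫ y, f y ∂H := by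
  rw [contaminated, integral_add_measure (hμ.smul_measure ENNReal.ofReal_ne_top)
    (hH.smul_measure ENNReal.ofReal_ne_top), integral_smul_measure, integral_smul_measure,
    ENNReal.toReal_ofReal (by linarith [hε.2]), ENNReal.toReal_ofReal hε.1, smul_eq_mul,
    smul_eq_mul]

lemma integrable_contaminated {f : S → ℝ} (hμ : Integrable f μ) (hH : Integrable f H) :
    Integrable f (contaminated ε μ H) :=
  (hμ.smul_measure ENNReal.ofReal_ne_top).add_measure (hH.smul_measure ENNReal.ofReal_ne_top)

lemma isProbabilityMeasure_contaminated [IsProbabilityMeasure μ] [IsProbabilityMeasure H]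
    (hε : ε ∈ Set.Icc (0 : ℝ) 1) : IsProbabilityMeasure (contaminated ε μ H) := by
  constructor
  simp only [contaminated, Measure.add_apply, Measure.smul_apply, measure_univ, smul_eq_mul,
    mul_one]
  rw [← ENNReal.ofReal_add (by linarith [hε.2]) hε.1]
  simp

lemma evariance_of_integral_eq_zero {ν : Measure S} {X : S → ℝ} (h : ∫ y, X y ∂ν = 0) :
    evariance X ν = ∫⁻ y, ENNReal.ofReal (X y ^ 2) ∂ν := by
  simp only [evariance, h, sub_zero]
  refine lintegral_congr fun y => ?_
  rw [Real.enorm_eq_ofReal_abs, ← ENNReal.ofReal_pow (abs_nonneg _), sq_abs]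

/-- A bounded score whose sensitivity is bounded below has bounded asymptotic variance. -/
lemma asympVar_le {ψ : S → ℝ → ℝ} {ν : Measure S} [IsProbabilityMeasure ν] {a M Alow : ℝ}
    (hM : ∀ y, |ψ y a| ≤ M) (h0 : popScore ψ ν a = 0) (hlow : 0 < Alow)
    (hA : Alow ≤ |sensitivity ψ ν a|) :
    asympVar ψ ν a ≤ ENNReal.ofReal (M ^ 2 / Alow ^ 2) := by
  rw [asympVar, evariance_of_integral_eq_zero h0, ENNReal.ofReal_div_of_pos (by positivity)]
  refine ENNReal.div_le_div ?_ (ENNReal.ofReal_le_ofReal ?_)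
  · calc ∫⁻ y, ENNReal.ofReal (ψ y a ^ 2) ∂ν ≤ ∫⁻ _, ENNReal.ofReal (M ^ 2) ∂ν := by
          refine lintegral_mono fun y => ENNReal.ofReal_le_ofReal ?_
          rw [← sq_abs]
          exact pow_le_pow_left₀ (abs_nonneg _) (hM y) 2
      _ = ENNReal.ofReal (M ^ 2) := by simp
  · rw [← sq_abs (sensitivity ψ ν a)]
    exact pow_le_pow_left₀ hlow.le hA 2

/-- The contaminating part alone makes the second moment, hence the variance, explode. -/
lemma tendsto_asympVar_top {ψ : S → ℝ → ℝ} {H : ℝ → Measure S} (hε : 0 < ε) {θ : ℝ → ℝ} {C : ℝ}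
    (h0 : ∀ τ > 0, popScore ψ (contaminated ε μ (H τ)) (θ τ) = 0)
    (hC : ∀ᶠ τ in atTop, |sensitivity ψ (contaminated ε μ (H τ)) (θ τ)| ≤ C)
    (htop : Tendsto (fun τ => ∫⁻ y, ENNReal.ofReal (ψ y (θ τ) ^ 2) ∂(H τ)) atTop (𝓝 ⊤)) :
    Tendsto (fun τ => asympVar ψ (contaminated ε μ (H τ)) (θ τ)) atTop (𝓝 ⊤) := by
  set k : ℝ≥0∞ := ENNReal.ofReal ε / ENNReal.ofReal (C ^ 2 + 1)
  have hk : k ≠ 0 := ENNReal.div_ne_zero.2 ⟨by simpa using hε, ENNReal.ofReal_ne_top⟩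
  have hlim := ENNReal.Tendsto.const_mul (a := k) htop (Or.inl ENNReal.top_ne_zero)
  rw [ENNReal.mul_top hk] at hlim
  refine tendsto_of_tendsto_of_tendsto_of_le_of_le' hlim tendsto_const_nhds ?_
    (.of_forall fun _ => le_top)
  filter_upwards [hC, eventually_gt_atTop 0] with τ hτ hpos
  rw [asympVar, evariance_of_integral_eq_zero (h0 τ hpos), mul_comm, mul_div_assoc', mul_comm]
  refine ENNReal.div_le_div ?_ (ENNReal.ofReal_le_ofReal ?_)
  · rw [contaminated, lintegral_add_measure, lintegral_smul_measure, lintegral_smul_measure]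
    exact le_add_self
  · rw [← sq_abs]
    linarith [pow_le_pow_left₀ (abs_nonneg _) hτ 2]

end Contamination

/-! ### Variance dominance -/

section Variance

variable {n : ℕ} {F : PredictiveFamilies n} {G : AffineForm n} {D : RobustDivergence}

theorem ConditionsC1C2.varianceDominance (hC : ConditionsC1C2 F G)
    (hm : ∀ i, Measurable fun y => G.m2 y i - G.c y i) : VarianceDominance F G D := by
  intro μ _ H _ ε hε hε1 aS hroot A VS M
  obtain ⟨C, L, -, -, hreg⟩ := hC.exists_regularScore (D := D) hm
  have hprob : ∀ τ, IsProbabilityMeasure (contaminated ε μ (H τ)) := fun τ =>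
    isProbabilityMeasure_contaminated ⟨hε.le, hε1.le⟩
  have hVS : ∀ τ > 0, ∀ Alow > 0, Alow ≤ |A τ| → VS τ ≤ ENNReal.ofReal (M ^ 2 / Alow ^ 2) :=
    fun τ hτ Alow hlow hA =>
      asympVar_le (fun y => hC.abs_score_le y _) (hroot τ hτ) hlow hA
  refine ⟨fun T 𝒦 hT h𝒦 hmem hcont hpos => ?_, fun T Alow _ hlow hA =>
    iSup₂_le fun τ hτ => hVS τ hτ.1 Alow hlow (hA τ hτ), fun ψ₀ θ _ hψ₀ hbd htop => ?_⟩
  · have hcomp : IsCompact (𝒦 ×ˢ Set.Icc 0 T) := h𝒦.prod isCompact_Icc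
    have hne : (𝒦 ×ˢ Set.Icc 0 T).Nonempty :=
      ⟨(aS T, T), hmem T ⟨hT, le_rfl⟩, hT.le, le_rfl⟩
    have hpos' : ∀ q ∈ 𝒦 ×ˢ Set.Icc 0 T,
        0 < sensitivity (score F D) (contaminated ε μ (H q.2)) q.1 := fun q hq => by
      rw [hreg.sensitivity_eq]
      exact hpos q.1 hq.1 q.2 hq.2
    obtain ⟨q₁, hq₁, hmin⟩ := hcomp.exists_isMinOn hne hcont
    obtain ⟨q₂, hq₂, hmax⟩ := hcomp.exists_isMaxOn hne hcont
    refine ⟨_, _, hpos' q₁ hq₁, hmin hq₂, fun τ hτ => ?_⟩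
    have hq : (aS τ, τ) ∈ 𝒦 ×ˢ Set.Icc 0 T := ⟨hmem τ hτ, hτ.1.le, hτ.2⟩
    have hA : |A τ| = A τ := abs_of_pos (hpos' _ hq)
    have hlow := (hmin hq).trans_eq hA.symm
    exact ⟨hlow, hA.trans_le (hmax hq), hVS τ hτ.1 _ (hpos' q₁ hq₁) hlow⟩
  · obtain ⟨K, hK⟩ := hbd
    have hinf := tendsto_asympVar_top hε (fun τ hτ => (hψ₀ τ hτ).2.1) hK htop
    refine ⟨hinf, fun ⟨Alow, hlow, hA⟩ => ?_⟩
    obtain ⟨τ₀, hτ₀⟩ := eventually_atTop.1 ((hinf.eventually (lt_mem_nhds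
      (ENNReal.ofReal_lt_top (r := M ^ 2 / Alow ^ 2)))).and (hA.and (eventually_gt_atTop 0)))
    refine ⟨max τ₀ 1, by positivity, fun τ hτ => ?_⟩
    obtain ⟨h1, h2, h3⟩ := hτ₀ τ ((le_max_left _ _).trans hτ)
    exact (hVS τ h3 Alow hlow h2).trans_lt h1

end Variance

/-! ### First-order comparison under contamination -/

section Elpd

open Asymptotics

lemma tendsto_zero_nhdsWithin : Tendsto (fun ε : ℝ => ε) (𝓝[>] 0) (𝓝 0) :=
  tendsto_id.mono_left nhdsWithin_le_nhds

lemma eventually_mem_Ioo : ∀ᶠ ε : ℝ in 𝓝[>] 0, ε ∈ Set.Ioo (0 : ℝ) 1 :=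
  Ioo_mem_nhdsGT one_pos

/-- First-order expansion of a root of `(1 - ε) f + ε g` as `ε → 0+`. -/
lemma root_expansion {f g : ℝ → ℝ} {a A M : ℝ} {aS : ℝ → ℝ} (hf : HasDerivAt f A a)
    (hg : ContinuousAt g a) (hfb : ∀ x, |f x| ≤ M) (hgb : ∀ x, |g x| ≤ M) (h0 : f a = 0)
    (hA : A ≠ 0) (haS : Tendsto aS (𝓝[>] 0) (𝓝 a))
    (hroot : ∀ᶠ ε in 𝓝[>] (0 : ℝ), (1 - ε) * f (aS ε) + ε * g (aS ε) = 0) :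
    (fun ε => aS ε - a - ε * (-A⁻¹ * g a)) =o[𝓝[>] 0] (fun ε : ℝ => ε) := by
  have hA' : 0 < |A| := abs_pos.2 hA
  have hlin : (fun ε => f (aS ε) - (aS ε - a) * A) =o[𝓝[>] 0] fun ε => aS ε - a := by
    have h := (hasDerivAt_iff_isLittleO.1 hf).comp_tendsto haS
    refine h.congr (fun ε => ?_) fun ε => rfl
    simp [h0]
  -- the displacement of the root is of order `ε`
  have hO : (fun ε => aS ε - a) =O[𝓝[>] 0] fun ε : ℝ => ε := by
    refine IsBigO.of_bound (2 * (2 * M) / |A|) ?_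
    filter_upwards [hlin.bound (half_pos hA'), hroot, eventually_mem_Ioo] with ε h1 h2 h3
    rw [Real.norm_eq_abs, Real.norm_eq_abs] at h1 ⊢
    have h4 : |f (aS ε)| ≤ ε * (2 * M) := by
      rw [show f (aS ε) = ε * (f (aS ε) - g (aS ε)) by linarith, abs_mul, abs_of_pos h3.1]
      refine mul_le_mul_of_nonneg_left ((abs_sub _ _).trans ?_) h3.1.le
      linarith [hfb (aS ε), hgb (aS ε)]
    have h5 : |(aS ε - a) * A| ≤ |f (aS ε) - (aS ε - a) * A| + |f (aS ε)| := by
      rw [abs_sub_comm]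
      refine le_trans (le_of_eq ?_) (abs_add_le _ _)
      congr 1
      ring
    rw [abs_mul] at h5
    rw [abs_of_pos h3.1, div_mul_eq_mul_div, le_div_iff₀ hA']
    linarith
  have h1 := hlin.trans_isBigO hO
  have h2 : (fun ε => f (aS ε) + ε * g a) =o[𝓝[>] 0] fun ε : ℝ => ε := by
    have hlim : Tendsto (fun ε => f (aS ε) - g (aS ε) + g a) (𝓝[>] 0) (𝓝 0) := by
      have := ((hf.continuousAt.tendsto.comp haS).sub (hg.tendsto.comp haS)).add_const (g a)
      simpa [h0] using this
    refine ((isBigO_refl (fun ε : ℝ => ε) (𝓝[>] 0)).mul_isLittleO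
      ((isLittleO_one_iff ℝ).2 hlim)).congr' ?_ (.of_forall fun ε => mul_one ε)
    filter_upwards [hroot] with ε hε
    linarith
  refine ((h2.sub h1).const_mul_left A⁻¹).congr_left fun ε => ?_
  field_simp
  ring

lemma sq_expansion (w₀ w₁ : ℝ) {r : ℝ → ℝ} (hr : r =o[𝓝[>] 0] fun ε : ℝ => ε) :
    (fun ε => (w₀ + ε * w₁ - r ε) ^ 2 - (w₀ ^ 2 + 2 * ε * (w₀ * w₁))) =o[𝓝[>] 0]
      fun ε : ℝ => ε := by
  have hε := tendsto_zero_nhdsWithin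
  have hr0 : Tendsto r (𝓝[>] 0) (𝓝 0) := hr.isBigO.trans_tendsto hε
  have h1 : (fun ε => r ε * (r ε - 2 * w₀ - 2 * ε * w₁)) =o[𝓝[>] 0] fun ε : ℝ => ε := by
    have := hr.mul_isBigO ((((hr0.sub_const (2 * w₀)).sub
      ((hε.const_mul 2).mul_const w₁))).isBigO_one ℝ)
    simpa using this
  have h2 : (fun ε : ℝ => ε * (ε * w₁ ^ 2)) =o[𝓝[>] 0] fun ε : ℝ => ε := by
    have hlim : Tendsto (fun ε : ℝ => ε * w₁ ^ 2) (𝓝[>] 0) (𝓝 0) := by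
      simpa using hε.mul_const (w₁ ^ 2)
    simpa using (isBigO_refl (fun ε : ℝ => ε) (𝓝[>] 0)).mul_isLittleO
      ((isLittleO_one_iff ℝ).2 hlim)
  exact (h1.add h2).congr_left fun ε => by ring

/-- Comparison of two predictions with first-order expansions under a score that is quadratic to
first order. -/
lemma quadratic_gain {s : ℝ → ℝ → ℝ} {lam m₀ m₁ a b B B' : ℝ} {aS aP : ℝ → ℝ}
    (hS : (fun ε => aS ε - a - ε * B) =o[𝓝[>] 0] fun ε : ℝ => ε)
    (hP : (fun ε => aP ε - b - ε * B') =o[𝓝[>] 0] fun ε : ℝ => ε)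
    (hs : ∃ k : ℝ → ℝ, ∀ R : ℝ, ∃ ρ : ℝ → ℝ, ρ =o[𝓝[>] 0] (fun ε : ℝ => ε) ∧
      ∀ᶠ ε in 𝓝[>] (0 : ℝ), ∀ a, |a| ≤ R →
        |s a ε - (-lam * (m₀ + ε * m₁ - a) ^ 2 + k ε)| ≤ ρ ε) :
    (fun ε => s (aS ε) ε - s (aP ε) ε - (lam * ((m₀ - b) ^ 2 - (m₀ - a) ^ 2) +
      2 * lam * ε * ((m₀ - b) * (m₁ - B') - (m₀ - a) * (m₁ - B)))) =o[𝓝[>] 0]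
      fun ε : ℝ => ε := by
  obtain ⟨k, hk⟩ := hs
  have hlim : ∀ {x B : ℝ} {t : ℝ → ℝ}, (fun ε => t ε - x - ε * B) =o[𝓝[>] 0] (fun ε : ℝ => ε) →
      Tendsto t (𝓝[>] 0) (𝓝 x) := fun {x B t} ht => by
    have h := ((ht.isBigO.trans_tendsto tendsto_zero_nhdsWithin).add_const x).add
      (tendsto_zero_nhdsWithin.mul_const B)
    simp only [zero_add, zero_mul, add_zero] at h
    exact h.congr fun ε => by ring
  obtain ⟨ρ, hρ, hbd⟩ := hk (max (|a| + 1) (|b| + 1))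
  have hsmall : ∀ {x B : ℝ} {t : ℝ → ℝ},
      (fun ε => t ε - x - ε * B) =o[𝓝[>] 0] (fun ε : ℝ => ε) →
      |x| + 1 ≤ max (|a| + 1) (|b| + 1) →
      (fun ε => s (t ε) ε - (-lam * (m₀ + ε * m₁ - t ε) ^ 2 + k ε)) =o[𝓝[>] 0]
        (fun ε : ℝ => ε) := fun {x B t} ht hx => by
    refine IsBigO.trans_isLittleO (IsBigO.of_bound 1 ?_) hρ
    filter_upwards [hbd, (hlim ht).abs.eventually (ge_mem_nhds (lt_add_one |x|))] with ε h1 h2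
    rw [one_mul, Real.norm_eq_abs]
    exact (h1 _ (h2.trans hx)).trans (le_abs_self _)
  have e1 := hsmall hS (le_max_left _ _)
  have e2 := hsmall hP (le_max_right _ _)
  have e3 := (sq_expansion (m₀ - a) (m₁ - B) hS).const_mul_left lam
  have e4 := (sq_expansion (m₀ - b) (m₁ - B') hP).const_mul_left lam
  refine ((e1.sub e2).add (e4.sub e3)).congr_left fun ε => ?_
  ring

lemma log_gaussianPDFReal {s2 : ℝ≥0} (hs : 0 < s2) (a t : ℝ) :
    Real.log (gaussianPDFReal a s2 t) =
      -(t - a) ^ 2 / (2 * s2) - Real.log (2 * Real.pi * s2) / 2 := by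
  have h : (0 : ℝ) < s2 := hs
  have h2 : 0 < 2 * Real.pi * s2 := by positivity
  rw [gaussianPDFReal, Real.log_mul (inv_ne_zero (Real.sqrt_pos.2 h2).ne') (Real.exp_pos _).ne',
    Real.log_exp, Real.log_inv, Real.log_sqrt h2.le]
  ring

/-- The expected log density of a Gaussian prediction is exactly quadratic in the prediction. -/
lemma elpd_eq {s2 : ℝ≥0} (hs : 0 < s2) (a : ℝ) {ν : Measure ℝ} [IsProbabilityMeasure ν]
    (hν : MemLp id 2 ν) :
    elpd s2 a ν = -(∫ t, t ∂ν - a) ^ 2 / (2 * s2) +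
      (-Var[id; ν] / (2 * s2) - Real.log (2 * Real.pi * s2) / 2) := by
  have i1 : Integrable (fun t : ℝ => t) ν := hν.integrable one_le_two
  have i2 : Integrable (fun t : ℝ => t ^ 2) ν := hν.integrable_sq
  have hvar : Var[id; ν] = ∫ t, t ^ 2 ∂ν - (∫ t, t ∂ν) ^ 2 := by
    rw [variance_eq_sub hν]; rfl
  have hint : ∫ t, (t - a) ^ 2 ∂ν = ∫ t, t ^ 2 ∂ν - 2 * a * ∫ t, t ∂ν + a ^ 2 := by
    have e : ∀ t : ℝ, (t - a) ^ 2 = t ^ 2 - 2 * a * t + a ^ 2 := fun t => by ring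
    simp_rw [e]
    rw [integral_add (f := fun t => t ^ 2 - 2 * a * t) (i2.sub (i1.const_mul _))
      (integrable_const _), integral_sub i2 (i1.const_mul _), integral_const_mul]
    simp
  have i3 : Integrable (fun t : ℝ => (t - a) ^ 2) ν :=
    (hν.sub (memLp_const a)).integrable_sq
  have h : (0 : ℝ) < s2 := hs
  simp only [elpd, log_gaussianPDFReal hs]
  rw [integral_sub (by simpa using (i3.neg.div_const _)) (integrable_const _), integral_div,
    integral_neg, hint, hvar]
  simp
  field_simp
  ring

variable {n : ℕ} {F : PredictiveFamilies n} {G : AffineForm n} {D : RobustDivergence}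

theorem ConditionsC1C2.elpdComparison (hC : ConditionsC1C2 F G)
    (hm : ∀ i, Measurable fun y => G.m2 y i - G.c y i) : ElpdComparison F G D := by
  intro μ H _ _ aStar aS h0 hA haS hroot BS
  obtain ⟨C, L, -, -, hreg⟩ := hC.exists_regularScore (D := D) hm
  set A := sensitivity (score F D) μ aStar with hAdef
  have hBS : BS = -A⁻¹ * popScore (score F D) H aStar := integral_const_mul _ _
  have hS : (fun ε => aS ε - aStar - ε * BS) =o[𝓝[>] 0] (fun ε : ℝ => ε) := by
    rw [hBS]
    refine root_expansion (f := popScore (score F D) μ) (M := scoreBound G D) ?_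
      (hreg.hasDerivAt_popScore H aStar).continuousAt (hreg.abs_popScore_le μ)
      (hreg.abs_popScore_le H) h0 hA haS ?_
    · rw [hAdef, hreg.sensitivity_eq]
      exact hreg.hasDerivAt_popScore μ aStar
    · filter_upwards [hroot, eventually_mem_Ioo] with ε h1 h2
      rw [popScore, contaminated_apply_integral ⟨h2.1.le, h2.2.le⟩ (hreg.integrable μ _)
        (hreg.integrable H _)] at h1
      exact h1
  refine ⟨?_, hS, fun IF₀ aPlug aP hIF₀ => ⟨fun hunb R => ?_, ?_⟩⟩
  · rw [hBS, neg_mul, abs_neg, abs_mul, abs_inv, inv_mul_eq_div]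
    exact div_le_div_of_nonneg_right (hreg.abs_popScore_le H aStar) (abs_nonneg _)
  · -- a point mass where the influence function is large
    simp only [BddAbove, upperBounds, Set.Nonempty, Set.mem_range, Set.mem_ofPred_eq, not_exists,
      not_forall, not_le] at hunb
    obtain ⟨_, ⟨z, rfl⟩, hz⟩ := hunb R
    exact ⟨Measure.dirac z, inferInstance, integrable_dirac (by simp), by simpa using hz⟩
  · intro _ B₀ hP ν νH _ _ hν hνH m₀ mH gain
    have hmean : ∀ ε ∈ Set.Icc (0 : ℝ) 1,
        ∫ t, t ∂(contaminated ε ν νH) = m₀ + ε * (mH - m₀) := fun ε hε => by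
      refine (contaminated_apply_integral (f := id) hε hν hνH).trans ?_
      simp only [id, m₀, mH]
      ring
    refine ⟨hmean, fun S lam _ hs => quadratic_gain (s := fun a ε => S a (contaminated ε ν νH))
      hS hP hs, fun hν2 hνH2 s2 hs2 => ?_⟩
    have hexact : ∀ ε ∈ Set.Icc (0 : ℝ) 1, ∀ a, elpd s2 a (contaminated ε ν νH) =
        -(m₀ + ε * (mH - m₀) - a) ^ 2 / (2 * s2)
          + (-Var[id; contaminated ε ν νH] / (2 * s2)
            - Real.log (2 * Real.pi * s2) / 2) := fun ε hε a => by
      have := isProbabilityMeasure_contaminated (μ := ν) (H := νH) hε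
      have hid : AEStronglyMeasurable (id : ℝ → ℝ) (contaminated ε ν νH) :=
        measurable_id.aestronglyMeasurable
      rw [elpd_eq hs2 a ((memLp_two_iff_integrable_sq hid).2
        (integrable_contaminated hν2.integrable_sq hνH2.integrable_sq)), hmean ε hε]
    refine ⟨hexact, quadratic_gain (s := fun a ε => elpd s2 a (contaminated ε ν νH)) hS hP
      ⟨fun ε => -Var[id; contaminated ε ν νH] / (2 * s2) - Real.log (2 * Real.pi * s2) / 2,
        fun R => ⟨fun _ => 0, isLittleO_zero _ _, ?_⟩⟩⟩
    filter_upwards [eventually_mem_Ioo] with ε hε a _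
    rw [hexact ε ⟨hε.1.le, hε.2.le⟩ a, abs_nonpos_iff]
    ring

/-- The proofs use nothing about the two models beyond the affine Gaussian structure and
measurability of the discrepancies. -/
theorem ConditionsC1C2.inheritedResults (hC : ConditionsC1C2 F G)
    (hm : ∀ i, Measurable fun y => G.m2 y i - G.c y i) : InheritedResults.{w} F G :=
  fun _ => ⟨hC.boundedInfluence hm, hC.localConvexity hm, hC.asymptoticNormality hm,
    hC.varianceDominance hm, hC.elpdComparison hm, hC.scalarScoreEquation⟩

end Elpd

/-! ### Composition of straight-line programs -/

section ProgramCalculus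

variable {In : Type} {Θ : Type*}

lemma run_append (inp : In → ℝ) (p q : List (Instr In)) (mem : List ℝ) :
    run inp (p ++ q) mem = (run inp p mem).bind (run inp q) := by
  induction p generalizing mem with
  | nil => rfl
  | cons I p ih => simp only [List.cons_append, run, ih, Option.bind_assoc]

lemma run_prefix {inp : In → ℝ} {p : List (Instr In)} {mem mem' : List ℝ}
    (h : run inp p mem = some mem') :
    mem <+: mem' ∧ mem'.length = mem.length + p.length := by
  induction p generalizing mem with
  | nil =>
    cases h
    simp
  | cons I p ih =>
    simp only [run, Option.bind_eq_some_iff] at h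
    obtain ⟨s, -, t, -, r, -, h⟩ := h
    obtain ⟨h1, h2⟩ := ih h
    refine ⟨(List.prefix_append _ _).trans h1, ?_⟩
    rw [h2]
    simp
    omega

lemma Operand.eval_mono {inp : In → ℝ} {mem mem' : List ℝ} (h : mem <+: mem') {o : Operand In}
    {r : ℝ} (ho : o.eval inp mem = some r) : o.eval inp mem' = some r := by
  cases o with
  | input v => exact ho
  | const r => exact ho
  | reg k =>
    simp only [Operand.eval] at ho ⊢
    obtain ⟨hk, -⟩ := List.getElem?_eq_some_iff.1 ho
    obtain ⟨t, rfl⟩ := h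
    rw [List.getElem?_append_left hk, ho]

variable (inp : Θ → In → ℝ)

/-- The program runs without error on all inputs of the family `inp`. -/
def Valid (p : List (Instr In)) : Prop := ∀ θ, ∃ mem, run (inp θ) p [] = some mem

/-- After running `p`, one operand holds `f θ` on every input `inp θ`. -/
def Holds (p : List (Instr In)) (f : Θ → ℝ) : Prop :=
  ∃ o : Operand In, ∀ θ mem, run (inp θ) p [] = some mem → o.eval (inp θ) mem = some (f θ)

/-- Any program holding all functions in `S` can be extended by at most `c` instructions so as to
hold all functions in `T`. -/
def Derives (c : ℕ) (S T : Set (Θ → ℝ)) : Prop :=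
  ∀ p, Valid inp p → (∀ f ∈ S, Holds inp p f) →
    ∃ q, Valid inp (p ++ q) ∧ q.length ≤ c ∧ ∀ f ∈ T, Holds inp (p ++ q) f

/-- `Derives` for a single function. -/
abbrev Der (c : ℕ) (S : Set (Θ → ℝ)) (f : Θ → ℝ) : Prop := Derives inp c S {f}

variable {inp}

lemma Holds.append {p q : List (Instr In)} {f : Θ → ℝ} (h : Holds inp p f) :
    Holds inp (p ++ q) f := by
  obtain ⟨o, ho⟩ := h
  refine ⟨o, fun θ mem hmem => ?_⟩
  rw [run_append, Option.bind_eq_some_iff] at hmem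
  obtain ⟨mem₀, h0, h1⟩ := hmem
  exact Operand.eval_mono (run_prefix h1).1 (ho θ mem₀ h0)

variable {c c' : ℕ} {S S' T U : Set (Θ → ℝ)} {f g : Θ → ℝ}

lemma Derives.mono (h : Derives inp c S T) (hc : c ≤ c') : Derives inp c' S T :=
  fun p hp hS => (h p hp hS).imp fun _ hq => ⟨hq.1, hq.2.1.trans hc, hq.2.2⟩

lemma Derives.weaken (h : Derives inp c S T) (hS : S ⊆ S') : Derives inp c S' T :=
  fun p hp hS' => h p hp fun f hf => hS' f (hS hf)

lemma Derives.cut (h : Derives inp c S T) (h' : Derives inp c' (S ∪ T) U) :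
    Derives inp (c + c') S U := by
  intro p hp hS
  obtain ⟨q, hq, hqc, hqT⟩ := h p hp hS
  obtain ⟨q', hq', hqc', hqU⟩ := h' (p ++ q) hq
    fun f hf => hf.elim (fun hf => (hS f hf).append) (hqT f)
  refine ⟨q ++ q', ?_, ?_, ?_⟩
  · rwa [← List.append_assoc]
  · rw [List.length_append]
    omega
  · rwa [← List.append_assoc]

lemma Derives.union (h : Derives inp c S T) (h' : Derives inp c' S U) :
    Derives inp (c + c') S (T ∪ U) := by
  intro p hp hS
  obtain ⟨q, hq, hqc, hqT⟩ := h p hp hS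
  obtain ⟨q', hq', hqc', hqU⟩ := h' (p ++ q) hq fun f hf => (hS f hf).append
  refine ⟨q ++ q', ?_, ?_, ?_⟩
  · rwa [← List.append_assoc]
  · rw [List.length_append]
    omega
  · rw [← List.append_assoc]
    exact fun f hf => hf.elim (fun hf => (hqT f hf).append) (hqU f)

lemma derives_empty : Derives inp 0 S ∅ :=
  fun p hp _ => ⟨[], by rwa [List.append_nil], le_rfl, fun _ hf => hf.elim⟩

lemma derives_iUnion {m : ℕ} {T : Fin m → Set (Θ → ℝ)} (h : ∀ i, Derives inp c S (T i)) :
    Derives inp (m * c) S (⋃ i, T i) := by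
  induction m with
  | zero => simpa using derives_empty
  | succ m ih =>
    have h1 := (ih fun i => h i.castSucc).union (h (Fin.last m))
    rw [← Nat.succ_mul] at h1
    intro p hp hS
    obtain ⟨q, hq, hqc, hqT⟩ := h1 p hp hS
    refine ⟨q, hq, hqc, fun f hf => hqT f ?_⟩
    obtain ⟨i, hi⟩ := Set.mem_iUnion.1 hf
    refine Fin.lastCases (fun hi => Or.inr hi) (fun j hi => Or.inl ?_) i hi
    exact Set.mem_iUnion.2 ⟨j, hi⟩

lemma derives_range {m : ℕ} {f : Fin m → Θ → ℝ} (h : ∀ i, Der inp c S (f i)) :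
    Derives inp (m * c) S (Set.range f) := by
  have := derives_iUnion h
  rwa [Set.iUnion_singleton_eq_range] at this

lemma Derives.congr (h : Der inp c S f) (hfg : ∀ θ, f θ = g θ) : Der inp c S g := by
  rwa [← funext hfg]

lemma der_of_mem (hf : f ∈ S) : Der inp 0 S f :=
  fun p hp hS => ⟨[], by rwa [List.append_nil], le_rfl, fun g hg => by
    rw [List.append_nil, Set.mem_singleton_iff.1 hg]
    exact hS f hf⟩

lemma der_of_operand (o : Operand In) (ho : ∀ θ mem, o.eval (inp θ) mem = some (f θ)) :
    Der inp 0 S f :=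
  fun p hp _ => ⟨[], by rwa [List.append_nil], le_rfl, fun g hg => by
    rw [Set.mem_singleton_iff.1 hg]
    exact ⟨o, fun θ mem _ => ho θ mem⟩⟩

lemma der_input (v : In) : Der inp 0 S fun θ => inp θ v :=
  der_of_operand (.input v) fun _ _ => rfl

lemma der_const (r : ℚ) : Der inp 0 S fun _ => (r : ℝ) :=
  der_of_operand (.const r) fun _ _ => rfl

lemma der_op (op : ArithOp) {k : Θ → ℝ} (hk : ∀ θ, op.eval (f θ) (g θ) = some (k θ))
    (hf : Der inp c S f) (hg : Der inp c' S g) : Der inp (c + c' + 1) S k := by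
  refine (hf.union hg).cut ?_
  intro p hp hS
  obtain ⟨o₁, h₁⟩ := hS f (by simp)
  obtain ⟨o₂, h₂⟩ := hS g (by simp)
  have hrun : ∀ θ mem, run (inp θ) p [] = some mem →
      run (inp θ) (p ++ [⟨op, o₁, o₂⟩]) [] = some (mem ++ [k θ]) := fun θ mem hmem => by
    rw [run_append, hmem]
    simp [run, h₁ θ mem hmem, h₂ θ mem hmem, hk]
  refine ⟨[⟨op, o₁, o₂⟩], fun θ => ?_, le_rfl, fun k' hk' => ?_⟩
  · obtain ⟨mem, hmem⟩ := hp θ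
    exact ⟨_, hrun θ mem hmem⟩
  · rw [Set.mem_singleton_iff.1 hk']
    refine ⟨.reg p.length, fun θ mem' hmem' => ?_⟩
    obtain ⟨mem, hmem⟩ := hp θ
    rw [hrun θ mem hmem] at hmem'
    cases hmem'
    have := (run_prefix hmem).2
    simp only [List.length_nil, zero_add] at this
    simp [Operand.eval, ← this]

lemma Derives.add (hf : Der inp c S f) (hg : Der inp c' S g) :
    Der inp (c + c' + 1) S fun θ => f θ + g θ := der_op .add (fun _ => rfl) hf hg

lemma Derives.sub (hf : Der inp c S f) (hg : Der inp c' S g) :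
    Der inp (c + c' + 1) S fun θ => f θ - g θ := der_op .sub (fun _ => rfl) hf hg

lemma Derives.mul (hf : Der inp c S f) (hg : Der inp c' S g) :
    Der inp (c + c' + 1) S fun θ => f θ * g θ := der_op .mul (fun _ => rfl) hf hg

lemma Derives.div (hf : Der inp c S f) (hg : Der inp c' S g) (h0 : ∀ θ, g θ ≠ 0) :
    Der inp (c + c' + 1) S fun θ => f θ / g θ :=
  der_op .div (fun θ => by simp [ArithOp.eval, h0 θ]) hf hg

lemma der_sum {m : ℕ} {f : Fin m → Θ → ℝ} (h : ∀ i, Der inp c S (f i)) :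
    Der inp (m * (c + 1)) S fun θ => ∑ i, f i θ := by
  induction m with
  | zero => exact ((der_const 0).mono (by simp)).congr fun θ => by simp
  | succ m ih =>
    exact (((ih fun i => h i.castSucc).add (h (Fin.last m))).mono
      (c' := (m + 1) * (c + 1)) (by rw [Nat.succ_mul]; omega)).congr fun θ =>
      (Fin.sum_univ_castSucc fun i => f i θ).symm

lemma der_dotProduct {m : ℕ} {f g : Θ → Fin m → ℝ} (hf : ∀ i, Der inp c S fun θ => f θ i)
    (hg : ∀ i, Der inp c' S fun θ => g θ i) :
    Der inp (m * (c + c' + 2)) S fun θ => f θ ⬝ᵥ g θ :=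
  der_sum fun i => (hf i).mul (hg i)

/-- From derivability from nothing to one program that computes all targets. -/
lemma Derives.exists_computes {Out : Type} {tgt : Out → Θ → ℝ}
    (h : Derives inp c ∅ (Set.range tgt)) :
    ∃ (p : List (Instr In)) (out : Out → Operand In), p.length ≤ c ∧
      ∀ θ, Computes p out (inp θ) fun o => tgt o θ := by
  obtain ⟨q, hq, hqc, hqT⟩ := h [] (fun θ => ⟨[], rfl⟩) fun _ hf => hf.elim
  rw [List.nil_append] at hq hqT
  choose out hout using fun o => hqT (tgt o) ⟨o, rfl⟩
  refine ⟨q, out, hqc, fun θ => ?_⟩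
  obtain ⟨mem, hmem⟩ := hq θ
  exact ⟨mem, hmem, fun o => hout o θ mem hmem⟩

end ProgramCalculus

/-! ### Rank-one updates of positive definite matrices -/

section RankOne

variable {ι : Type*} [Fintype ι] [DecidableEq ι] {M : Matrix ι ι ℝ}

/-- The Sherman–Morrison formula. -/
lemma inv_add_smul_vecMulVec (hM : IsUnit M) {s : ℝ} {u : ι → ℝ}
    (h : 1 + s * (u ⬝ᵥ (M⁻¹ *ᵥ u)) ≠ 0) :
    (M + s • vecMulVec u u)⁻¹ = M⁻¹ - (s / (1 + s * (u ⬝ᵥ (M⁻¹ *ᵥ u)))) •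
      (M⁻¹ * vecMulVec u u * M⁻¹) := by
  have hdet := (Matrix.isUnit_iff_isUnit_det M).1 hM
  set q := u ⬝ᵥ (M⁻¹ *ᵥ u)
  set t := s / (1 + s * q)
  have ht : s - t - s * t * q = 0 := by simp only [t]; field_simp; ring
  have hU : vecMulVec u u * M⁻¹ * (vecMulVec u u * M⁻¹) = q • (vecMulVec u u * M⁻¹) := by
    rw [← Matrix.mul_assoc, vecMulVec_mul, vecMulVec_mul_vecMulVec, ← dotProduct_mulVec,
      vecMulVec_smul, Matrix.smul_mul, vecMulVec_mul]
  refine Matrix.inv_eq_right_inv ?_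
  rw [Matrix.mul_sub, Matrix.add_mul, Matrix.mul_nonsing_inv M hdet, Matrix.mul_smul,
    Matrix.add_mul, Matrix.mul_assoc M⁻¹, Matrix.mul_nonsing_inv_cancel_left M _ hdet,
    Matrix.smul_mul, Matrix.smul_mul,
    show vecMulVec u u * (M⁻¹ * (vecMulVec u u * M⁻¹)) = q • (vecMulVec u u * M⁻¹) by
      rw [← Matrix.mul_assoc, hU]]
  rw [show 1 + s • (vecMulVec u u * M⁻¹) - t • (vecMulVec u u * M⁻¹ +
    s • q • (vecMulVec u u * M⁻¹)) = 1 + (s - t - s * t * q) • (vecMulVec u u * M⁻¹) by module,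
    ht, zero_smul, add_zero]

lemma _root_.Matrix.PosDef.dotProduct_pos (hM : M.PosDef) {x : ι → ℝ} (hx : x ≠ 0) :
    0 < x ⬝ᵥ (M *ᵥ x) := by
  simpa using hM.dotProduct_mulVec_pos hx

lemma _root_.Matrix.PosSemidef.dotProduct_nonneg (hM : M.PosSemidef) (x : ι → ℝ) :
    0 ≤ x ⬝ᵥ (M *ᵥ x) := by
  simpa using hM.dotProduct_mulVec_nonneg x

lemma dotProduct_mulVec_comm (hM : M.IsHermitian) (x y : ι → ℝ) :
    x ⬝ᵥ (M *ᵥ y) = y ⬝ᵥ (M *ᵥ x) := by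
  have hT : Mᵀ = M := Matrix.isHermitian_iff_isSymm.1 hM
  rw [dotProduct_mulVec, ← mulVec_transpose, hT, dotProduct_comm]

lemma posSemidef_vecMulVec_self (u : ι → ℝ) : (vecMulVec u u).PosSemidef := by
  simpa using Matrix.posSemidef_vecMulVec_self_star u

lemma dotProduct_vecMulVec_mulVec (u v x y : ι → ℝ) :
    x ⬝ᵥ (vecMulVec u v *ᵥ y) = (x ⬝ᵥ u) * (v ⬝ᵥ y) := by
  rw [vecMulVec_mulVec, dotProduct_smul]
  rfl

/-- A rank-one downdate of a positive definite matrix is only positive definite if the denominator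
in the Sherman–Morrison formula is positive. -/
lemma _root_.Matrix.PosDef.one_sub_pos (hM : M.PosDef) {t : ℝ} {v : ι → ℝ}
    (h : (M - t • vecMulVec v v).PosDef) : 0 < 1 - t * (v ⬝ᵥ (M⁻¹ *ᵥ v)) := by
  have hdet := (Matrix.isUnit_iff_isUnit_det M).1 hM.isUnit
  set w := M⁻¹ *ᵥ v with hw
  have hMw : M *ᵥ w = v := by rw [hw, mulVec_mulVec, Matrix.mul_nonsing_inv M hdet, one_mulVec]
  by_cases h0 : w = 0
  · simp [h0]
  have h1 := hM.dotProduct_pos h0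
  have h2 := h.dotProduct_pos h0
  rw [hMw] at h1
  rw [sub_mulVec, hMw, dotProduct_sub, smul_mulVec, dotProduct_smul, dotProduct_vecMulVec_mulVec,
    dotProduct_comm w v, smul_eq_mul,
    show v ⬝ᵥ w - t * (v ⬝ᵥ w * (v ⬝ᵥ w)) = (v ⬝ᵥ w) * (1 - t * (v ⬝ᵥ w)) by ring] at h2
  rw [dotProduct_comm] at h1
  exact (mul_pos_iff_of_pos_left h1).1 h2

/-- Bilinear form of the Sherman–Morrison inverse. -/
lemma dotProduct_sub_smul_mulVec (W : Matrix ι ι ℝ) (t : ℝ) (u x y : ι → ℝ) :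
    x ⬝ᵥ ((W - t • (W * vecMulVec u u * W)) *ᵥ y) =
      x ⬝ᵥ (W *ᵥ y) - t * ((x ⬝ᵥ (W *ᵥ u)) * (u ⬝ᵥ (W *ᵥ y))) := by
  rw [sub_mulVec, dotProduct_sub, smul_mulVec, dotProduct_smul, smul_eq_mul, mul_vecMulVec,
    vecMulVec_mul, dotProduct_vecMulVec_mulVec, ← dotProduct_mulVec]

lemma dotProduct_add_smul_mulVec (W : Matrix ι ι ℝ) (t : ℝ) (u x y : ι → ℝ) :
    x ⬝ᵥ ((W + t • (W * vecMulVec u u * W)) *ᵥ y) =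
      x ⬝ᵥ (W *ᵥ y) + t * ((x ⬝ᵥ (W *ᵥ u)) * (u ⬝ᵥ (W *ᵥ y))) := by
  have h := dotProduct_sub_smul_mulVec W (-t) u x y
  rw [neg_smul, sub_neg_eq_add] at h
  rw [h]
  ring

end RankOne

/-! ### Basis expansion: the rank-two update -/

namespace BasisDesign

variable {n K : ℕ} (B : BasisDesign n K)

lemma updateRow_gram (Z : Matrix (Fin n) (Fin K) ℝ) (i : Fin n) (w : Fin K → ℝ) :
    (Z.updateRow i w)ᵀ * Z.updateRow i w =
      Zᵀ * Z - vecMulVec (Z i) (Z i) + vecMulVec w w := by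
  ext k l
  simp only [Matrix.mul_apply, Matrix.transpose_apply, Matrix.add_apply, Matrix.sub_apply,
    vecMulVec_apply]
  rw [← Finset.add_sum_erase _ _ (Finset.mem_univ i),
    ← Finset.add_sum_erase _ (fun j => Z j k * Z j l) (Finset.mem_univ i)]
  simp only [Matrix.updateRow_self, add_sub_cancel_left]
  rw [add_comm]
  congr 1
  refine Finset.sum_congr rfl fun j hj => ?_
  rw [Matrix.updateRow_ne (Finset.ne_of_mem_erase hj)]

lemma posDef_gram_add {m : Type*} [Fintype m] (X : Matrix m (Fin K) ℝ) (hV : B.V.PosDef) :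
    (Xᵀ * X + B.V⁻¹).PosDef := by
  rw [add_comm]
  refine hV.inv.add_posSemidef ?_
  simpa using Matrix.posSemidef_conjTranspose_mul_self X

lemma posDef_A (hV : B.V.PosDef) : B.A.PosDef := B.posDef_gram_add B.Z hV

lemma posDef_Aswap (hV : B.V.PosDef) (i : Fin n) : (B.Aswap i).PosDef := B.posDef_gram_add _ hV

lemma Aswap_eq (i : Fin n) :
    B.Aswap i = B.A - vecMulVec (B.Z i) (B.Z i) + vecMulVec B.zNew B.zNew := by
  rw [Aswap, updateRow_gram, A]
  abel

lemma posDef_A_sub (hV : B.V.PosDef) (i : Fin n) :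
    (B.A - vecMulVec (B.Z i) (B.Z i)).PosDef := by
  have h := B.posDef_gram_add (B.Z.updateRow i 0) hV
  rw [updateRow_gram, zero_vecMulVec, add_zero] at h
  rwa [A, add_sub_right_comm]

lemma one_sub_lev_pos (hV : B.V.PosDef) (i : Fin n) : 0 < 1 - B.lev i := by
  have h := (B.posDef_A hV).one_sub_pos (t := 1) (v := B.Z i)
    (by rw [one_smul]; exact B.posDef_A_sub hV i)
  rwa [one_mul] at h

lemma downdate_eq (hV : B.V.PosDef) (i : Fin n) :
    B.downdate i = (B.A - vecMulVec (B.Z i) (B.Z i))⁻¹ := by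
  have hpos := B.one_sub_lev_pos hV i
  have h := inv_add_smul_vecMulVec (B.posDef_A hV).isUnit (s := -1) (u := B.Z i)
    (by rw [neg_one_mul, ← sub_eq_add_neg]; exact hpos.ne')
  rw [neg_one_smul, ← sub_eq_add_neg, neg_one_mul, ← sub_eq_add_neg, neg_div, neg_smul,
    sub_neg_eq_add, one_div] at h
  exact h.symm

lemma posDef_downdate (hV : B.V.PosDef) (i : Fin n) : (B.downdate i).PosDef := by
  rw [B.downdate_eq hV]
  exact (B.posDef_A_sub hV i).inv

lemma one_add_downdate_pos (hV : B.V.PosDef) (i : Fin n) :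
    0 < 1 + B.zNew ⬝ᵥ (B.downdate i *ᵥ B.zNew) := by
  have := (B.posDef_downdate hV i).posSemidef.dotProduct_nonneg B.zNew
  linarith

lemma Aswap_inv (hV : B.V.PosDef) (i : Fin n) :
    (B.Aswap i)⁻¹ = B.downdate i - (1 + B.zNew ⬝ᵥ (B.downdate i *ᵥ B.zNew))⁻¹ •
      (B.downdate i * vecMulVec B.zNew B.zNew * B.downdate i) := by
  have hpos := B.one_add_downdate_pos hV i
  rw [B.downdate_eq hV] at hpos ⊢
  have h := inv_add_smul_vecMulVec (B.posDef_A_sub hV i).isUnit (s := 1) (u := B.zNew)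
    (by rw [one_mul]; exact hpos.ne')
  rw [one_smul, one_mul, one_div] at h
  rw [Aswap_eq, h]

theorem rankTwoUpdate (hV : B.V.PosDef) : B.RankTwoUpdate := fun i =>
  ⟨(B.posDef_A hV).isUnit, (B.posDef_Aswap hV i).isUnit, B.Aswap_eq i, B.one_sub_lev_pos hV i,
    B.one_add_downdate_pos hV i, B.Aswap_inv hV i⟩

/-- The bilinear form of the downdated inverse. -/
lemma dotProduct_downdate (i : Fin n) (x y : Fin K → ℝ) :
    x ⬝ᵥ (B.downdate i *ᵥ y) = x ⬝ᵥ (B.A⁻¹ *ᵥ y) +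
      (1 - B.lev i)⁻¹ * ((x ⬝ᵥ (B.A⁻¹ *ᵥ B.Z i)) * (B.Z i ⬝ᵥ (B.A⁻¹ *ᵥ y))) :=
  dotProduct_add_smul_mulVec _ _ _ _ _

lemma dotProduct_downdate_self (hV : B.V.PosDef) (i : Fin n) (y : Fin K → ℝ) :
    B.Z i ⬝ᵥ (B.downdate i *ᵥ y) = B.Z i ⬝ᵥ (B.A⁻¹ *ᵥ y) / (1 - B.lev i) := by
  have := (B.one_sub_lev_pos hV i).ne'
  rw [dotProduct_downdate, ← lev]
  field_simp
  ring

end BasisDesign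

/-! ### Posterior mean and variance: function space and weight space -/

section GPAlgebra

variable {𝒳 : Type u} {ι : Type} [Fintype ι] [DecidableEq ι] {k : 𝒳 → 𝒳 → ℝ} {σ2 : ℝ≥0}

/-- The kernel `k` is symmetric and positive semidefinite, on families of points. -/
def IsPSDKernel (k : 𝒳 → 𝒳 → ℝ) : Prop :=
  ∀ {ι : Type} [Fintype ι] (x : ι → 𝒳), (Matrix.of fun i j => k (x i) (x j)).PosSemidef

lemma posDef_gpSigma (hk : IsPSDKernel k) (hσ : 0 < σ2) (x : ι → 𝒳) :
    (gpSigma k σ2 x).PosDef := by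
  rw [gpSigma, add_comm]
  exact (Matrix.PosDef.one.smul (show (0 : ℝ) < σ2 from hσ)).add_posSemidef (hk x)

lemma IsPSDKernel.symm (hk : IsPSDKernel k) (s t : 𝒳) : k s t = k t s := by
  have h := (hk (ι := Bool) fun b => if b then s else t).isHermitian.apply true false
  simpa using h.symm

/-- The posterior variance of a Gaussian process is nonnegative. -/
lemma gpVar_nonneg (hk : IsPSDKernel k) (hσ : 0 < σ2) (x : ι → 𝒳) (s : 𝒳) :
    0 ≤ gpVar k σ2 x s := by
  have hdet := (Matrix.isUnit_iff_isUnit_det _).1 (posDef_gpSigma hk hσ x).isUnit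
  set k₀ : ι → ℝ := fun j => k s (x j) with hk₀
  set b := (gpSigma k σ2 x)⁻¹ *ᵥ k₀ with hb
  have hS : gpSigma k σ2 x *ᵥ b = k₀ := by
    rw [hb, mulVec_mulVec, Matrix.mul_nonsing_inv _ hdet, one_mulVec]
  have hK : Matrix.of (fun i j => k (x i) (x j)) *ᵥ b = k₀ - (σ2 : ℝ) • b := by
    rw [← hS, gpSigma, add_mulVec, smul_mulVec, one_mulVec, add_sub_cancel_right]
  -- test the joint kernel matrix on `(1, -b)`
  have h := (hk (ι := Option ι) fun o => o.elim s x).dotProduct_nonneg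
    (fun o => o.elim 1 fun j => -b j)
  have hrow : ∀ j, ∑ l, k (x j) (x l) * b l = k₀ j - σ2 * b j := fun j => by
    simpa [mulVec, dotProduct] using congrFun hK j
  have hbb : 0 ≤ ∑ j, b j * b j := Finset.sum_nonneg fun j _ => mul_self_nonneg _
  simp only [dotProduct, mulVec, Fintype.sum_option, Option.elim, Matrix.of_apply, one_mul, mul_one,
    mul_neg, Finset.sum_neg_distrib, hrow, neg_mul] at h
  have hsym : ∀ j, k (x j) s = k₀ j := fun j => hk.symm _ _
  simp only [hsym] at h
  have e : ∑ j, b j * (k₀ j + -(k₀ j - σ2 * b j)) = σ2 * ∑ j, b j * b j := by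
    rw [Finset.mul_sum]
    exact Finset.sum_congr rfl fun j _ => by ring
  rw [e] at h
  have hσ' : 0 ≤ (σ2 : ℝ) * ∑ j, b j * b j := mul_nonneg σ2.2 hbb
  have e2 : k₀ ⬝ᵥ b = ∑ j, k s (x j) * b j := rfl
  rw [gpVar, ← hk₀, ← hb, e2]
  linarith

end GPAlgebra

/-! ### Gaussian process regression: the rank-two update and the leave-one-out formulas -/

lemma sum_eq_add_sum_ne {n : ℕ} (i : Fin n) (g : Fin n → ℝ) :
    ∑ j, g j = g i + ∑ j : {j : Fin n // j ≠ i}, g j :=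
  Fintype.sum_eq_add_sum_subtype_ne g i

section GPMean

variable {𝒳 : Type u} {ι : Type} [Fintype ι] [DecidableEq ι] {k : 𝒳 → 𝒳 → ℝ} {σ2 : ℝ≥0}

lemma measurable_gpMean (m : 𝒳 → ℝ) (k : 𝒳 → 𝒳 → ℝ) (σ2 : ℝ≥0) (x : ι → 𝒳) (s : 𝒳) :
    Measurable fun y : ι → ℝ => gpMean m k σ2 x y s := by
  simp only [gpMean, dotProduct, mulVec]
  fun_prop

lemma gpSigma_mulVec_inv (hk : IsPSDKernel k) (hσ : 0 < σ2) (x : ι → 𝒳) (w : ι → ℝ) :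
    gpSigma k σ2 x *ᵥ ((gpSigma k σ2 x)⁻¹ *ᵥ w) = w := by
  have hdet := (Matrix.isUnit_iff_isUnit_det _).1 (posDef_gpSigma hk hσ x).isUnit
  rw [mulVec_mulVec, Matrix.mul_nonsing_inv _ hdet, one_mulVec]

lemma gpSigma_inv_mulVec (hk : IsPSDKernel k) (hσ : 0 < σ2) (x : ι → 𝒳) (w : ι → ℝ) :
    (gpSigma k σ2 x)⁻¹ *ᵥ (gpSigma k σ2 x *ᵥ w) = w := by
  have hdet := (Matrix.isUnit_iff_isUnit_det _).1 (posDef_gpSigma hk hσ x).isUnit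
  rw [mulVec_mulVec, Matrix.nonsing_inv_mul _ hdet, one_mulVec]

/-- The posterior mean through the weights `b = Σ⁻¹ k(x₀)`. -/
lemma gpMean_eq_of_weights (hk : IsPSDKernel k) (hσ : 0 < σ2) (m : 𝒳 → ℝ) (x : ι → 𝒳)
    (y : ι → ℝ) (s : 𝒳) {b : ι → ℝ} (hb : gpSigma k σ2 x *ᵥ b = fun j => k s (x j)) :
    gpMean m k σ2 x y s = m s + b ⬝ᵥ fun j => y j - m (x j) := by
  rw [gpMean, dotProduct_mulVec_comm (posDef_gpSigma hk hσ x).inv.isHermitian, ← hb,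
    gpSigma_inv_mulVec hk hσ, dotProduct_comm]

lemma gpVar_eq_of_weights (hk : IsPSDKernel k) (hσ : 0 < σ2) (x : ι → 𝒳) (s : 𝒳) {b : ι → ℝ}
    (hb : gpSigma k σ2 x *ᵥ b = fun j => k s (x j)) :
    gpVar k σ2 x s = k s s - (fun j => k s (x j)) ⬝ᵥ b := by
  have h : (gpSigma k σ2 x)⁻¹ *ᵥ (fun j => k s (x j)) = b := by
    rw [← hb, gpSigma_inv_mulVec hk hσ]
  rw [gpVar, h]

end GPMean

namespace GPDesign

variable {𝒳 : Type u} {n : ℕ} {B : GPDesign 𝒳 n}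

lemma IsKernel.isPSDKernel (hB : B.IsKernel) : IsPSDKernel B.k := by
  classical
  intro ι _ x
  exact (hB (Finset.univ.image x)).submatrix
    fun i => ⟨x i, Finset.mem_image_of_mem _ (Finset.mem_univ i)⟩

lemma xSwap_self (i : Fin n) : B.xSwap i i = B.xNew := Function.update_self ..

lemma xSwap_of_ne {i j : Fin n} (h : j ≠ i) : B.xSwap i j = B.x j := Function.update_of_ne h ..

lemma SigSwap_eq (hk : IsPSDKernel B.k) (i : Fin n) :
    B.SigSwap i = B.Sig + vecMulVec (Pi.single i 1) (B.shift i) +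
      vecMulVec (B.shift i) (Pi.single i 1) := by
  ext j l
  simp only [SigSwap, Sig, gpSigma, Matrix.add_apply, Matrix.of_apply, vecMulVec_apply]
  by_cases hj : j = i <;> by_cases hl : l = i
  · subst hj
    subst hl
    simp only [xSwap_self, Pi.single_eq_same, shift, if_true]
    ring
  · subst hj
    simp only [xSwap_self, xSwap_of_ne hl, Pi.single_eq_same, Pi.single_eq_of_ne hl, shift, hl,
      if_false]
    ring
  · subst hl
    simp only [xSwap_self, xSwap_of_ne hj, Pi.single_eq_same, Pi.single_eq_of_ne hj, shift, hj,
      if_false, hk.symm (B.x j)]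
    ring
  · simp only [xSwap_of_ne hj, xSwap_of_ne hl, Pi.single_eq_of_ne hj, Pi.single_eq_of_ne hl]
    ring

/-- Polarisation turns the symmetric rank-two term into a difference of two squares. -/
lemma SigSwap_eq_polarised (hk : IsPSDKernel B.k) (i : Fin n) :
    B.SigSwap i = B.Sig +
      (1 / 2 : ℝ) • vecMulVec (Pi.single i 1 + B.shift i) (Pi.single i 1 + B.shift i) -
      (1 / 2 : ℝ) • vecMulVec (Pi.single i 1 - B.shift i) (Pi.single i 1 - B.shift i) := by
  rw [SigSwap_eq hk]
  ext j l
  simp only [Matrix.add_apply, Matrix.sub_apply, Matrix.smul_apply, vecMulVec_apply, Pi.add_apply,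
    Pi.sub_apply, smul_eq_mul]
  ring

theorem rankTwoUpdate (hB : B.IsKernel) (hσ : 0 < B.σ2) : B.RankTwoUpdate := by
  intro i e u v
  have hk : IsPSDKernel B.k := hB.isPSDKernel
  have hS : B.Sig.PosDef := posDef_gpSigma hk hσ _
  have hS' : (B.SigSwap i).PosDef := posDef_gpSigma hk hσ _
  have hq : 0 ≤ u ⬝ᵥ (B.Sig⁻¹ *ᵥ u) := hS.inv.posSemidef.dotProduct_nonneg u
  set M := B.Sig + (1 / 2 : ℝ) • vecMulVec u u with hM
  have hMpos : M.PosDef :=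
    hS.add_posSemidef ((posSemidef_vecMulVec_self u).smul (by norm_num : (0 : ℝ) ≤ 1 / 2))
  have hswap : B.SigSwap i = M - (1 / 2 : ℝ) • vecMulVec v v := SigSwap_eq_polarised hk i
  have h1 : M⁻¹ = B.update1 i := by
    rw [hM, inv_add_smul_vecMulVec hS.isUnit (by positivity), update1]
    congr 2
    change _ = (2 + u ⬝ᵥ (B.Sig⁻¹ *ᵥ u))⁻¹
    field_simp
  have hv : 0 < 1 - 1 / 2 * (v ⬝ᵥ (B.update1 i *ᵥ v)) := by
    rw [← h1]
    exact hMpos.one_sub_pos (hswap ▸ hS')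
  have hv' : 0 < 2 - v ⬝ᵥ (B.update1 i *ᵥ v) := by linarith
  refine ⟨hS.isUnit, hS'.isUnit, SigSwap_eq hk i, by positivity, hv', ?_⟩
  have h2 := inv_add_smul_vecMulVec hMpos.isUnit (s := -(1 / 2)) (u := v) (by
    rw [h1]
    exact (by linarith : 0 < 1 + -(1 / 2) * (v ⬝ᵥ (B.update1 i *ᵥ v))).ne')
  rw [neg_smul, ← sub_eq_add_neg, ← hswap, h1] at h2
  rw [h2, sub_eq_add_neg, ← neg_smul]
  congr 2
  have := hv'.ne'
  rw [show 1 + -(1 / 2) * (v ⬝ᵥ (B.update1 i *ᵥ v)) = (2 - v ⬝ᵥ (B.update1 i *ᵥ v)) / 2 by ring]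
  field_simp

/-- The leave-one-out weights `b` enter through `β = (1, -b)`, for which `Σₙ β` is a multiple of
`eᵢ`; so `β` is proportional to the `i`-th column of `Σₙ⁻¹`. -/
theorem looFormulas (hB : B.IsKernel) (hσ : 0 < B.σ2) : B.LooFormulas := by
  intro y i
  have hk : IsPSDKernel B.k := hB.isPSDKernel
  have hS : B.Sig.PosDef := posDef_gpSigma hk hσ _
  have hpos : 0 < B.Sig⁻¹ i i := hS.inv.diag_pos
  set x' : {j : Fin n // j ≠ i} → 𝒳 := fun j => B.x j with hx'
  set k₀ : {j : Fin n // j ≠ i} → ℝ := fun j => B.k (B.x i) (x' j) with hk₀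
  set b := (gpSigma B.k B.σ2 x')⁻¹ *ᵥ k₀ with hb
  have hSb : gpSigma B.k B.σ2 x' *ᵥ b = k₀ := gpSigma_mulVec_inv hk hσ x' k₀
  have hmean := gpMean_eq_of_weights hk hσ B.m x' (fun j => y j) (B.x i) hSb
  have hvar := gpVar_eq_of_weights hk hσ x' (B.x i) hSb
  set s := gpVar B.k B.σ2 x' (B.x i) + B.σ2 with hs
  set r : Fin n → ℝ := fun j => y j - B.m (B.x j) with hr
  set β : Fin n → ℝ := fun j => if h : j = i then 1 else -b ⟨j, h⟩ with hβ
  have hβi : β i = 1 := by simp [hβ]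
  have hβj : ∀ j : {j : Fin n // j ≠ i}, β j = -b j := fun j => by simp [hβ, j.2]
  have hSβ : B.Sig *ᵥ β = s • Pi.single i 1 := by
    ext l
    rw [mulVec, dotProduct, sum_eq_add_sum_ne i, hβi]
    simp only [hβj]
    by_cases hl : l = i
    · subst hl
      have e : ∀ j : {j : Fin n // j ≠ l}, B.Sig l j * -b j = -(k₀ j * b j) := fun j => by
        simp [Sig, gpSigma, hk₀, hx', Matrix.one_apply_ne j.2.symm]
      simp only [e, Finset.sum_neg_distrib]
      simp only [hs, hvar, dotProduct, Sig, gpSigma, Pi.smul_apply, Pi.single_eq_same,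
        Matrix.add_apply, Matrix.of_apply, Matrix.smul_apply, Matrix.one_apply_eq, smul_eq_mul]
      ring
    · have e : ∀ j : {j : Fin n // j ≠ i}, B.Sig l j * -b j =
          -(gpSigma B.k B.σ2 x' ⟨l, hl⟩ j * b j) := fun j => by
        simp [Sig, gpSigma, hx', Matrix.one_apply, Subtype.ext_iff]
      have h2 := congrFun hSb ⟨l, hl⟩
      rw [mulVec, dotProduct] at h2
      simp only [e, Finset.sum_neg_distrib, h2]
      simp [Sig, gpSigma, hk₀, hx', hl, hk.symm (B.x i)]
  have hβW : β = s • (B.Sig⁻¹ *ᵥ Pi.single i 1) := by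
    rw [← mulVec_smul, ← hSβ]
    exact (gpSigma_inv_mulVec hk hσ B.x β).symm
  have hcol : ∀ w : Fin n → ℝ, w ⬝ᵥ (B.Sig⁻¹ *ᵥ Pi.single i 1) = (B.Sig⁻¹ *ᵥ w) i := fun w => by
    rw [dotProduct_mulVec_comm hS.inv.isHermitian, single_one_dotProduct]
  have h1 : 1 = s * B.Sig⁻¹ i i := by
    have := congrFun hβW i
    rw [hβi] at this
    simpa using this
  have hs1 : s = 1 / B.Sig⁻¹ i i := by
    rw [eq_div_iff hpos.ne']
    exact h1.symm
  refine ⟨hpos, ?_, hs1⟩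
  have h3 : r ⬝ᵥ β = s * (B.Sig⁻¹ *ᵥ r) i := by rw [hβW, dotProduct_smul, hcol, smul_eq_mul]
  rw [dotProduct, sum_eq_add_sum_ne i, hβi] at h3
  simp only [hβj, mul_neg, mul_one, Finset.sum_neg_distrib] at h3
  have h4 : (b ⬝ᵥ fun j : {j : Fin n // j ≠ i} => y j - B.m (x' j)) =
      ∑ j : {j : Fin n // j ≠ i}, r j * b j :=
    Finset.sum_congr rfl fun j _ => mul_comm _ _
  change gpMean B.m B.k B.σ2 x' (fun j => y j) (B.x i) = _
  rw [hmean, h4]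
  have h5 : s * (B.Sig⁻¹ *ᵥ r) i = (B.Sig⁻¹ *ᵥ r) i / B.Sig⁻¹ i i := by rw [hs1]; ring
  rw [← h5, ← h3]
  simp only [hr]
  ring

/-- The swapped predictive mean is affine in the candidate value. -/
lemma gpMean_xSwap (y : Fin n → ℝ) (i : Fin n) (a : ℝ) :
    gpMean B.m B.k B.σ2 (B.xSwap i) (Function.update y i a) (B.x i) = B.c y i + B.d i * a := by
  have e : (fun j => Function.update y i a j - B.m (B.xSwap i j)) =
      (fun j => Function.update y i 0 j - B.m (B.xSwap i j)) + a • Pi.single i 1 := by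
    ext j
    by_cases hj : j = i
    · subst hj
      simp
      ring
    · simp [hj]
  change B.m (B.x i) + B.kSwap i ⬝ᵥ ((B.SigSwap i)⁻¹ *ᵥ _) = _
  rw [e, mulVec_add, dotProduct_add, mulVec_smul, dotProduct_smul, dotProduct_mulVec _ _
    (Pi.single i 1), dotProduct_single_one, c, d, smul_eq_mul]
  ring

lemma measurable_disc (i : Fin n) :
    Measurable fun y => B.affineForm.m2 y i - B.affineForm.c y i := by
  refine Measurable.sub ?_ ?_
  · exact (measurable_gpMean B.m B.k B.σ2 _ _).comp (by fun_prop)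
  · have h : ∀ y, B.affineForm.c y i =
        gpMean B.m B.k B.σ2 (B.xSwap i) (Function.update y i 0) (B.x i) := fun y => by
      rw [gpMean_xSwap, mul_zero, add_zero]
      rfl
    simp only [h]
    refine (measurable_gpMean B.m B.k B.σ2 _ _).comp (measurable_pi_lambda _ fun j => ?_)
    by_cases hj : j = i
    · subst hj
      simp
    · simp only [Function.update_of_ne hj]
      fun_prop

end GPDesign

/-! ### Basis expansion: weight space and function space -/

section WeightSpace

variable {𝒳 : Type u} {K : ℕ} {ι : Type} [Fintype ι] [DecidableEq ι]

/-- The covariance kernel `σ2 φ(s)ᵀ V φ(t)` of the random function `∑ₖ βₖ φₖ`. -/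
def basisKernel (φ : Fin K → 𝒳 → ℝ) (V : Matrix (Fin K) (Fin K) ℝ) (σ2 : ℝ≥0) (s t : 𝒳) : ℝ :=
  σ2 * ((fun k => φ k s) ⬝ᵥ (V *ᵥ fun k => φ k t))

/-- The mean function `φ(s)ᵀ β0` of the random function `∑ₖ βₖ φₖ`. -/
def basisMean (φ : Fin K → 𝒳 → ℝ) (β0 : Fin K → ℝ) (s : 𝒳) : ℝ := (fun k => φ k s) ⬝ᵥ β0

variable {φ : Fin K → 𝒳 → ℝ} {β0 : Fin K → ℝ} {V : Matrix (Fin K) (Fin K) ℝ} {σ2 : ℝ≥0}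

lemma isPSDKernel_basisKernel (hV : V.PosDef) : IsPSDKernel (basisKernel φ V σ2) := by
  intro ι _ x
  have h := ((hV.posSemidef.mul_mul_conjTranspose_same
    (Matrix.of fun (i : ι) k => φ k (x i))).smul (α := ℝ) σ2.2)
  convert h using 1
  ext i j
  rw [Matrix.smul_apply, Matrix.mul_assoc, Matrix.mul_apply', Matrix.of_apply, basisKernel]
  rfl

/-- The weights of the data in the posterior mean are `X Λ⁻¹ φ(x₀)`, with `Λ = XᵀX + V⁻¹`. -/
lemma gpSigma_basisKernel_mulVec (hV : V.PosDef) (x : ι → 𝒳) (s : 𝒳)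
    {Λ : Matrix (Fin K) (Fin K) ℝ} {X : Matrix ι (Fin K) ℝ}
    (hX : X = Matrix.of fun i k => φ k (x i)) (hΛ : Λ = Xᵀ * X + V⁻¹) (hΛu : IsUnit Λ) :
    gpSigma (basisKernel φ V σ2) σ2 x *ᵥ (X *ᵥ (Λ⁻¹ *ᵥ fun k => φ k s)) =
      fun j => basisKernel φ V σ2 s (x j) := by
  have hdet := (Matrix.isUnit_iff_isUnit_det _).1 hΛu
  have hVdet := (Matrix.isUnit_iff_isUnit_det _).1 hV.isUnit
  set φ₀ : Fin K → ℝ := fun k => φ k s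
  have h1 : gpSigma (basisKernel φ V σ2) σ2 x = (σ2 : ℝ) • (X * V * Xᵀ + 1) := by
    rw [gpSigma, smul_add]
    congr 1
    ext i j
    rw [Matrix.smul_apply, Matrix.mul_assoc, Matrix.mul_apply', Matrix.of_apply, basisKernel, hX]
    rfl
  have h2 : (X * V * Xᵀ + 1) * X = X * V * Λ := by
    rw [hΛ, Matrix.mul_add, Matrix.add_mul, Matrix.mul_assoc (X * V) Xᵀ X, Matrix.mul_assoc X V V⁻¹,
      Matrix.mul_nonsing_inv _ hVdet, Matrix.mul_one, Matrix.one_mul]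
  rw [h1, smul_mulVec, mulVec_mulVec, h2, mulVec_mulVec, Matrix.mul_assoc,
    Matrix.mul_nonsing_inv _ hdet, Matrix.mul_one, ← mulVec_mulVec]
  ext j
  rw [basisKernel, dotProduct_mulVec_comm hV.isHermitian, Pi.smul_apply, hX]
  rfl

lemma gpMean_basis (hV : V.PosDef) (hσ : 0 < σ2) (x : ι → 𝒳) (y : ι → ℝ) (s : 𝒳)
    {Λ : Matrix (Fin K) (Fin K) ℝ} {X : Matrix ι (Fin K) ℝ}
    (hX : X = Matrix.of fun i k => φ k (x i)) (hΛ : Λ = Xᵀ * X + V⁻¹) (hΛp : Λ.PosDef) :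
    gpMean (basisMean φ β0) (basisKernel φ V σ2) σ2 x y s =
      (fun k => φ k s) ⬝ᵥ (Λ⁻¹ *ᵥ (Xᵀ *ᵥ y + V⁻¹ *ᵥ β0)) := by
  have hdet := (Matrix.isUnit_iff_isUnit_det _).1 hΛp.isUnit
  rw [gpMean_eq_of_weights (isPSDKernel_basisKernel hV) hσ _ x y s
    (gpSigma_basisKernel_mulVec hV x s hX hΛ hΛp.isUnit)]
  set φ₀ : Fin K → ℝ := fun k => φ k s
  have hr : (fun j => y j - basisMean φ β0 (x j)) = y - X *ᵥ β0 := by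
    ext j
    rw [hX]
    rfl
  have h0 : basisMean φ β0 s = φ₀ ⬝ᵥ (Λ⁻¹ *ᵥ (Λ *ᵥ β0)) := by
    rw [mulVec_mulVec, Matrix.nonsing_inv_mul _ hdet, one_mulVec]
    rfl
  have h1 : (X *ᵥ (Λ⁻¹ *ᵥ φ₀)) ⬝ᵥ (y - X *ᵥ β0) = φ₀ ⬝ᵥ (Λ⁻¹ *ᵥ (Xᵀ *ᵥ (y - X *ᵥ β0))) := by
    rw [dotProduct_mulVec_comm hΛp.inv.isHermitian, dotProduct_comm, dotProduct_mulVec,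
      ← mulVec_transpose]
  rw [hr, h0, h1, ← dotProduct_add, ← mulVec_add, hΛ, mulVec_sub, add_mulVec, mulVec_mulVec]
  congr 2
  abel

lemma gpVar_basis (hV : V.PosDef) (hσ : 0 < σ2) (x : ι → 𝒳) (s : 𝒳)
    {Λ : Matrix (Fin K) (Fin K) ℝ} {X : Matrix ι (Fin K) ℝ}
    (hX : X = Matrix.of fun i k => φ k (x i)) (hΛ : Λ = Xᵀ * X + V⁻¹) (hΛp : Λ.PosDef) :
    gpVar (basisKernel φ V σ2) σ2 x s + σ2 =
      σ2 * (1 + (fun k => φ k s) ⬝ᵥ (Λ⁻¹ *ᵥ fun k => φ k s)) := by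
  have hdet := (Matrix.isUnit_iff_isUnit_det _).1 hΛp.isUnit
  have hVdet := (Matrix.isUnit_iff_isUnit_det _).1 hV.isUnit
  rw [gpVar_eq_of_weights (isPSDKernel_basisKernel hV) hσ x s
    (gpSigma_basisKernel_mulVec hV x s hX hΛ hΛp.isUnit)]
  set φ₀ : Fin K → ℝ := fun k => φ k s with hφ₀
  have hk : (fun j => basisKernel φ V σ2 s (x j)) = (σ2 : ℝ) • (X *ᵥ (V *ᵥ φ₀)) := by
    ext j
    rw [basisKernel, dotProduct_mulVec_comm hV.isHermitian, hX]
    rfl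
  have h1 : (X *ᵥ (V *ᵥ φ₀)) ⬝ᵥ (X *ᵥ (Λ⁻¹ *ᵥ φ₀)) =
      (V *ᵥ φ₀) ⬝ᵥ ((Xᵀ * X) *ᵥ (Λ⁻¹ *ᵥ φ₀)) := by
    rw [← mulVec_mulVec, dotProduct_mulVec _ Xᵀ, vecMul_transpose]
  have h2 : (Xᵀ * X) *ᵥ (Λ⁻¹ *ᵥ φ₀) = φ₀ - V⁻¹ *ᵥ (Λ⁻¹ *ᵥ φ₀) := by
    rw [show Xᵀ * X = Λ - V⁻¹ by rw [hΛ]; abel, sub_mulVec, mulVec_mulVec,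
      Matrix.mul_nonsing_inv _ hdet, one_mulVec]
  have h3 : (V *ᵥ φ₀) ⬝ᵥ (V⁻¹ *ᵥ (Λ⁻¹ *ᵥ φ₀)) = φ₀ ⬝ᵥ (Λ⁻¹ *ᵥ φ₀) := by
    rw [dotProduct_mulVec_comm hV.inv.isHermitian, mulVec_mulVec, Matrix.nonsing_inv_mul _ hVdet,
      one_mulVec, dotProduct_comm]
  rw [hk, smul_dotProduct, h1, h2, dotProduct_sub, h3, dotProduct_comm (V *ᵥ φ₀), basisKernel,
    smul_eq_mul, ← hφ₀]
  ring

end WeightSpace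

section BasisLaws

variable {𝒳 : Type u} {n K : ℕ} {φ : Fin K → 𝒳 → ℝ} {β0 : Fin K → ℝ}
  {V : Matrix (Fin K) (Fin K) ℝ} {σ2 : ℝ≥0} {x : Fin n → 𝒳} {xNew : 𝒳}

lemma gram_loo (i : Fin n) (X : Matrix {j : Fin n // j ≠ i} (Fin K) ℝ)
    (hX : X = Matrix.of fun (j : {j : Fin n // j ≠ i}) k => φ k (x j)) :
    (basisDesign φ β0 V x xNew).A -
        vecMulVec ((basisDesign φ β0 V x xNew).Z i) ((basisDesign φ β0 V x xNew).Z i) = Xᵀ * X + V⁻¹ := by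
  rw [BasisDesign.A, add_sub_right_comm]
  congr 1
  ext k l
  rw [Matrix.sub_apply, Matrix.mul_apply, Matrix.mul_apply, sum_eq_add_sum_ne i, hX,
    vecMulVec_apply]
  exact add_sub_cancel_left _ _

lemma gpMean_basis_loo (hV : V.PosDef) (hσ : 0 < σ2) (y : Fin n → ℝ) (i : Fin n) :
    gpMean (basisMean φ β0) (basisKernel φ V σ2) σ2 (fun j : {j : Fin n // j ≠ i} => x j)
      (fun j => y j) (x i) = ((basisDesign φ β0 V x xNew).affineForm σ2).m2 y i := by
  set X : Matrix {j : Fin n // j ≠ i} (Fin K) ℝ := Matrix.of fun j k => φ k (x j) with hX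
  have hpos : 0 < 1 - (basisDesign φ β0 V x xNew).lev i :=
    (basisDesign φ β0 V x xNew).one_sub_lev_pos hV i
  rw [gpMean_basis hV hσ _ _ _ hX (gram_loo i X hX) ((basisDesign φ β0 V x xNew).posDef_A_sub hV i),
    ← (basisDesign φ β0 V x xNew).downdate_eq hV i]
  have hy : Xᵀ *ᵥ (fun j => y j) =
      (basisDesign φ β0 V x xNew).Zᵀ *ᵥ y - y i • (basisDesign φ β0 V x xNew).Z i := by
    ext k
    rw [Pi.sub_apply, mulVec, mulVec, dotProduct, dotProduct, sum_eq_add_sum_ne i,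
      Pi.smul_apply, smul_eq_mul]
    simp only [Matrix.transpose_apply]
    rw [mul_comm (y i), add_sub_cancel_left]
    rfl
  have e : Xᵀ *ᵥ (fun j => y j) + V⁻¹ *ᵥ β0 =
      (basisDesign φ β0 V x xNew).Zᵀ *ᵥ y + V⁻¹ *ᵥ β0 -
        y i • (basisDesign φ β0 V x xNew).Z i := by
    rw [hy]
    abel
  have h := (basisDesign φ β0 V x xNew).dotProduct_downdate_self hV i
    ((basisDesign φ β0 V x xNew).Zᵀ *ᵥ y + V⁻¹ *ᵥ β0 - y i • (basisDesign φ β0 V x xNew).Z i)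
  rw [e]
  refine h.trans ?_
  rw [mulVec_sub, dotProduct_sub, mulVec_smul, dotProduct_smul, smul_eq_mul, mul_comm (y i)]
  rfl

lemma gpVar_basis_loo (hV : V.PosDef) (hσ : 0 < σ2) (i : Fin n) :
    gpVar (basisKernel φ V σ2) σ2 (fun j : {j : Fin n // j ≠ i} => x j) (x i) + σ2 =
      ((basisDesign φ β0 V x xNew).affineForm σ2).v2 i := by
  set X : Matrix {j : Fin n // j ≠ i} (Fin K) ℝ := Matrix.of fun j k => φ k (x j) with hX
  have hpos : 0 < 1 - (basisDesign φ β0 V x xNew).lev i :=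
    (basisDesign φ β0 V x xNew).one_sub_lev_pos hV i
  rw [gpVar_basis hV hσ _ _ hX (gram_loo (β0 := β0) (xNew := xNew) i X hX)
    ((basisDesign φ β0 V x xNew).posDef_A_sub hV i), ← (basisDesign φ β0 V x xNew).downdate_eq hV i]
  have h : (fun k => φ k (x i)) ⬝ᵥ ((basisDesign φ β0 V x xNew).downdate i *ᵥ fun k => φ k (x i)) =
      (basisDesign φ β0 V x xNew).lev i / (1 - (basisDesign φ β0 V x xNew).lev i) :=
    (basisDesign φ β0 V x xNew).dotProduct_downdate_self hV i ((basisDesign φ β0 V x xNew).Z i)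
  have hv : ((basisDesign φ β0 V x xNew).affineForm σ2).v2 i =
      σ2 / (1 - (basisDesign φ β0 V x xNew).lev i) := rfl
  rw [h, hv]
  field_simp
  ring

lemma of_update_eq_updateRow (i : Fin n) :
    (basisDesign φ β0 V x xNew).Z.updateRow i (basisDesign φ β0 V x xNew).zNew =
      Matrix.of fun j k => φ k (Function.update x i xNew j) := by
  ext j k
  by_cases hj : j = i
  · subst hj
    simp [basisDesign]
  · simp [basisDesign, hj]

lemma gpMean_basis_swap (hV : V.PosDef) (hσ : 0 < σ2) (y : Fin n → ℝ) (i : Fin n) (a : ℝ) :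
    gpMean (basisMean φ β0) (basisKernel φ V σ2) σ2 (Function.update x i xNew)
      (Function.update y i a) (x i) =
      ((basisDesign φ β0 V x xNew).affineForm σ2).c y i +
        ((basisDesign φ β0 V x xNew).affineForm σ2).d i * a := by
  rw [gpMean_basis hV hσ _ _ _ (of_update_eq_updateRow (β0 := β0) (V := V) i) rfl
    ((basisDesign φ β0 V x xNew).posDef_Aswap hV i)]
  have e : ((basisDesign φ β0 V x xNew).Z.updateRow i (basisDesign φ β0 V x xNew).zNew)ᵀ *ᵥ
        Function.update y i a =
      (∑ j ∈ Finset.univ.erase i, y j • (basisDesign φ β0 V x xNew).Z j) +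
        a • (basisDesign φ β0 V x xNew).zNew := by
    ext k
    rw [mulVec, dotProduct, ← Finset.add_sum_erase _ _ (Finset.mem_univ i), Pi.add_apply,
      Finset.sum_apply, add_comm]
    simp only [Matrix.transpose_apply, Matrix.updateRow_self, Function.update_self, Pi.smul_apply,
      smul_eq_mul, mul_comm a]
    congr 1
    refine Finset.sum_congr rfl fun j hj => ?_
    have hj := Finset.ne_of_mem_erase hj
    rw [Matrix.updateRow_ne hj, Function.update_of_ne hj, mul_comm]
  change (basisDesign φ β0 V x xNew).Z i ⬝ᵥ (((basisDesign φ β0 V x xNew).Aswap i)⁻¹ *ᵥ _) =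
    (basisDesign φ β0 V x xNew).c y i + (basisDesign φ β0 V x xNew).d i * a
  rw [e, add_right_comm, mulVec_add, dotProduct_add, mulVec_smul, dotProduct_smul, smul_eq_mul,
    mul_comm a]
  rfl

lemma gpVar_basis_swap (hV : V.PosDef) (hσ : 0 < σ2) (i : Fin n) :
    gpVar (basisKernel φ V σ2) σ2 (Function.update x i xNew) (x i) + σ2 =
      ((basisDesign φ β0 V x xNew).affineForm σ2).v1 i :=
  gpVar_basis hV hσ _ _ (of_update_eq_updateRow (β0 := β0) (V := V) i) rfl
    ((basisDesign φ β0 V x xNew).posDef_Aswap hV i)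

lemma measurable_disc_basis (B : BasisDesign n K) (i : Fin n) :
    Measurable fun y => (B.affineForm σ2).m2 y i - (B.affineForm σ2).c y i := by
  simp only [BasisDesign.affineForm, BasisDesign.c, BasisDesign.βhat, dotProduct, mulVec,
    Pi.add_apply, Finset.sum_apply, Pi.smul_apply]
  fun_prop

end BasisLaws

/-! ### The posterior predictive law of a Gaussian process -/

section GaussianBayes

variable {Ω : Type v} [MeasurableSpace Ω] {𝒳 : Type u} {P : Measure Ω} {f : 𝒳 → Ω → ℝ}

/-- Finite linear combinations of the values of a Gaussian process are Gaussian. -/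
lemma hasGaussianLaw_linearCombination (hf : IsGaussianProcess f P) {κ : Type} [Fintype κ]
    (x : κ → 𝒳) (c : κ → ℝ) : HasGaussianLaw (fun ω => ∑ j, c j * f (x j) ω) P := by
  classical
  let L : (Finset.univ.image x → ℝ) →L[ℝ] ℝ :=
    ∑ j, c j • ContinuousLinearMap.proj ⟨x j, Finset.mem_image_of_mem x (Finset.mem_univ j)⟩
  have h := (hf.hasGaussianLaw (Finset.univ.image x)).map_fun L
  convert! h using 2 with ω
  simp [L]

/-- The characteristic function of a finite linear combination of the values of a Gaussian
process. -/
lemma integral_cexp_linearCombination (hf : IsGaussianProcess f P) {m : 𝒳 → ℝ}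
    {k : 𝒳 → 𝒳 → ℝ} (hm : ∀ s, ∫ ω, f s ω ∂P = m s) (hk : ∀ s t, cov[f s, f t; P] = k s t)
    {κ : Type} [Fintype κ] (x : κ → 𝒳) (c : κ → ℝ) :
    ∫ ω, Complex.exp ((∑ j, c j * f (x j) ω : ℝ) * Complex.I) ∂P =
      Complex.exp ((∑ j, c j * m (x j) : ℝ) * Complex.I -
        (∑ i, ∑ j, c i * c j * k (x i) (x j) : ℝ) / 2) := by
  have : IsProbabilityMeasure P := hf.isProbabilityMeasure
  have hL := hasGaussianLaw_linearCombination hf x c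
  have hmem : ∀ s, MemLp (f s) 2 P := fun s => (hf.hasGaussianLaw_eval s).memLp_two
  have hmem' : ∀ j, MemLp (fun ω => c j * f (x j) ω) 2 P := fun j => (hmem _).const_mul _
  have hmean : ∫ ω, ∑ j, c j * f (x j) ω ∂P = ∑ j, c j * m (x j) := by
    rw [integral_finsetSum _ fun j _ => ((hmem' j).integrable (by norm_num))]
    exact Finset.sum_congr rfl fun j _ => by rw [integral_const_mul, hm]
  have hvar : Var[fun ω => ∑ j, c j * f (x j) ω; P] = ∑ i, ∑ j, c i * c j * k (x i) (x j) := by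
    rw [variance_fun_sum hmem']
    refine Finset.sum_congr rfl fun i _ => Finset.sum_congr rfl fun j _ => ?_
    rw [covariance_const_mul_left, covariance_const_mul_right, hk]
    ring
  have h := hL.charFun_map_eq 1
  rw [charFun_apply_real, integral_map hL.aemeasurable (by fun_prop)] at h
  simpa [hmean, hvar] using h

/-- A Gaussian density is the Fourier transform of a Gaussian, here for a product of densities. -/
lemma exists_prod_gaussianPDFReal_eq_integral {ι : Type} [Fintype ι] {v : ℝ≥0} (hv : 0 < v) :
    ∃ C : ℂ, ∀ z y : ι → ℝ, ((∏ j, gaussianPDFReal (z j) v (y j) : ℝ) : ℂ) =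
      C * ∫ ξ : ι → ℝ, Complex.exp (-((v : ℂ) / 2) * ∑ j, (ξ j : ℂ) ^ 2 +
        ∑ j, (Complex.I * (y j - z j)) * ξ j) := by
  have hv0 : (v : ℂ) ≠ 0 := by exact_mod_cast hv.ne'
  have hre : 0 < ((v : ℂ) / 2).re := by
    have : ((v : ℂ) / 2).re = (v : ℝ) / 2 := by simp
    rw [this]
    exact half_pos hv
  refine ⟨(∏ _j : ι, ((√(2 * Real.pi * v))⁻¹ : ℝ)) /
    (Real.pi / ((v : ℂ) / 2)) ^ (Fintype.card ι / 2 : ℂ), fun z y => ?_⟩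
  have hpi : (Real.pi / ((v : ℂ) / 2)) ^ (Fintype.card ι / 2 : ℂ) ≠ 0 := by
    refine Complex.cpow_ne_zero_iff.2 (Or.inl ?_)
    have hpi : (Real.pi : ℂ) ≠ 0 := by exact_mod_cast Real.pi_ne_zero
    exact div_ne_zero hpi (div_ne_zero hv0 two_ne_zero)
  rw [GaussianFourier.integral_cexp_neg_mul_sum_add hre fun j => Complex.I * (y j - z j),
    ← mul_assoc, div_mul_cancel₀ _ hpi]
  simp only [gaussianPDFReal, Finset.prod_mul_distrib, ← Real.exp_sum]
  push_cast
  congr 2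
  rw [Finset.sum_div]
  refine Finset.sum_congr rfl fun j _ => ?_
  rw [mul_pow, Complex.I_sq]
  field_simp
  ring

variable {m : 𝒳 → ℝ} {k : 𝒳 → 𝒳 → ℝ} {ι : Type} [Fintype ι]

/-- The covariance of a Gaussian process is a kernel. -/
lemma isPSDKernel_covariance (hf : IsGaussianProcess f P) (hk : ∀ s t, cov[f s, f t; P] = k s t) :
    IsPSDKernel k := by
  intro ι _ x
  have : IsProbabilityMeasure P := hf.isProbabilityMeasure
  have hmem : ∀ s, MemLp (f s) 2 P := fun s => (hf.hasGaussianLaw_eval s).memLp_two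
  refine Matrix.PosSemidef.of_dotProduct_mulVec_nonneg ?_ fun c => ?_
  · ext i j
    simp [← hk, covariance_comm (f (x i))]
  · have h := variance_nonneg (fun ω => ∑ j, c j * f (x j) ω) P
    rw [variance_fun_sum fun j => (hmem (x j)).const_mul (c j)] at h
    simp only [covariance_const_mul_left, covariance_const_mul_right, hk] at h
    simpa [dotProduct, mulVec, Finset.mul_sum, mul_comm, mul_left_comm] using h

/-- Fourier representation of the likelihood-weighted characteristic function of `f s`: the
likelihood is written as a Fourier integral over frequencies `ξ`, and the prior expectation is
taken first. -/
lemma exists_integral_likelihood_mul_cexp [DecidableEq ι] (hf : IsGaussianProcess f P)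
    (hm : ∀ s, ∫ ω, f s ω ∂P = m s) (hk : ∀ s t, cov[f s, f t; P] = k s t) {v : ℝ≥0} (hv : 0 < v)
    (x : ι → 𝒳) (y : ι → ℝ) (s : 𝒳) :
    ∃ C : ℂ, ∀ t : ℝ,
      ∫ ω, ((∏ j, gaussianPDFReal (f (x j) ω) v (y j) : ℝ) : ℂ) *
          Complex.exp ((t * f s ω : ℝ) * Complex.I) ∂P =
        C * ∫ ξ : ι → ℝ, Complex.exp (((t * m s + ξ ⬝ᵥ fun j => y j - m (x j)) : ℝ) * Complex.I -
          ((t ^ 2 * k s s - 2 * t * (ξ ⬝ᵥ fun j => k s (x j)) +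
            ξ ⬝ᵥ (gpSigma k v x *ᵥ ξ) : ℝ) : ℂ) / 2) := by
  have : IsProbabilityMeasure P := hf.isProbabilityMeasure
  have hpsd : IsPSDKernel k := isPSDKernel_covariance hf hk
  have hsym : ∀ r, k r s = k s r := fun r => hpsd.symm r s
  obtain ⟨C, hC⟩ := exists_prod_gaussianPDFReal_eq_integral (ι := ι) hv
  refine ⟨C, fun t => ?_⟩
  have hre : 0 < ((v : ℂ) / 2).re := by
    have : ((v : ℂ) / 2).re = (v : ℝ) / 2 := by simp
    rw [this]
    exact half_pos hv
  set g : Ω → (ι → ℝ) → ℂ := fun ω ξ => Complex.exp (-((v : ℂ) / 2) * ∑ j, (ξ j : ℂ) ^ 2 +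
    ∑ j, (Complex.I * (y j - f (x j) ω)) * ξ j) * Complex.exp ((t * f s ω : ℝ) * Complex.I) with hg
  have hmeas : ∀ r, AEMeasurable (fun q : Ω × (ι → ℝ) => f r q.1) (P.prod volume) :=
    fun r => (hf.aemeasurable r).comp_fst
  have hint : Integrable (Function.uncurry g) (P.prod volume) := by
    have h0 := (GaussianFourier.integrable_cexp_neg_mul_sum_add (ι := ι) hre 0).comp_snd P
    refine h0.mono ?_ (ae_of_all _ fun q => le_of_eq ?_)
    · have h1 := hmeas s
      have h2 := fun j => hmeas (x j)
      refine AEMeasurable.aestronglyMeasurable ?_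
      simp only [hg, Function.uncurry_def]
      refine AEMeasurable.mul (Complex.measurable_exp.comp_aemeasurable ?_)
        (Complex.measurable_exp.comp_aemeasurable ?_)
      · refine AEMeasurable.add (by fun_prop) (Finset.aemeasurable_fun_sum _ fun j _ => ?_)
        have := (Complex.measurable_ofReal.comp_aemeasurable (h2 j))
        simp only [Function.comp_def] at this
        fun_prop
      · have := (Complex.measurable_ofReal.comp_aemeasurable (h1.const_mul t))
        simp only [Function.comp_def] at this
        fun_prop
    · simp only [hg, Function.uncurry_def, norm_mul, Complex.norm_exp]
      simp [← Complex.ofReal_sub, ← Complex.ofReal_pow]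
  have hinner : ∀ ξ : ι → ℝ, ∫ ω, g ω ξ ∂P =
      Complex.exp (((t * m s + ξ ⬝ᵥ fun j => y j - m (x j)) : ℝ) * Complex.I -
          ((t ^ 2 * k s s - 2 * t * (ξ ⬝ᵥ fun j => k s (x j)) +
            ξ ⬝ᵥ (gpSigma k v x *ᵥ ξ) : ℝ) : ℂ) / 2) := fun ξ => by
    have h := integral_cexp_linearCombination hf hm hk (fun o : Option ι => o.elim s x)
      (fun o => o.elim t fun j => -ξ j)
    have h1 : (ξ ⬝ᵥ fun j => y j - m (x j)) = ∑ j, ξ j * y j - ∑ j, ξ j * m (x j) := by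
      simp only [dotProduct, mul_sub, Finset.sum_sub_distrib]
    have h2 : ξ ⬝ᵥ (gpSigma k v x *ᵥ ξ) =
        ∑ i, ∑ j, ξ i * ξ j * k (x i) (x j) + v * ∑ j, ξ j ^ 2 := by
      rw [gpSigma, add_mulVec, dotProduct_add, smul_mulVec, one_mulVec, dotProduct_smul]
      simp only [dotProduct, mulVec, Finset.mul_sum, Matrix.of_apply, smul_eq_mul]
      congr 1
      · exact Finset.sum_congr rfl fun i _ => Finset.sum_congr rfl fun j _ => by ring
      · exact Finset.sum_congr rfl fun j _ => by ring
    have h3 : ∑ o : Option ι, ∑ o' : Option ι, (o.elim t fun j => -ξ j) *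
        (o'.elim t fun j => -ξ j) * k (o.elim s x) (o'.elim s x) =
        t ^ 2 * k s s - 2 * t * (ξ ⬝ᵥ fun j => k s (x j)) +
          ∑ i, ∑ j, ξ i * ξ j * k (x i) (x j) := by
      simp only [Fintype.sum_option, Option.elim, Finset.sum_add_distrib, dotProduct,
        Finset.mul_sum, hsym, neg_mul, mul_neg,
        Finset.sum_neg_distrib]
      have e : ∀ j, 2 * t * (ξ j * k s (x j)) = t * ξ j * k s (x j) + ξ j * t * k s (x j) :=
        fun j => by ring
      simp only [e, Finset.sum_add_distrib]
      ring
    have h4 : ∀ ω, g ω ξ = Complex.exp ((∑ j, ξ j * y j : ℝ) * Complex.I -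
        (v * ∑ j, ξ j ^ 2 : ℝ) / 2) *
        Complex.exp ((∑ o : Option ι, (o.elim t fun j => -ξ j) * f (o.elim s x) ω : ℝ) *
          Complex.I) := fun ω => by
      simp only [hg]
      rw [← Complex.exp_add, ← Complex.exp_add]
      congr 1
      have e : ∀ j, Complex.I * (y j - f (x j) ω) * ξ j =
        (ξ j * y j : ℂ) * Complex.I - ξ j * f (x j) ω * Complex.I := fun j => by ring
      simp only [e, Fintype.sum_option, Option.elim, Finset.sum_sub_distrib, neg_mul,
        Finset.sum_neg_distrib, ← Finset.sum_mul]
      push_cast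
      ring
    simp only [h4]
    rw [integral_const_mul, h, h3, h2, h1, ← Complex.exp_add]
    congr 1
    simp only [Fintype.sum_option, Option.elim, neg_mul, Finset.sum_neg_distrib]
    push_cast
    ring
  calc _ = ∫ ω, (C * ∫ ξ, g ω ξ) ∂P := by
        refine integral_congr_ae (ae_of_all _ fun ω => ?_)
        simp only [hg]
        rw [integral_mul_const, ← mul_assoc, ← hC]
    _ = C * ∫ ξ, (∫ ω, g ω ξ ∂P) := by
        rw [integral_const_mul, integral_integral_swap hint]
    _ = _ := by simp only [hinner]

/-- Translating the frequencies by `t Σ⁻¹ k(s)` separates the factor that depends on `t`. -/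
lemma integral_likelihood_mul_cexp [DecidableEq ι] (hf : IsGaussianProcess f P)
    (hm : ∀ s, ∫ ω, f s ω ∂P = m s) (hk : ∀ s t, cov[f s, f t; P] = k s t) {v : ℝ≥0} (hv : 0 < v)
    (x : ι → 𝒳) (y : ι → ℝ) (s : 𝒳) (t : ℝ) :
    ∫ ω, ((∏ j, gaussianPDFReal (f (x j) ω) v (y j) : ℝ) : ℂ) *
        Complex.exp ((t * f s ω : ℝ) * Complex.I) ∂P =
      (∫ ω, ((∏ j, gaussianPDFReal (f (x j) ω) v (y j) : ℝ) : ℂ) ∂P) *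
        Complex.exp ((t * gpMean m k v x y s : ℝ) * Complex.I -
          (gpVar k v x s * t ^ 2 : ℝ) / 2) := by
  have hpsd : IsPSDKernel k := isPSDKernel_covariance hf hk
  obtain ⟨C, hC⟩ := exists_integral_likelihood_mul_cexp hf hm hk hv x y s
  have h0 := hC 0
  simp only [zero_mul, Complex.ofReal_zero, Complex.exp_zero, mul_one] at h0
  set r : ι → ℝ := fun j => y j - m (x j) with hr
  set k₀ : ι → ℝ := fun j => k s (x j) with hk₀
  set b := (gpSigma k v x)⁻¹ *ᵥ k₀ with hb
  have hS : gpSigma k v x *ᵥ b = k₀ := gpSigma_mulVec_inv hpsd hv x k₀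
  have hsymm : ∀ ξ, b ⬝ᵥ (gpSigma k v x *ᵥ ξ) = ξ ⬝ᵥ k₀ := fun ξ => by
    rw [dotProduct_mulVec_comm (posDef_gpSigma hpsd hv x).isHermitian, hS]
  rw [hC t, h0, gpMean_eq_of_weights hpsd hv m x y s hS, gpVar_eq_of_weights hpsd hv x s hS,
    mul_assoc, ← integral_mul_const,
    ← integral_add_right_eq_self (μ := (volume : Measure (ι → ℝ))) _ (t • b)]
  congr 1
  refine integral_congr_ae (ae_of_all _ fun ξ => ?_)
  simp only
  rw [← Complex.exp_add]
  congr 1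
  have e1 : (ξ + t • b) ⬝ᵥ r = ξ ⬝ᵥ r + t * (b ⬝ᵥ r) := by
    rw [add_dotProduct, smul_dotProduct, smul_eq_mul]
  have e2 : (ξ + t • b) ⬝ᵥ k₀ = ξ ⬝ᵥ k₀ + t * (k₀ ⬝ᵥ b) := by
    rw [add_dotProduct, smul_dotProduct, smul_eq_mul, dotProduct_comm b]
  have e3 : (ξ + t • b) ⬝ᵥ (gpSigma k v x *ᵥ (ξ + t • b)) =
      ξ ⬝ᵥ (gpSigma k v x *ᵥ ξ) + 2 * t * (ξ ⬝ᵥ k₀) + t ^ 2 * (k₀ ⬝ᵥ b) := by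
    rw [mulVec_add, mulVec_smul, hS, dotProduct_add, add_dotProduct, add_dotProduct,
      dotProduct_smul, smul_dotProduct, smul_dotProduct, dotProduct_smul, hsymm,
      dotProduct_comm b k₀]
    simp only [smul_eq_mul]
    ring
  rw [e1, e2, e3]
  push_cast
  ring

/-- The characteristic function of a mixture of normal laws over their mean. -/
lemma charFun_bind_gaussianReal {μ : Measure Ω} [IsProbabilityMeasure μ] {X : Ω → ℝ}
    (hX : AEMeasurable X μ) (v : ℝ≥0) :
    IsProbabilityMeasure (μ.bind fun ω => gaussianReal (X ω) v) ∧
    ∀ t : ℝ, charFun (μ.bind fun ω => gaussianReal (X ω) v) t =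
      (∫ ω, Complex.exp ((t * X ω : ℝ) * Complex.I) ∂μ) *
        Complex.exp (-((v * t ^ 2 : ℝ) / 2)) := by
  obtain ⟨X', hX', hXX'⟩ := hX
  let κ : Kernel Ω ℝ := ⟨fun ω => gaussianReal (X' ω) v,
    measurable_gaussianReal.comp (hX'.prodMk measurable_const)⟩
  have : IsMarkovKernel κ := 
    ⟨fun ω => inferInstanceAs (IsProbabilityMeasure (gaussianReal (X' ω) v))⟩
  have hbind : μ.bind (fun ω => gaussianReal (X ω) v) = μ.bind κ :=
    Measure.bind_congr_right (hXX'.mono fun ω h => by simp only [h]; rfl)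
  rw [hbind]
  refine ⟨inferInstance, fun t => ?_⟩
  have hint : Integrable (fun q : Ω × ℝ => Complex.exp ((t * q.2 : ℝ) * Complex.I)) (μ ⊗ₘ κ) :=
    Integrable.of_bound (by fun_prop) 1
      (ae_of_all _ fun q => (Complex.norm_exp_ofReal_mul_I _).le)
  have h1 : ∀ ω, ∫ u, Complex.exp ((t * u : ℝ) * Complex.I) ∂(κ ω) =
      Complex.exp ((t * X' ω : ℝ) * Complex.I) * Complex.exp (-((v * t ^ 2 : ℝ) / 2)) := fun ω => by
    have := charFun_gaussianReal (μ := X' ω) (v := v) t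
    rw [charFun_apply_real] at this
    rw [← Complex.exp_add]
    push_cast
    rw [← sub_eq_add_neg, ← this]
    rfl
  rw [← Measure.snd_compProd, charFun_apply_real, Measure.snd,
    integral_map measurable_snd.aemeasurable (by fun_prop)]
  push_cast at hint h1 ⊢
  rw [Measure.integral_compProd hint]
  simp only [h1]
  rw [integral_mul_const]
  congr 1
  exact integral_congr_ae (hXX'.mono fun ω h => by simp [h])

/-- The posterior predictive law of a Gaussian process. -/
theorem predictive_gaussianProcess [DecidableEq ι] (hf : IsGaussianProcess f P)
    (hm : ∀ s, ∫ ω, f s ω ∂P = m s) (hk : ∀ s t, cov[f s, f t; P] = k s t) {v : ℝ≥0} (hv : 0 < v)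
    (x : ι → 𝒳) (y : ι → ℝ) (s : 𝒳) :
    predictive P f v x y s =
      gaussianReal (gpMean m k v x y s) (gpVar k v x s + v).toNNReal := by
  have : IsProbabilityMeasure P := hf.isProbabilityMeasure
  have hpsd : IsPSDKernel k := isPSDKernel_covariance hf hk
  set Lr : Ω → ℝ := fun ω => ∏ j, gaussianPDFReal (f (x j) ω) v (y j) with hLr
  have hLpos : ∀ ω, 0 < Lr ω := fun ω =>
    Finset.prod_pos fun j _ => gaussianPDFReal_pos _ _ _ hv.ne'
  have hL : likelihood f v x y = fun ω => ENNReal.ofReal (Lr ω) := by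
    ext ω
    rw [likelihood, hLr, ENNReal.ofReal_prod_of_nonneg fun j _ => gaussianPDFReal_nonneg _ _ _]
    rfl
  have hmeas : AEMeasurable Lr P := by
    refine Finset.aemeasurable_fun_prod _ fun j _ => ?_
    have h : Measurable fun z : ℝ => gaussianPDFReal z v (y j) := by
      unfold gaussianPDFReal
      fun_prop
    exact h.comp_aemeasurable (hf.aemeasurable (x j))
  have hbound : ∀ ω, ‖Lr ω‖ ≤ ∏ _j : ι, (√(2 * Real.pi * v))⁻¹ := fun ω => by
    rw [Real.norm_of_nonneg (hLpos ω).le]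
    refine Finset.prod_le_prod (fun j _ => gaussianPDFReal_nonneg _ _ _) fun j _ => ?_
    rw [gaussianPDFReal]
    refine mul_le_of_le_one_right (by positivity) (Real.exp_le_one_iff.2 ?_)
    rw [neg_div, neg_nonpos]
    positivity
  have hint : Integrable Lr P := Integrable.of_bound hmeas.aestronglyMeasurable _
    (ae_of_all _ hbound)
  set Z := ∫ ω, Lr ω ∂P with hZ
  have hZpos : 0 < Z := by
    rw [hZ, integral_pos_iff_support_of_nonneg (fun ω => (hLpos ω).le) hint]
    have : Function.support Lr = Set.univ := Set.eq_univ_of_forall fun ω => (hLpos ω).ne'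
    simp [this]
  have hZ' : ∫⁻ ω, likelihood f v x y ω ∂P = ENNReal.ofReal Z := by
    rw [hL, hZ, ofReal_integral_eq_lintegral_ofReal hint (ae_of_all _ fun ω => (hLpos ω).le)]
  set post := bayesPosterior P f v x y with hpost
  have hpost_prob : IsProbabilityMeasure post := ⟨by
    rw [hpost, bayesPosterior, Measure.smul_apply, withDensity_apply _ MeasurableSet.univ,
      Measure.restrict_univ, hZ', smul_eq_mul]
    exact ENNReal.inv_mul_cancel (by simpa using hZpos) ENNReal.ofReal_ne_top⟩
  have hac : post ≪ P := by
    rw [hpost, bayesPosterior]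
    exact (withDensity_absolutelyContinuous _ _).smul_left _
  have hpint : ∀ g : Ω → ℂ, ∫ ω, g ω ∂post = (Z : ℂ)⁻¹ * ∫ ω, (Lr ω : ℂ) * g ω ∂P := fun g => by
    rw [hpost, bayesPosterior, integral_smul_measure, hZ', hL,
      integral_withDensity_eq_integral_toReal_smul₀ hmeas.ennreal_ofReal
        (ae_of_all _ fun ω => ENNReal.ofReal_lt_top)]
    rw [ENNReal.toReal_inv, ENNReal.toReal_ofReal hZpos.le, Complex.real_smul, Complex.ofReal_inv]
    congr 1
    refine integral_congr_ae (ae_of_all _ fun ω => ?_)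
    simp only
    rw [ENNReal.toReal_ofReal (hLpos ω).le, Complex.real_smul]
  obtain ⟨hprob, hchar⟩ := charFun_bind_gaussianReal ((hf.aemeasurable s).mono_ac hac) v
  rw [predictive]
  refine Measure.ext_of_charFun ?_
  ext t
  have hZc : ∫ ω, (Lr ω : ℂ) ∂P = Z := integral_ofReal
  have hvar : (((gpVar k v x s + v).toNNReal : ℝ≥0) : ℝ) = gpVar k v x s + v :=
    Real.coe_toNNReal _ (add_nonneg (gpVar_nonneg hpsd hv x s) v.2)
  rw [hchar t, hpint, integral_likelihood_mul_cexp hf hm hk hv x y s t, hZc, ← mul_assoc,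
    inv_mul_cancel₀ (by exact_mod_cast hZpos.ne'), one_mul, charFun_gaussianReal,
    ← Complex.exp_add, hvar]
  congr 1
  push_cast
  ring

end GaussianBayes

/-! ### The predictive laws of the two models -/

section Models

variable {𝒳 : Type u} {n K : ℕ}

/-- The closed form of the divergences is a consequence of normality of the predictive laws. -/
lemma conditionsC1C2_of_gaussian {F : PredictiveFamilies n} {G : AffineForm n}
    (hv : ∀ i, 0 < G.v1 i ∧ 0 < G.v2 i)
    (hp : ∀ y i, F.loo y i = gaussianReal (G.m2 y i) (G.v2 i).toNNReal)
    (hq : ∀ y i a, F.swapped y i a = gaussianReal (G.c y i + G.d i * a) (G.v1 i).toNNReal) :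
    ConditionsC1C2 F G := by
  refine ⟨hv, fun y i => ⟨hp y i, ?_⟩, fun y i a => ⟨hq y i a, ?_, ?_⟩, fun D y i a => ?_⟩
  · rw [hp, integral_id_gaussianReal]
  · rw [hq, integral_id_gaussianReal]
  · simp only [hq, integral_id_gaussianReal]
    simpa using ((hasDerivAt_id a).const_mul (G.d i)).const_add (G.c y i)
  · have h : D.div (F.loo y i) (F.swapped y i a) = D.base (G.v2 i) (G.v1 i)
        - D.amp (G.v2 i) (G.v1 i) * Real.exp (-(kappa G D i * G.disc y i a ^ 2)) := by
      rw [hp, hq, D.div_gaussianReal (Real.toNNReal_pos.2 (hv i).1) (Real.toNNReal_pos.2 (hv i).2),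
        Real.coe_toNNReal _ (hv i).1.le, Real.coe_toNNReal _ (hv i).2.le]
      rfl
    refine ⟨?_, h⟩
    rw [h, profile_eq D hv]
    rfl

/-- The values of the random function of the basis-expansion model form a Gaussian process. -/
lemma isGaussianProcess_basis (φ : Fin K → 𝒳 → ℝ) (μ : EuclideanSpace ℝ (Fin K))
    (S : Matrix (Fin K) (Fin K) ℝ) :
    IsGaussianProcess (fun s (β : EuclideanSpace ℝ (Fin K)) => ∑ k, β k * φ k s)
      (multivariateGaussian μ S) where
  hasGaussianLaw I := by
    let L : EuclideanSpace ℝ (Fin K) →L[ℝ] (I → ℝ) := ContinuousLinearMap.pi fun s =>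
      ∑ k, φ k s • (EuclideanSpace.proj k : EuclideanSpace ℝ (Fin K) →L[ℝ] ℝ)
    have h := (IsGaussian.hasGaussianLaw_id (μ := multivariateGaussian μ S)).map_fun L
    convert! h using 2 with β
    ext s
    simp [L, mul_comm]

variable {φ : Fin K → 𝒳 → ℝ} {β0 : Fin K → ℝ} {V : Matrix (Fin K) (Fin K) ℝ} {σ2 : ℝ≥0}

lemma memLp_eval_multivariateGaussian (μ : EuclideanSpace ℝ (Fin K))
    (S : Matrix (Fin K) (Fin K) ℝ) (k : Fin K) :
    MemLp (fun β : EuclideanSpace ℝ (Fin K) => β k) 2 (multivariateGaussian μ S) :=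
  ((IsGaussian.hasGaussianLaw_id (μ := multivariateGaussian μ S)).map_fun
    (EuclideanSpace.proj k : EuclideanSpace ℝ (Fin K) →L[ℝ] ℝ)).memLp_two

lemma integral_basis (S : Matrix (Fin K) (Fin K) ℝ) (s : 𝒳) :
    ∫ β, ∑ k, β k * φ k s ∂(multivariateGaussian (WithLp.toLp 2 β0) S) = basisMean φ β0 s := by
  have hmem := memLp_eval_multivariateGaussian (WithLp.toLp 2 β0) S
  rw [integral_finsetSum _ fun k _ => ((hmem k).integrable (by norm_num)).mul_const _]
  refine Finset.sum_congr rfl fun k _ => ?_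
  have h := (EuclideanSpace.proj k : EuclideanSpace ℝ (Fin K) →L[ℝ] ℝ).integral_comp_comm
    (IsGaussian.integrable_id (μ := multivariateGaussian (WithLp.toLp 2 β0) S))
  simp only [id, integral_id_multivariateGaussian, EuclideanSpace.coe_proj] at h
  rw [integral_mul_const, h, mul_comm]

lemma covariance_basis (hV : V.PosDef) (s t : 𝒳) :
    cov[fun β : EuclideanSpace ℝ (Fin K) => ∑ k, β k * φ k s, fun β => ∑ k, β k * φ k t;
      multivariateGaussian (WithLp.toLp 2 β0) ((σ2 : ℝ) • V)] = basisKernel φ V σ2 s t := by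
  have hS : ((σ2 : ℝ) • V).PosSemidef := hV.posSemidef.smul σ2.2
  have hmem := memLp_eval_multivariateGaussian (WithLp.toLp 2 β0) ((σ2 : ℝ) • V)
  rw [covariance_fun_sum_fun_sum (fun k => (hmem k).mul_const _) fun k => (hmem k).mul_const _]
  simp only [covariance_mul_const_left, covariance_mul_const_right,
    covariance_eval_multivariateGaussian hS, Matrix.smul_apply, smul_eq_mul, basisKernel,
    dotProduct, mulVec, Finset.mul_sum]
  exact Finset.sum_congr rfl fun i _ => Finset.sum_congr rfl fun j _ => by ring

lemma predictive_basis {ι : Type} [Fintype ι] [DecidableEq ι] (hV : V.PosDef) (hσ : 0 < σ2)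
    (x : ι → 𝒳) (y : ι → ℝ) (s : 𝒳) :
    predictive (multivariateGaussian (WithLp.toLp 2 β0) ((σ2 : ℝ) • V))
      (fun x (β : EuclideanSpace ℝ (Fin K)) => ∑ k, β k * φ k x) σ2 x y s =
      gaussianReal (gpMean (basisMean φ β0) (basisKernel φ V σ2) σ2 x y s)
        (gpVar (basisKernel φ V σ2) σ2 x s + σ2).toNNReal :=
  predictive_gaussianProcess (isGaussianProcess_basis φ _ _) (integral_basis _)
    (covariance_basis hV) hσ x y s

theorem conditionsC1C2_basis (hV : V.PosDef) (hσ : 0 < σ2) (x : Fin n → 𝒳) (xNew : 𝒳) :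
    ConditionsC1C2 (basisFamilies φ β0 V σ2 x xNew)
      ((basisDesign φ β0 V x xNew).affineForm σ2) := by
  have hσ' : (0 : ℝ) < σ2 := hσ
  have hk : IsPSDKernel (basisKernel φ V σ2) := isPSDKernel_basisKernel hV
  refine conditionsC1C2_of_gaussian (fun i => ⟨?_, ?_⟩) (fun y i => ?_) fun y i a => ?_
  · rw [← gpVar_basis_swap hV hσ]
    exact add_pos_of_nonneg_of_pos (gpVar_nonneg hk hσ _ _) hσ'
  · rw [← gpVar_basis_loo hV hσ]
    exact add_pos_of_nonneg_of_pos (gpVar_nonneg hk hσ _ _) hσ'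
  · rw [← gpMean_basis_loo hV hσ, ← gpVar_basis_loo hV hσ]
    exact predictive_basis hV hσ _ _ _
  · rw [← gpMean_basis_swap hV hσ, ← gpVar_basis_swap hV hσ]
    exact predictive_basis hV hσ _ _ _

variable {B : GPDesign 𝒳 n} {Ω : Type v} [MeasurableSpace Ω] {P : Measure Ω} {f : 𝒳 → Ω → ℝ}

lemma isKernel_of_covariance (hf : IsGaussianProcess f P)
    (hk : ∀ s t, cov[f s, f t; P] = B.k s t) : B.IsKernel := by
  intro s
  -- reindex by `Fin`, as finite families of points are indexed by types in the lowest universe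
  have h := isPSDKernel_covariance hf hk fun i : Fin s.card => (s.equivFin.symm i : 𝒳)
  convert! h.submatrix s.equivFin using 1
  ext i j
  simp

theorem conditionsC1C2_gaussianProcess (hf : IsGaussianProcess f P)
    (hm : ∀ s, ∫ ω, f s ω ∂P = B.m s) (hk : ∀ s t, cov[f s, f t; P] = B.k s t) (hσ : 0 < B.σ2) :
    ConditionsC1C2 (bayesFamilies P f B.σ2 B.x B.xNew) B.affineForm := by
  have hσ' : (0 : ℝ) < B.σ2 := hσ
  have hpsd : IsPSDKernel B.k := isPSDKernel_covariance hf hk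
  refine conditionsC1C2_of_gaussian (fun i => ⟨?_, ?_⟩) (fun y i => ?_) fun y i a => ?_
  · exact add_pos_of_nonneg_of_pos (gpVar_nonneg hpsd hσ _ _) hσ'
  · exact add_pos_of_nonneg_of_pos (gpVar_nonneg hpsd hσ _ _) hσ'
  · exact predictive_gaussianProcess hf hm hk hσ _ _ _
  · have h := predictive_gaussianProcess hf hm hk hσ (B.xSwap i) (Function.update y i a) (B.x i)
    rw [GPDesign.gpMean_xSwap] at h
    exact h

end Models

/-! ### Operation counts -/

section Costs

section RankOne

variable {In : Type} {Θ : Type*} {inp : Θ → In → ℝ} {a c : ℕ} {S T U : Set (Θ → ℝ)}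

lemma Derives.subset (h : Derives inp c S T) (hU : U ⊆ T) : Derives inp c S U :=
  fun p hp hS => (h p hp hS).imp fun _ hq => ⟨hq.1, hq.2.1, fun f hf => hq.2.2 f (hU hf)⟩

/-- One entry of the bilinear form of a Sherman–Morrison downdate. -/
lemma der_rankOne_sub {xy xu uy D : Θ → ℝ} (hxy : Der inp a S xy) (hxu : Der inp a S xu)
    (huy : Der inp a S uy) (hD : Der inp a S D) (h0 : ∀ θ, D θ ≠ 0) :
    Der inp (4 * a + 3) S fun θ => xy θ - (D θ)⁻¹ * (xu θ * uy θ) :=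
  ((hxy.sub ((hxu.mul huy).div hD h0)).mono (by omega)).congr fun θ => by rw [div_eq_inv_mul]

/-- One entry of the bilinear form of a Sherman–Morrison update. -/
lemma der_rankOne_add {xy xu uy D : Θ → ℝ} (hxy : Der inp a S xy) (hxu : Der inp a S xu)
    (huy : Der inp a S uy) (hD : Der inp a S D) (h0 : ∀ θ, D θ ≠ 0) :
    Der inp (4 * a + 3) S fun θ => xy θ + (D θ)⁻¹ * (xu θ * uy θ) :=
  ((hxy.add ((hxu.mul huy).div hD h0)).mono (by omega)).congr fun θ => by rw [div_eq_inv_mul]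

/-- Targets indexed by two copies of `Fin n`, each pair derived from `S` at cost `c`. -/
lemma derives_range_sum {n : ℕ} {f g : Fin n → Θ → ℝ}
    (h : ∀ i, Derives inp c S ({f i} ∪ {g i})) :
    Derives inp (n * c) S (Set.range fun o : Fin n ⊕ Fin n => fun θ =>
      Sum.elim (fun i => f i θ) (fun i => g i θ) o) := by
  refine (derives_iUnion h).subset ?_
  rintro _ ⟨i | i, rfl⟩
  · exact Set.mem_iUnion.2 ⟨i, Or.inl rfl⟩
  · exact Set.mem_iUnion.2 ⟨i, Or.inr rfl⟩

end RankOne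

namespace BasisDesign

variable {n K : ℕ}

/-- Inputs of the programs for basis expansion: a design with positive definite prior covariance,
and a response vector. -/
abbrev Data (n K : ℕ) : Type := {q : BasisDesign n K × (Fin n → ℝ) // q.1.V.PosDef}

abbrev Data.input (θ : Data n K) : Input n K → ℝ := θ.1.1.input θ.1.2

/-- `Zᵀy + V⁻¹ β0`. -/
def Data.moment (θ : Data n K) : Fin K → ℝ := θ.1.1.Zᵀ *ᵥ θ.1.2 + θ.1.1.V⁻¹ *ᵥ θ.1.1.β0

lemma c_eq (B : BasisDesign n K) (y : Fin n → ℝ) (i : Fin n) :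
    B.c y i = B.Z i ⬝ᵥ ((B.Aswap i)⁻¹ *ᵥ
      (B.Zᵀ *ᵥ y + B.V⁻¹ *ᵥ B.β0 - y i • B.Z i)) := by
  rw [c]
  congr 2
  ext k
  have h : (B.Zᵀ *ᵥ y) k = ∑ j, y j * B.Z j k := by
    simp only [mulVec, dotProduct, Matrix.transpose_apply, mul_comm]
  rw [Pi.sub_apply, Pi.add_apply, Pi.add_apply, h, Finset.sum_apply,
    ← Finset.add_sum_erase _ _ (Finset.mem_univ i)]
  simp only [Pi.smul_apply, smul_eq_mul]
  ring

/-- The bilinear form of the swapped inverse through that of the downdated inverse. -/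
lemma dotProduct_Aswap_inv (B : BasisDesign n K) (hV : B.V.PosDef) (i : Fin n)
    (x y : Fin K → ℝ) :
    x ⬝ᵥ ((B.Aswap i)⁻¹ *ᵥ y) = x ⬝ᵥ (B.downdate i *ᵥ y) -
      (1 + B.zNew ⬝ᵥ (B.downdate i *ᵥ B.zNew))⁻¹ *
        ((x ⬝ᵥ (B.downdate i *ᵥ B.zNew)) * (B.zNew ⬝ᵥ (B.downdate i *ᵥ y))) := by
  rw [B.Aswap_inv hV, dotProduct_sub_smul_mulVec]

/-- The vectors computed once for all observations: the moment vector and `zNewᵀ A⁻¹`. -/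
def shared (n K : ℕ) : Set (Data n K → ℝ) :=
  (Set.range fun k (θ : Data n K) => θ.moment k) ∪
    Set.range fun k (θ : Data n K) => (θ.1.1.zNew ᵥ* θ.1.1.A⁻¹) k

lemma derives_shared :
    Derives (Data.input (n := n) (K := K)) (K * (n * 2 + K * 2 + 1) + K * (K * 2)) ∅
      (shared n K) := by
  have h1 : ∀ k, Der (Data.input (n := n) (K := K)) (n * 2 + K * 2 + 1) ∅
      fun θ => θ.moment k := fun k =>
    (Derives.add
      (der_dotProduct (c := 0) (c' := 0) (f := fun (θ : Data n K) j => θ.1.1.Z j k)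
        (g := fun (θ : Data n K) j => θ.1.2 j)
        (fun j => der_input (Input.feature j k)) fun j => der_input (Input.response j))
      (der_dotProduct (c := 0) (c' := 0) (f := fun (θ : Data n K) l => θ.1.1.V⁻¹ k l)
        (g := fun (θ : Data n K) l => θ.1.1.β0 l)
        (fun l => der_input (Input.priorPrecision k l))
        fun l => der_input (Input.priorMean l))).congr fun θ => rfl
  have h2 : ∀ k, Der (Data.input (n := n) (K := K)) (K * 2) ∅
      fun θ => (θ.1.1.zNew ᵥ* θ.1.1.A⁻¹) k := fun k =>
    (der_dotProduct (c := 0) (c' := 0) (f := fun (θ : Data n K) l => θ.1.1.zNew l)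
      (g := fun (θ : Data n K) l => θ.1.1.A⁻¹ l k)
      (fun l => der_input (Input.newFeature l)) fun l => der_input (Input.Ainv l k)).congr
      fun θ => rfl
  exact (derives_range h1).union (derives_range h2)

/-- Only the row vector `zᵢᵀ A⁻¹` costs a matrix–vector product; every other scalar for observation
`i` is a combination of `O(1)` inner products with it and with the shared vectors. -/
lemma derives_c_d (i : Fin n) :
    Derives (Data.input (n := n) (K := K)) (K * (K * 2) + (128 * K + 134)) (shared n K)
      ({fun θ => θ.1.1.c θ.1.2 i} ∪ {fun θ => θ.1.1.d i}) := by
  have hrow : Derives (Data.input (n := n) (K := K)) (K * (K * 2)) (shared n K)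
      (Set.range fun k (θ : Data n K) => (θ.1.1.Z i ᵥ* θ.1.1.A⁻¹) k) :=
    derives_range fun k =>
      (der_dotProduct (c := 0) (c' := 0) (f := fun (θ : Data n K) l => θ.1.1.Z i l)
        (g := fun (θ : Data n K) l => θ.1.1.A⁻¹ l k)
        (fun l => der_input (Input.feature i l)) fun l => der_input (Input.Ainv l k)).congr
        fun θ => rfl
  refine hrow.cut ?_
  set S := shared n K ∪ Set.range fun k (θ : Data n K) => (θ.1.1.Z i ᵥ* θ.1.1.A⁻¹) k
  have hmom : ∀ k, Der Data.input 0 S fun θ => θ.moment k :=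
    fun k => der_of_mem (Or.inl (Or.inl ⟨k, rfl⟩))
  have hN : ∀ k, Der Data.input 0 S fun θ => (θ.1.1.zNew ᵥ* θ.1.1.A⁻¹) k :=
    fun k => der_of_mem (Or.inl (Or.inr ⟨k, rfl⟩))
  have hz : ∀ k, Der Data.input 0 S fun θ => (θ.1.1.Z i ᵥ* θ.1.1.A⁻¹) k :=
    fun k => der_of_mem (Or.inr ⟨k, rfl⟩)
  have hfz : ∀ k, Der Data.input 0 S fun θ => θ.1.1.Z i k := fun k => der_input (Input.feature i k)
  have hfN : ∀ k, Der Data.input 0 S fun θ => θ.1.1.zNew k :=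
    fun k => der_input (Input.newFeature k)
  -- the values of the bilinear form of `A⁻¹`
  have hzz : Der Data.input (K * 2) S fun θ => θ.1.1.lev i :=
    (der_dotProduct hz hfz).congr fun θ => (dotProduct_mulVec _ _ _).symm
  have hzN : Der Data.input (K * 2) S fun θ => θ.1.1.Z i ⬝ᵥ (θ.1.1.A⁻¹ *ᵥ θ.1.1.zNew) :=
    (der_dotProduct hz hfN).congr fun θ => (dotProduct_mulVec _ _ _).symm
  have hNz : Der Data.input (K * 2) S fun θ => θ.1.1.zNew ⬝ᵥ (θ.1.1.A⁻¹ *ᵥ θ.1.1.Z i) :=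
    (der_dotProduct hN hfz).congr fun θ => (dotProduct_mulVec _ _ _).symm
  have hNN : Der Data.input (K * 2) S fun θ => θ.1.1.zNew ⬝ᵥ (θ.1.1.A⁻¹ *ᵥ θ.1.1.zNew) :=
    (der_dotProduct hN hfN).congr fun θ => (dotProduct_mulVec _ _ _).symm
  have hzs : Der Data.input (K * 2) S fun θ => θ.1.1.Z i ⬝ᵥ (θ.1.1.A⁻¹ *ᵥ θ.moment) :=
    (der_dotProduct hz hmom).congr fun θ => (dotProduct_mulVec _ _ _).symm
  have hNs : Der Data.input (K * 2) S fun θ => θ.1.1.zNew ⬝ᵥ (θ.1.1.A⁻¹ *ᵥ θ.moment) :=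
    (der_dotProduct hN hmom).congr fun θ => (dotProduct_mulVec _ _ _).symm
  have hy : Der Data.input 0 S fun θ => θ.1.2 i := der_input (Input.response i)
  let r : Data n K → Fin K → ℝ := fun θ => θ.moment - θ.1.2 i • θ.1.1.Z i
  have hzr : Der Data.input (K * 4 + 2) S fun θ => θ.1.1.Z i ⬝ᵥ (θ.1.1.A⁻¹ *ᵥ r θ) :=
    ((hzs.sub (hy.mul hzz)).mono (by omega)).congr fun θ => by
      rw [mulVec_sub, dotProduct_sub, mulVec_smul, dotProduct_smul, smul_eq_mul, lev]
  have hNr : Der Data.input (K * 4 + 2) S fun θ => θ.1.1.zNew ⬝ᵥ (θ.1.1.A⁻¹ *ᵥ r θ) :=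
    ((hNs.sub (hy.mul hNz)).mono (by omega)).congr fun θ => by
      rw [mulVec_sub, dotProduct_sub, mulVec_smul, dotProduct_smul, smul_eq_mul]
  -- the values of the bilinear form of the downdated inverse
  have hD : Der Data.input (K * 4 + 3) S fun θ => 1 - θ.1.1.lev i :=
    (((der_const 1).sub hzz).mono (by omega)).congr fun θ => by rw [Rat.cast_one]
  have hD0 : ∀ θ : Data n K, 1 - θ.1.1.lev i ≠ 0 := fun θ => (θ.1.1.one_sub_lev_pos θ.2 i).ne'
  have hdown : ∀ x y : Data n K → Fin K → ℝ,
      Der Data.input (K * 4 + 2) S (fun θ => x θ ⬝ᵥ (θ.1.1.A⁻¹ *ᵥ y θ)) →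
      Der Data.input (K * 4 + 2) S (fun θ => x θ ⬝ᵥ (θ.1.1.A⁻¹ *ᵥ θ.1.1.Z i)) →
      Der Data.input (K * 4 + 2) S (fun θ => θ.1.1.Z i ⬝ᵥ (θ.1.1.A⁻¹ *ᵥ y θ)) →
      Der Data.input (K * 16 + 15) S fun θ => x θ ⬝ᵥ (θ.1.1.downdate i *ᵥ y θ) :=
    fun x y h1 h2 h3 => ((der_rankOne_add (h1.mono (by omega)) (h2.mono (by omega))
      (h3.mono (by omega)) hD hD0).mono (by omega)).congr fun θ =>
        (θ.1.1.dotProduct_downdate i (x θ) (y θ)).symm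
  have hzz' : Der Data.input (K * 4 + 2) S
      fun θ => θ.1.1.Z i ⬝ᵥ (θ.1.1.A⁻¹ *ᵥ θ.1.1.Z i) := hzz.mono (by omega)
  have hdzN := hdown _ _ (hzN.mono (by omega)) hzz' (hzN.mono (by omega))
  have hdNN := hdown _ _ (hNN.mono (by omega)) (hNz.mono (by omega)) (hzN.mono (by omega))
  have hdzr := hdown _ _ hzr hzz' hzr
  have hdNr := hdown _ _ hNr (hNz.mono (by omega)) hzr
  -- the values of the bilinear form of the swapped inverse
  have hE : Der Data.input (K * 16 + 16) S
      fun θ => 1 + θ.1.1.zNew ⬝ᵥ (θ.1.1.downdate i *ᵥ θ.1.1.zNew) :=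
    (((der_const 1).add hdNN).mono (by omega)).congr fun θ => by rw [Rat.cast_one]
  have hE0 : ∀ θ : Data n K, 1 + θ.1.1.zNew ⬝ᵥ (θ.1.1.downdate i *ᵥ θ.1.1.zNew) ≠ 0 :=
    fun θ => (θ.1.1.one_add_downdate_pos θ.2 i).ne'
  have hc : Der Data.input (K * 64 + 67) S fun θ => θ.1.1.c θ.1.2 i :=
    ((der_rankOne_sub (hdzr.mono (by omega)) (hdzN.mono (by omega)) (hdNr.mono (by omega)) hE
      hE0).mono (by omega)).congr fun θ => by
        rw [c_eq, θ.1.1.dotProduct_Aswap_inv θ.2 i]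
        rfl
  have hd : Der Data.input (K * 64 + 67) S fun θ => θ.1.1.d i :=
    ((der_rankOne_sub (hdzN.mono (by omega)) (hdzN.mono (by omega)) (hdNN.mono (by omega)) hE
      hE0).mono (by omega)).congr fun θ => (θ.1.1.dotProduct_Aswap_inv θ.2 i _ _).symm
  exact (hc.union hd).mono (by omega)

end BasisDesign

theorem basisCost : BasisCost := by
  refine ⟨300, fun n K => ?_⟩
  rcases Nat.eq_zero_or_pos n with rfl | hn
  · exact ⟨[], fun o => .const 0, by simp, fun B y _ => ⟨[], rfl, fun o => o.elim finZeroElim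
      finZeroElim⟩⟩
  rcases Nat.eq_zero_or_pos K with rfl | hK
  · refine ⟨[], fun o => .const 0, by simp, fun B y _ => ⟨[], rfl, fun o => ?_⟩⟩
    rcases o with i | i <;> simp [Operand.eval, BasisDesign.c, BasisDesign.d]
  have h := BasisDesign.derives_shared.cut ((derives_range_sum
    (BasisDesign.derives_c_d (n := n) (K := K))).weaken Set.subset_union_right)
  obtain ⟨p, out, hp, hrun⟩ := h.exists_computes
  refine ⟨p, out, hp.trans ?_, fun B y hV => ?_⟩
  · have h1 : n * K ≤ n * K ^ 2 := Nat.mul_le_mul_left n (Nat.le_self_pow two_ne_zero K)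
    have h2 : K ^ 2 ≤ n * K ^ 2 := Nat.le_mul_of_pos_left _ hn
    have h3 : n ≤ n * K := Nat.le_mul_of_pos_right _ hK
    have h4 : K ≤ K ^ 2 := Nat.le_self_pow two_ne_zero K
    have e : K * (n * 2 + K * 2 + 1) + K * (K * 2) + n * (K * (K * 2) + (128 * K + 134)) =
        130 * (n * K) + 4 * K ^ 2 + K + 2 * (n * K ^ 2) + 134 * n := by ring
    omega
  · obtain ⟨mem, hm, ho⟩ := hrun ⟨(B, y), hV⟩
    refine ⟨mem, hm, fun o => (ho o).trans ?_⟩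
    cases o <;> rfl

namespace GPDesign

variable {n : ℕ}

/-- Inputs of the programs for Gaussian process regression: a design with a valid kernel and
positive noise variance, and a response vector. -/
def Data (n : ℕ) : Type (u + 1) :=
  Σ 𝒳 : Type u, {q : GPDesign 𝒳 n × (Fin n → ℝ) // q.1.IsKernel ∧ 0 < q.1.σ2}

abbrev Data.design (θ : Data.{u} n) : GPDesign θ.1 n := θ.2.1.1

abbrev Data.response (θ : Data.{u} n) : Fin n → ℝ := θ.2.1.2

abbrev Data.input (θ : Data.{u} n) : Input n → ℝ := θ.design.input θ.response

/-- The residuals `y - m` at the swapped design points, for the candidate value `0`. -/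
def Data.resid (θ : Data.{u} n) (i : Fin n) : Fin n → ℝ :=
  fun j => Function.update θ.response i 0 j - θ.design.m (θ.design.xSwap i j)

/-- The first update vector `eᵢ + w`. -/
def Data.u (θ : Data.{u} n) (i : Fin n) : Fin n → ℝ := Pi.single i 1 + θ.design.shift i

/-- The second update vector `eᵢ - w`. -/
def Data.v (θ : Data.{u} n) (i : Fin n) : Fin n → ℝ := Pi.single i 1 - θ.design.shift i

lemma der_single (i j : Fin n) :
    Der (Data.input.{u} (n := n)) 0 ∅ fun _ => (Pi.single i 1 : Fin n → ℝ) j := by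
  by_cases h : j = i
  · exact (der_const 1).congr fun θ => by simp [h]
  · exact (der_const 0).congr fun θ => by simp [h]

lemma der_shift (i j : Fin n) : Der Data.input.{u} 2 ∅ fun θ => θ.design.shift i j := by
  by_cases h : j = i
  · have h2 : ∀ _ : Data.{u} n, ((2 : ℚ) : ℝ) ≠ 0 := fun _ => by norm_num
    refine ((((der_input Input.kernelNewNew).sub (der_input (Input.kernel i i))).div
      (der_const 2) h2).mono (by omega)).congr fun θ => ?_
    simp [shift, h, input]
  · refine (((der_input (Input.kernelNew j)).sub (der_input (Input.kernel i j))).mono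
      (by omega)).congr fun θ => ?_
    simp [shift, h, input]

lemma der_u (i j : Fin n) : Der Data.input.{u} 3 ∅ fun θ => θ.u i j :=
  (der_single i j).add (der_shift i j)

lemma der_v (i j : Fin n) : Der Data.input.{u} 3 ∅ fun θ => θ.v i j :=
  (der_single i j).sub (der_shift i j)

lemma der_kSwap (i j : Fin n) : Der Data.input.{u} 3 ∅ fun θ => θ.design.kSwap i j := by
  by_cases h : j = i
  · subst h
    refine ((der_input (Input.kernelNew j)).mono (by omega)).congr fun θ => ?_
    have hk : IsPSDKernel θ.design.k := θ.2.2.1.isPSDKernel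
    rw [kSwap, xSwap_self, hk.symm]
    rfl
  · refine ((der_input (Input.kernel i j)).mono (by omega)).congr fun θ => ?_
    rw [kSwap, xSwap_of_ne h]
    rfl

lemma der_resid (i j : Fin n) : Der Data.input.{u} 3 ∅ fun θ => θ.resid i j := by
  by_cases h : j = i
  · subst h
    refine (((der_const 0).sub (der_input Input.meanNew)).mono (by omega)).congr fun θ => ?_
    rw [Data.resid, Function.update_self, xSwap_self, Rat.cast_zero]
    rfl
  · refine (((der_input (Input.response j)).sub (der_input (Input.mean j))).mono
      (by omega)).congr fun θ => ?_
    rw [Data.resid, Function.update_of_ne h, xSwap_of_ne h]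
    rfl

/-- A value of the bilinear form of `Σₙ⁻¹`. -/
lemma der_bilin {x y : Data.{u} n → Fin n → ℝ} (hx : ∀ j, Der Data.input 3 ∅ fun θ => x θ j)
    (hy : ∀ j, Der Data.input 3 ∅ fun θ => y θ j) :
    Der Data.input (n * (n * 5 + 5)) ∅ fun θ => x θ ⬝ᵥ (θ.design.Sig⁻¹ *ᵥ y θ) :=
  (der_dotProduct hx fun i => der_dotProduct (fun j => der_input (Input.SigInv i j)) hy).mono
    (Nat.mul_le_mul_left n (by omega))

/-- A value of the bilinear form after the first rank-one step. -/
lemma der_bilin_update1 (i : Fin n) {x y : Data.{u} n → Fin n → ℝ}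
    (hx : ∀ j, Der Data.input 3 ∅ fun θ => x θ j) (hy : ∀ j, Der Data.input 3 ∅ fun θ => y θ j) :
    Der Data.input (4 * (n * (n * 5 + 5) + 1) + 3) ∅
      fun θ => x θ ⬝ᵥ (θ.design.update1 i *ᵥ y θ) := by
  have hD : Der Data.input.{u} (n * (n * 5 + 5) + 1) ∅
      fun θ => 2 + θ.u i ⬝ᵥ (θ.design.Sig⁻¹ *ᵥ θ.u i) :=
    (((der_const 2).add (der_bilin (der_u i) (der_u i))).mono (by omega)).congr fun θ => by
      norm_num
  exact (der_rankOne_sub ((der_bilin hx hy).mono (by omega))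
    ((der_bilin hx (der_u i)).mono (by omega)) ((der_bilin (der_u i) hy).mono (by omega)) hD
    fun θ => (rankTwoUpdate θ.2.2.1 θ.2.2.2 i).2.2.2.1.ne').congr fun θ =>
      (dotProduct_sub_smul_mulVec _ _ _ _ _).symm

/-- A value of the bilinear form of the swapped inverse. -/
lemma der_bilin_SigSwap (i : Fin n) {x y : Data.{u} n → Fin n → ℝ}
    (hx : ∀ j, Der Data.input 3 ∅ fun θ => x θ j) (hy : ∀ j, Der Data.input 3 ∅ fun θ => y θ j) :
    Der Data.input (4 * (4 * (n * (n * 5 + 5) + 1) + 4) + 3) ∅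
      fun θ => x θ ⬝ᵥ ((θ.design.SigSwap i)⁻¹ *ᵥ y θ) := by
  have hD : Der Data.input.{u} (4 * (n * (n * 5 + 5) + 1) + 4) ∅
      fun θ => 2 - θ.v i ⬝ᵥ (θ.design.update1 i *ᵥ θ.v i) :=
    (((der_const 2).sub (der_bilin_update1 i (der_v i) (der_v i))).mono (by omega)).congr
      fun θ => by norm_num
  refine (der_rankOne_add ((der_bilin_update1 i hx hy).mono (by omega))
    ((der_bilin_update1 i hx (der_v i)).mono (by omega))
    ((der_bilin_update1 i (der_v i) hy).mono (by omega)) hD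
    fun θ => (rankTwoUpdate θ.2.2.1 θ.2.2.2 i).2.2.2.2.1.ne').congr fun θ => ?_
  rw [(rankTwoUpdate θ.2.2.1 θ.2.2.2 i).2.2.2.2.2]
  exact (dotProduct_add_smul_mulVec _ _ _ _ _).symm

lemma derives_c_d (i : Fin n) :
    Derives Data.input.{u} (32 * (n * (n * 5 + 5)) + 71) ∅
      ({fun θ => θ.design.c θ.response i} ∪ {fun θ => θ.design.d i}) := by
  have hc : Der Data.input.{u} (16 * (n * (n * 5 + 5)) + 36) ∅
      fun θ => θ.design.c θ.response i :=
    ((der_input (Input.mean i)).add (der_bilin_SigSwap i (der_kSwap i) (der_resid i))).mono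
      (by omega)
  have hd : Der Data.input.{u} (16 * (n * (n * 5 + 5)) + 35) ∅ fun θ => θ.design.d i :=
    ((der_bilin_SigSwap i (der_kSwap i) fun j => (der_single i j).mono (by omega)).mono
      (by omega)).congr fun θ => by rw [dotProduct_mulVec, dotProduct_single_one, d]
  exact (hc.union hd).mono (by omega)

end GPDesign

theorem gpCost : GPCost.{u} := by
  refine ⟨400, fun n => ?_⟩
  rcases Nat.eq_zero_or_pos n with rfl | hn
  · exact ⟨[], fun o => .const 0, by simp, fun 𝒳 B y _ _ => ⟨[], rfl, fun o =>
      o.elim finZeroElim finZeroElim⟩⟩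
  obtain ⟨p, out, hp, hrun⟩ := (derives_range_sum
    (GPDesign.derives_c_d.{u} (n := n))).exists_computes
  refine ⟨p, out, hp.trans ?_, fun 𝒳 B y hB hσ => ?_⟩
  · rw [Nat.mul_left_comm 400 n]
    refine Nat.mul_le_mul_left n ?_
    have h1 : n ≤ n ^ 2 := Nat.le_self_pow two_ne_zero n
    have e : 32 * (n * (n * 5 + 5)) + 71 = 160 * n ^ 2 + 160 * n + 71 := by ring
    omega
  · obtain ⟨mem, hm, ho⟩ := hrun ⟨𝒳, (B, y), hB, hσ⟩
    refine ⟨mem, hm, fun o => (ho o).trans ?_⟩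
    cases o <;> rfl

end Costs

end CPP

end

theorem mainTheorem9 :
    -- basis-expansion regression
    (∀ (𝒳 : Type u) (n K : ℕ) (φ : Fin K → 𝒳 → ℝ) (β0 : Fin K → ℝ)
      (V : Matrix (Fin K) (Fin K) ℝ) (σ2 : ℝ≥0) (x : Fin n → 𝒳) (xNew : 𝒳),
      V.PosDef → 0 < σ2 →
      CPP.ConditionsC1C2 (CPP.basisFamilies φ β0 V σ2 x xNew)
        ((CPP.basisDesign φ β0 V x xNew).affineForm σ2) ∧
      CPP.InheritedResults.{w} (CPP.basisFamilies φ β0 V σ2 x xNew)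
        ((CPP.basisDesign φ β0 V x xNew).affineForm σ2) ∧
      (CPP.basisDesign φ β0 V x xNew).RankTwoUpdate) ∧
    -- Gaussian process regression with `f ∼ GP(m, k)`
    (∀ (𝒳 : Type u) (n : ℕ) (B : CPP.GPDesign 𝒳 n) (Ω : Type v) [MeasurableSpace Ω]
      (P : Measure Ω) [IsProbabilityMeasure P] (f : 𝒳 → Ω → ℝ),
      IsGaussianProcess f P → (∀ s, ∫ ω, f s ω ∂P = B.m s) →
      (∀ s t, cov[f s, f t; P] = B.k s t) → 0 < B.σ2 →
      (∀ (y : Fin n → ℝ) (s : 𝒳), CPP.predictive P f B.σ2 B.x y s =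
        gaussianReal (CPP.gpMean B.m B.k B.σ2 B.x y s)
          (CPP.gpVar B.k B.σ2 B.x s + B.σ2).toNNReal) ∧
      CPP.ConditionsC1C2 (CPP.bayesFamilies P f B.σ2 B.x B.xNew) B.affineForm ∧
      B.LooFormulas ∧
      CPP.InheritedResults.{w} (CPP.bayesFamilies P f B.σ2 B.x B.xNew) B.affineForm ∧
      B.RankTwoUpdate) ∧
    -- operation counts
    CPP.BasisCost ∧ CPP.GPCost.{u} := by
  refine ⟨fun 𝒳 n K φ β0 V σ2 x xNew hV hσ => ?_, fun 𝒳 n B Ω _ P _ f hf hm hk hσ => ?_,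
    CPP.basisCost, CPP.gpCost⟩
  · have hC := CPP.conditionsC1C2_basis (φ := φ) (β0 := β0) hV hσ x xNew
    exact ⟨hC, hC.inheritedResults (CPP.measurable_disc_basis _),
      (CPP.basisDesign φ β0 V x xNew).rankTwoUpdate hV⟩
  · have hB := CPP.isKernel_of_covariance hf hk
    have hC := CPP.conditionsC1C2_gaussianProcess hf hm hk hσ
    exact ⟨CPP.predictive_gaussianProcess hf hm hk hσ B.x, hC, CPP.GPDesign.looFormulas hB hσ,
      hC.inheritedResults CPP.GPDesign.measurable_disc, CPP.GPDesign.rankTwoUpdate hB hσ⟩
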